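/- Let $(X,\tau)$ be a Polish space with a $\sigma$-finite Borel measure $\mathfrak m$ of full support. Let $\mathcal E$ be a strongly local symmetric Dirichlet form on $L^2(X,\mathfrak m)$ with domain $\mathbb V=D(\mathcal E)$: a densely defined, closed, nonnegative symmetric bilinear form on which every normal contraction operates, with $\mathcal E(f,g)=0$ whenever $f,g\in\mathbb V$ and $(f+a)g=0$ $\mathfrak m$-a.e. for some $a\in\mathbb R$. Assume that the semigroup generated by $\mathcal E$ is mass preserving, and that $\mathcal E$ admits a Carré du Champ $\Gamma:\mathbb V\times\mathbb V\to L^1(X,\mathfrak m)$, i.e. a positive symmetric continuous bilinear map with $$\mathcal E(f,g\varphi)+\mathcal E(g,f\varphi)-\mathcal E(fg,\varphi)=2\int_X\Gamma(f,g)\,\varphi\,d\mathfrak m\qquad\text{for all } f,g,\varphi\in\mathbb V\cap L^\infty(X,\mathfrak m).$$ Write $\Gamma(f)=\Gamma(f,f)$. Let $\Delta$ be the generator, with domain $\mathbb D\subset\mathbb V$: $f\in\mathbb D$ and $\Delta f=h\in L^2(X,\mathfrak m)$ mean that $\mathcal E(f,g)=-\int_X h\,g\,d\mathfrak m$ for every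 $g\in\mathbb V$. For $K\in\mathbb R$, $N\in[1,\infty]$ and $\nu=1/N\in[0,1]$, the condition ${\sf BE}(K,N)$ means that $$\int_X\Big(\tfrac12\Gamma(f)\,\Delta\varphi-\Gamma(f,\Delta f)\,\varphi\Big)d\mathfrak m\ \ge\ K\int_X\Gamma(f)\,\varphi\,d\mathfrak m+\nu\int_X(\Delta f)^2\varphi\,d\mathfrak m$$ for all $f\in\mathbb D$ with $\Delta f\in\mathbb V$ and all $\varphi\in\mathbb D\cap L^\infty(X,\mathfrak m)$ with $\Delta\varphi\in L^\infty(X,\mathfrak m)$ and $\varphi\ge0$. (i) If ${\sf BE}(K,\infty)$ holds, then for all $f,g,\varphi\in\mathbb D\cap L^\infty(X,\mathfrak m)$ the expression $$\frac12\int_X\Big(\Gamma(f,g)\,\Delta\varphi+\Delta f\,\Gamma(g,\varphi)+\Delta g\,\Gamma(f,\varphi)+2\varphi\,\Delta f\,\Delta g\Big)d\mathfrak m$$ is well defined, in the sense that each of its four terms is $\mathfrak m$-integrable. (ii) If ${\sf BE}(K,N)$ holds for some $N\in[1,\infty]$, then for all $f,\varphi\in\mathbb D\cap L^\infty(X,\mathfrak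 m)$ with $\varphi\ge0$ the integrals below are well defined (their integrands are $\mathfrak m$-integrable), and $$\int_X\Big(\tfrac12\Gamma(f)\,\Delta\varphi+\Delta f\,\Gamma(f,\varphi)+\varphi(\Delta f)^2\Big)d\mathfrak m\ \ge\ K\int_X\Gamma(f)\,\varphi\,d\mathfrak m+\nu\int_X(\Delta f)^2\varphi\,d\mathfrak m .$$ -/

import Mathlib

open MeasureTheory Filter Topology
open scoped ENNReal NNReal

/-- A symmetric Dirichlet form on `L²(X, μ)`: a densely defined, nonnegative, symmetric bilinear
form which is closed and on which every normal contraction operates. -/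
structure DirichletForm {X : Type*} [MeasurableSpace X] (μ : Measure X) where
  /-- The domain `D(𝓔) = 𝕍`. -/
  domain : Submodule ℝ (Lp ℝ 2 μ)
  dense_domain : Dense (domain : Set (Lp ℝ 2 μ))
  /-- The bilinear form `𝓔(f, g)`. -/
  form : domain →ₗ[ℝ] domain →ₗ[ℝ] ℝ
  symm : ∀ f g : domain, form f g = form g f
  nonneg : ∀ f : domain, 0 ≤ form f f
  closed : ∀ (u : ℕ → domain) (f : Lp ℝ 2 μ),
    Tendsto (fun n => (u n : Lp ℝ 2 μ)) atTop (𝓝 f) →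
    (∀ ε : ℝ, 0 < ε → ∃ n₀ : ℕ, ∀ m n : ℕ, n₀ ≤ m → n₀ ≤ n →
      form (u m - u n) (u m - u n) < ε) →
    ∃ hf : f ∈ domain, Tendsto (fun n => form (u n - ⟨f, hf⟩) (u n - ⟨f, hf⟩)) atTop (𝓝 0)
  markov : ∀ (η : ℝ → ℝ) (hη : LipschitzWith 1 η) (h0 : η 0 = 0) (f : domain),
    ∃ h : hη.compLp h0 (f : Lp ℝ 2 μ) ∈ domain,
      form ⟨hη.compLp h0 (f : Lp ℝ 2 μ), h⟩ ⟨hη.compLp h0 (f : Lp ℝ 2 μ), h⟩ ≤ form f f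

namespace DirichletForm

variable {X : Type*} [MeasurableSpace X] {μ : Measure X}

/-- Strong locality: `𝓔(f, g) = 0` whenever `(f + a) g = 0` a.e. for some constant `a`. -/
def StronglyLocal (E : DirichletForm μ) : Prop :=
  ∀ (f g : E.domain) (a : ℝ),
    (∀ᵐ x ∂μ, ((f : Lp ℝ 2 μ) x + a) * (g : Lp ℝ 2 μ) x = 0) → E.form f g = 0

/-- `h = Δ f` in `L²(X, μ)`, i.e. `𝓔(f, g) = - ∫ h g dμ` for every `g ∈ 𝕍`. -/
def HasLaplacian (E : DirichletForm μ) (f : E.domain) (h : Lp ℝ 2 μ) : Prop :=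
  ∀ g : E.domain, E.form f g = -inner ℝ h (g : Lp ℝ 2 μ)

/-- The domain `𝔻` of the `L²` realization of `Δ`. -/
def laplacianDomain (E : DirichletForm μ) : Set E.domain :=
  {f | ∃ h : Lp ℝ 2 μ, E.HasLaplacian f h}

open Classical in
/-- The Laplacian `Δ f ∈ L²(X, μ)` of `f ∈ 𝔻` (it is `0` by convention when `f ∉ 𝔻`). -/
noncomputable def laplacian (E : DirichletForm μ) (f : E.domain) : Lp ℝ 2 μ :=
  if h : ∃ h : Lp ℝ 2 μ, E.HasLaplacian f h then h.choose else 0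

theorem hasLaplacian_laplacian (E : DirichletForm μ) {f : E.domain}
    (hf : f ∈ E.laplacianDomain) : E.HasLaplacian f (E.laplacian f) := by
  have h : ∃ h : Lp ℝ 2 μ, E.HasLaplacian f h := hf
  rw [laplacian, dif_pos h]
  exact h.choose_spec

theorem HasLaplacian.laplacian_eq {E : DirichletForm μ} {f : E.domain} {h : Lp ℝ 2 μ}
    (hf : E.HasLaplacian f h) : E.laplacian f = h := by
  have h' := E.hasLaplacian_laplacian ⟨h, hf⟩
  refine E.dense_domain.eq_of_inner_left (𝕜 := ℝ) fun v hv => ?_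
  have h1 := h' ⟨v, hv⟩
  have h2 := hf ⟨v, hv⟩
  simp only at h1 h2
  linarith

/-- `D_𝕍(Δ) = {f ∈ 𝔻 : Δ f ∈ 𝕍}`. -/
def domV (E : DirichletForm μ) : Set E.domain :=
  {f | f ∈ E.laplacianDomain ∧ E.laplacian f ∈ E.domain}

/-- `Δ f` as an element of `𝕍`, for `f ∈ D_𝕍(Δ)`. -/
noncomputable def laplacianV (E : DirichletForm μ) (f : E.domV) : E.domain :=
  ⟨E.laplacian f, f.2.2⟩

/-- `D_{L^∞}(Δ) = {φ ∈ 𝕍 ∩ L^∞ : Δ φ ∈ L² ∩ L^∞}`. -/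
def domLInfty (E : DirichletForm μ) : Set E.domain :=
  {φ | φ ∈ E.laplacianDomain ∧ MemLp (φ : Lp ℝ 2 μ) ∞ μ ∧ MemLp (E.laplacian φ) ∞ μ}

/-- `𝔻 ∩ L^∞`. -/
def boundedLaplacianDomain (E : DirichletForm μ) : Set E.domain :=
  {f | f ∈ E.laplacianDomain ∧ MemLp (f : Lp ℝ 2 μ) ∞ μ}

/-- `u t = P_t f` is the trajectory issuing from `f` of the semigroup generated by `𝓔`, i.e. the
solution of `u' = Δ u` on `(0, ∞)` which is continuous on `[0, ∞)` with `u 0 = f`. -/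
structure IsHeatFlow (E : DirichletForm μ) (f : Lp ℝ 2 μ) (u : ℝ → Lp ℝ 2 μ) : Prop where
  initial : u 0 = f
  continuousOn : ContinuousOn u (Set.Ici 0)
  evolution : ∀ t : ℝ, 0 < t → ∃ ht : u t ∈ E.domain,
    (⟨u t, ht⟩ : E.domain) ∈ E.laplacianDomain ∧ HasDerivAt u (E.laplacian ⟨u t, ht⟩) t

/-- The semigroup generated by `𝓔` is mass preserving: `∫ P_t f dμ = ∫ f dμ` for every
`f ∈ L¹ ∩ L²` and `t ≥ 0`. -/
def MassPreserving (E : DirichletForm μ) : Prop :=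
  ∀ (f : Lp ℝ 2 μ) (u : ℝ → Lp ℝ 2 μ), Integrable f μ → E.IsHeatFlow f u →
    ∀ t : ℝ, 0 ≤ t → Integrable (u t) μ ∧ ∫ x, u t x ∂μ = ∫ x, f x ∂μ

/-- The norm of `𝕍`: `‖f‖_𝕍² = ‖f‖² + 𝓔(f, f)`. -/
noncomputable def normV (E : DirichletForm μ) (f : E.domain) : ℝ :=
  √(‖(f : Lp ℝ 2 μ)‖ ^ 2 + E.form f f)

/-- A Carré du Champ of `𝓔`: a positive, symmetric, continuous bilinear map `Γ : 𝕍 × 𝕍 → L¹(X, μ)`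
such that `𝓔(f, g φ) + 𝓔(g, f φ) - 𝓔(f g, φ) = 2 ∫ Γ(f, g) φ dμ` for all `f, g, φ ∈ 𝕍 ∩ L^∞`.
The variables `gφ`, `fφ`, `fg` are the products as elements of `𝕍`
(`𝕍 ∩ L^∞` is an algebra, by the Markov property). -/
structure CarreDuChamp (E : DirichletForm μ) where
  /-- The map `(f, g) ↦ Γ(f, g)`. -/
  gamma : E.domain →ₗ[ℝ] E.domain →ₗ[ℝ] Lp ℝ 1 μ
  symm : ∀ f g : E.domain, gamma f g = gamma g f
  nonneg : ∀ f : E.domain, ∀ᵐ x ∂μ, 0 ≤ gamma f f x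
  continuous : ∃ C : ℝ, ∀ f g : E.domain, ‖gamma f g‖ ≤ C * E.normV f * E.normV g
  form_eq : ∀ f g φ gφ fφ fg : E.domain,
    MemLp (f : Lp ℝ 2 μ) ∞ μ → MemLp (g : Lp ℝ 2 μ) ∞ μ → MemLp (φ : Lp ℝ 2 μ) ∞ μ →
    (∀ᵐ x ∂μ, (gφ : Lp ℝ 2 μ) x = (g : Lp ℝ 2 μ) x * (φ : Lp ℝ 2 μ) x) →
    (∀ᵐ x ∂μ, (fφ : Lp ℝ 2 μ) x = (f : Lp ℝ 2 μ) x * (φ : Lp ℝ 2 μ) x) →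
    (∀ᵐ x ∂μ, (fg : Lp ℝ 2 μ) x = (f : Lp ℝ 2 μ) x * (g : Lp ℝ 2 μ) x) →
    E.form f gφ + E.form g fφ - E.form fg φ =
      2 * ∫ x, gamma f g x * (φ : Lp ℝ 2 μ) x ∂μ

namespace CarreDuChamp

variable {E : DirichletForm μ}

/-- The multilinear form
`Γ₂(f, g; φ) = ½ ∫ (Γ(f, g) Δφ - (Γ(f, Δg) + Γ(g, Δf)) φ) dμ`
on `D_𝕍(Δ) × D_𝕍(Δ) × D_{L^∞}(Δ)`. -/
noncomputable def gamma2 (Γ : E.CarreDuChamp) (f g : E.domV) (φ : E.domLInfty) : ℝ :=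
  (1 / 2) * ∫ x, (Γ.gamma f g x * E.laplacian φ x
    - (Γ.gamma f (E.laplacianV g) x + Γ.gamma g (E.laplacianV f) x)
      * ((φ : E.domain) : Lp ℝ 2 μ) x) ∂μ

/-- The Bakry–Émery condition `BE(K, N)`, `K ∈ ℝ`, `N ∈ [1, ∞]`, with `ν = 1 / N`
(`ν = 0` for `N = ∞`). -/
def BE (Γ : E.CarreDuChamp) (K : ℝ) (N : ℝ≥0∞) : Prop :=
  ∀ (f : E.domV) (φ : E.domLInfty), (∀ᵐ x ∂μ, 0 ≤ ((φ : E.domain) : Lp ℝ 2 μ) x) →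
    K * ∫ x, Γ.gamma f f x * ((φ : E.domain) : Lp ℝ 2 μ) x ∂μ
      + N⁻¹.toReal * ∫ x, (E.laplacian f x) ^ 2 * ((φ : E.domain) : Lp ℝ 2 μ) x ∂μ
      ≤ Γ.gamma2 f f φ

end CarreDuChamp

end DirichletForm

/-!
The difficulty is integrability: `Γ(f, g)` is only known to be in `L¹`, whereas `Δφ` is only in
`L²`. The theorem rests on the interpolation estimate `BE.interpolation`: under `BE(K, ∞)`, a
function `f ∈ 𝔻` with `|f| ≤ M` satisfies
`‖Γ(f)‖² ≤ M² (11 ‖Δf‖² + 2 |K| 𝓔(f, f))`, the norms being those of `L²`.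
By the pointwise Cauchy–Schwarz inequality `Γ(f, g)` is then in `L²` for all `f, g ∈ 𝔻 ∩ L^∞`, which
gives the integrability statements.

*Interpolation.* For regular `f`, with `Δf` bounded and in `𝔻`, the Bakry–Émery inequality with the
test function `φ = M² - f² ≥ 0` reads, because `Δ f² = 2 f Δf + 2 Γ(f)`,
`∫ Γ(f)² ≤ - ∫ Γ(f) f Δf - ∫ Γ(f, Δf) (M² - f²) - K ∫ Γ(f) (M² - f²)`.
Integration by parts of `Γ(f, Δf)`, together with `|Γ(f, f²)| ≤ 2 M Γ(f)`, bounds the right-hand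
side by `3 M ‖Γ(f)‖ ‖Δf‖ + M² ‖Δf‖² + |K| M² 𝓔(f, f)`, and the first term is absorbed on the left.
Since `f²` need not be in `𝔻`, the test function is `M² - J_δ f²`, with `J_δ = (1 - δ Δ)⁻¹` the
resolvent, and `δ → 0`; the truncations `min Γ(f) n` replace `Γ(f)` until its square integrability
is known (`BE.norm_sq_truncation_le`). A general `f` is approximated by `J_ε f`, along which the
right-hand side of the estimate does not increase.

The constant `M²` is not in `L²`, and using it in a test function, as well as the identity
`∫ Γ(f, g) = 𝓔(f, g)`, requires `J_δ 1 = 1`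
(`MassPreserving.ae_tendsto_resolvent_exhaustion`). This is deduced from the preservation of mass,
by a Laplace transform in time of a heat flow constructed from the Yosida approximation.

The calculus needed for `Γ` follows from the identity defining it. The integrated Leibniz rule
`∫ Γ(f, g) φ + ∫ Γ(f, φ) g = 𝓔(f, g φ)` is an algebraic consequence (`integral_gamma_leibniz`), and
`Γ(f, f²) ≤ 2 M Γ(f)` follows from the positivity of the resolvents through the approximating forms
`ε⁻¹ ⟪f - J_ε f, g⟫` (`integral_gamma_sq_le`).

*The inequality.* The condition `BE(K, N)` applies to `J_ε f` and `J_ε φ`; after integrating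
`Γ(J_ε f, Δ J_ε f)` by parts it only involves quantities which converge as `ε → 0`
(`BE.apply_resolvent_resolvent`). The convergence of `Γ(J_ε f, J_ε φ)` to `Γ(f, φ)` in `L²`
(`BE.tendsto_toLp_gamma`) is once more the interpolation estimate, applied to `J_ε f - f`, whose sup
norm is at most `2 M` and whose energy and Laplacian tend to `0`.
-/

namespace DirichletForm

variable {X : Type*} [MeasurableSpace X] {μ : Measure X}

/-! ### The Hilbert space of finite energy functions and the resolvent -/

/-- The domain `𝕍` of the form, as a type carrying the inner product `⟪f, g⟫ + 𝓔(f, g)`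
(the subspace `E.domain` itself carries the topology of `L²`). -/
def FormSpace (E : DirichletForm μ) : Type _ := E.domain

instance (E : DirichletForm μ) : AddCommGroup E.FormSpace := inferInstanceAs (AddCommGroup E.domain)
instance (E : DirichletForm μ) : Module ℝ E.FormSpace := inferInstanceAs (Module ℝ E.domain)

/-- The identity map between the two copies of `𝕍`. -/
def ofFormSpace (E : DirichletForm μ) : E.FormSpace ≃ₗ[ℝ] E.domain := LinearEquiv.refl ℝ E.domain

/-- The inner product `⟪f, g⟫ + 𝓔(f, g)` on `𝕍`. -/
@[reducible] noncomputable def formCore (E : DirichletForm μ) :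
    InnerProductSpace.Core ℝ E.FormSpace where
  inner f g := inner ℝ (E.ofFormSpace f : Lp ℝ 2 μ) (E.ofFormSpace g)
    + E.form (E.ofFormSpace f) (E.ofFormSpace g)
  conj_inner_symm f g := by
    simp only [conj_trivial]
    rw [real_inner_comm, E.symm]
  re_inner_nonneg f := by
    simp only [RCLike.re_to_real]
    exact add_nonneg real_inner_self_nonneg (E.nonneg _)
  add_left f g h := by
    simp only [map_add, Submodule.coe_add, inner_add_left, LinearMap.add_apply]
    ring
  smul_left f g r := by
    simp only [map_smul, Submodule.coe_smul, real_inner_smul_left, LinearMap.smul_apply,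
      smul_eq_mul, conj_trivial]
    ring
  definite f hf := by
    have h1 : 0 ≤ inner ℝ (E.ofFormSpace f : Lp ℝ 2 μ) (E.ofFormSpace f) :=
      real_inner_self_nonneg
    have h2 := E.nonneg (E.ofFormSpace f)
    have h3 : inner ℝ (E.ofFormSpace f : Lp ℝ 2 μ) (E.ofFormSpace f) = 0 := by linarith
    exact Subtype.ext (inner_self_eq_zero.1 h3)

noncomputable instance (E : DirichletForm μ) : NormedAddCommGroup E.FormSpace :=
  @InnerProductSpace.Core.toNormedAddCommGroup ℝ _ _ _ _ E.formCore

noncomputable instance (E : DirichletForm μ) : InnerProductSpace ℝ E.FormSpace :=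
  InnerProductSpace.ofCore E.formCore.toCore

theorem formSpace_inner (E : DirichletForm μ) (f g : E.FormSpace) :
    inner ℝ f g = inner ℝ (E.ofFormSpace f : Lp ℝ 2 μ) (E.ofFormSpace g)
      + E.form (E.ofFormSpace f) (E.ofFormSpace g) := rfl

theorem formSpace_norm_sq (E : DirichletForm μ) (f : E.FormSpace) :
    ‖f‖ ^ 2 = ‖(E.ofFormSpace f : Lp ℝ 2 μ)‖ ^ 2
      + E.form (E.ofFormSpace f) (E.ofFormSpace f) := by
  rw [← real_inner_self_eq_norm_sq, ← real_inner_self_eq_norm_sq, formSpace_inner]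

theorem norm_ofFormSpace_le (E : DirichletForm μ) (f : E.FormSpace) :
    ‖(E.ofFormSpace f : Lp ℝ 2 μ)‖ ≤ ‖f‖ := by
  refine le_of_sq_le_sq ?_ (norm_nonneg _)
  rw [formSpace_norm_sq]
  linarith [E.nonneg (E.ofFormSpace f)]

theorem form_ofFormSpace_le (E : DirichletForm μ) (f : E.FormSpace) :
    E.form (E.ofFormSpace f) (E.ofFormSpace f) ≤ ‖f‖ ^ 2 := by
  rw [formSpace_norm_sq]
  linarith [sq_nonneg ‖(E.ofFormSpace f : Lp ℝ 2 μ)‖]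

/-- Completeness of `𝕍` is the closedness of the form. -/
instance (E : DirichletForm μ) : CompleteSpace E.FormSpace := by
  refine Metric.complete_of_cauchySeq_tendsto fun u hu => ?_
  have hu2 : CauchySeq fun n => (E.ofFormSpace (u n) : Lp ℝ 2 μ) := by
    rw [Metric.cauchySeq_iff] at hu ⊢
    intro ε hε
    obtain ⟨n, hn⟩ := hu ε hε
    refine ⟨n, fun m hm k hk => lt_of_le_of_lt ?_ (hn m hm k hk)⟩
    rw [dist_eq_norm, dist_eq_norm]
    simpa using E.norm_ofFormSpace_le (u m - u k)
  obtain ⟨f, hf⟩ := cauchySeq_tendsto_of_complete hu2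
  obtain ⟨hfV, hlim⟩ := E.closed (fun n => E.ofFormSpace (u n)) f hf (by
    intro ε hε
    rw [Metric.cauchySeq_iff] at hu
    obtain ⟨n, hn⟩ := hu (√ε) (Real.sqrt_pos.2 hε)
    refine ⟨n, fun m k hm hk => ?_⟩
    rw [← map_sub]
    refine lt_of_le_of_lt (E.form_ofFormSpace_le _) ?_
    have := hn m hm k hk
    rw [dist_eq_norm] at this
    calc _ < (√ε) ^ 2 := pow_lt_pow_left₀ this (norm_nonneg _) two_ne_zero
      _ = ε := Real.sq_sqrt hε.le)
  refine ⟨E.ofFormSpace.symm ⟨f, hfV⟩, ?_⟩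
  rw [tendsto_iff_norm_sub_tendsto_zero]
  have h0 : Tendsto (fun n => ‖(E.ofFormSpace (u n) : Lp ℝ 2 μ) - f‖ ^ 2
      + E.form (E.ofFormSpace (u n) - ⟨f, hfV⟩) (E.ofFormSpace (u n) - ⟨f, hfV⟩))
      atTop (𝓝 0) := by
    have := (tendsto_iff_norm_sub_tendsto_zero.1 hf).pow 2
    simpa using this.add hlim
  have h1 := h0.sqrt
  rw [Real.sqrt_zero] at h1
  refine h1.congr fun n => ?_
  rw [← Real.sqrt_sq (norm_nonneg (u n - _)), formSpace_norm_sq]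
  simp

/-- Cauchy–Schwarz inequality for the form. -/
theorem form_mul_self_le (E : DirichletForm μ) (f g : E.domain) :
    E.form f g * E.form f g ≤ E.form f f * E.form g g := by
  have h : ∀ t : ℝ, 0 ≤ E.form g g * (t * t) + 2 * E.form f g * t + E.form f f := by
    intro t
    have := E.nonneg (f + t • g)
    simp only [map_add, map_smul, LinearMap.add_apply, LinearMap.smul_apply, smul_eq_mul] at this
    rw [E.symm g f] at this
    linarith
  have := discrim_le_zero h
  rw [discrim] at this
  linarith

/-- The inclusion of `𝕍`, with its own norm, into `L²`. -/
noncomputable def inclusion (E : DirichletForm μ) : E.FormSpace →L[ℝ] Lp ℝ 2 μ :=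
  (E.domain.subtype ∘ₗ E.ofFormSpace.toLinearMap).mkContinuous 1 fun f => by
    simpa using E.norm_ofFormSpace_le f

theorem inclusion_apply (E : DirichletForm μ) (f : E.FormSpace) :
    E.inclusion f = (E.ofFormSpace f : Lp ℝ 2 μ) := rfl

/-- The rescaled form `c 𝓔`. -/
def scale (E : DirichletForm μ) {c : ℝ} (hc : 0 < c) : DirichletForm μ where
  domain := E.domain
  dense_domain := E.dense_domain
  form := c • E.form
  symm f g := by simp [E.symm f g]
  nonneg f := by simpa using mul_nonneg hc.le (E.nonneg f)
  closed u f hu hC := by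
    obtain ⟨hf, h⟩ := E.closed u f hu fun ε hε => by
      obtain ⟨n, hn⟩ := hC (c * ε) (mul_pos hc hε)
      refine ⟨n, fun m k hm hk => ?_⟩
      have := hn m k hm hk
      simp only [LinearMap.smul_apply, smul_eq_mul] at this
      exact lt_of_mul_lt_mul_left this hc.le
    refine ⟨hf, ?_⟩
    simpa using h.const_mul c
  markov η hη h0 f := by
    obtain ⟨h, h'⟩ := E.markov η hη h0 f
    refine ⟨h, ?_⟩
    simpa using mul_le_mul_of_nonneg_left h' hc.le

/-- The resolvent `J_ε = (1 - ε Δ)⁻¹`, with values in `𝕍`: the adjoint of the inclusion of `𝕍`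
into `L²`, when `𝕍` carries the inner product `⟪f, g⟫ + ε 𝓔(f, g)`. -/
noncomputable def resolvent (E : DirichletForm μ) {ε : ℝ} (hε : 0 < ε) :
    Lp ℝ 2 μ →ₗ[ℝ] E.domain :=
  (E.scale hε).ofFormSpace.toLinearMap ∘ₗ
    (ContinuousLinearMap.adjoint (E.scale hε).inclusion).toLinearMap

section Resolvent

variable (E : DirichletForm μ) {ε : ℝ} (hε : 0 < ε)

theorem resolvent_spec (h : Lp ℝ 2 μ) (g : E.domain) :
    inner ℝ (E.resolvent hε h : Lp ℝ 2 μ) g + ε * E.form (E.resolvent hε h) g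
      = inner ℝ h (g : Lp ℝ 2 μ) :=
  ContinuousLinearMap.adjoint_inner_left (E.scale hε).inclusion
    ((E.scale hε).ofFormSpace.symm g) h

theorem eq_resolvent {h : Lp ℝ 2 μ} {u : E.domain}
    (hu : ∀ g : E.domain, inner ℝ (u : Lp ℝ 2 μ) g + ε * E.form u g = inner ℝ h (g : Lp ℝ 2 μ)) :
    u = E.resolvent hε h := by
  set v := E.resolvent hε h
  have h1 := hu (u - v)
  have h2 := E.resolvent_spec hε h (u - v)
  have h3 : inner ℝ (u - v : E.domain).1 (u - v : E.domain).1 + ε * E.form (u - v) (u - v) = 0 := by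
    have e1 : inner ℝ (u - v : E.domain).1 (u - v : E.domain).1
      = inner ℝ (u : Lp ℝ 2 μ) (u - v : E.domain).1
        - inner ℝ (v : Lp ℝ 2 μ) (u - v : E.domain).1 := inner_sub_left _ _ _
    have e2 : E.form (u - v) (u - v) = E.form u (u - v) - E.form v (u - v) := by
      rw [map_sub E.form]; rfl
    rw [e1, e2]
    linarith
  have h4 := mul_nonneg hε.le (E.nonneg (u - v))
  have h5 : 0 ≤ inner ℝ (u - v : E.domain).1 (u - v : E.domain).1 := real_inner_self_nonneg
  have h6 : inner ℝ (u - v : E.domain).1 (u - v : E.domain).1 = 0 := by linarith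
  exact sub_eq_zero.1 (Subtype.ext (inner_self_eq_zero.1 h6))

theorem hasLaplacian_resolvent (h : Lp ℝ 2 μ) :
    E.HasLaplacian (E.resolvent hε h) (ε⁻¹ • ((E.resolvent hε h : Lp ℝ 2 μ) - h)) := by
  intro g
  have := E.resolvent_spec hε h g
  rw [real_inner_smul_left, inner_sub_left]
  field_simp
  linarith

theorem resolvent_mem (h : Lp ℝ 2 μ) : E.resolvent hε h ∈ E.laplacianDomain :=
  ⟨_, E.hasLaplacian_resolvent hε h⟩

theorem laplacian_resolvent (h : Lp ℝ 2 μ) :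
    E.laplacian (E.resolvent hε h) = ε⁻¹ • ((E.resolvent hε h : Lp ℝ 2 μ) - h) :=
  (E.hasLaplacian_resolvent hε h).laplacian_eq

theorem inner_resolvent_left (h k : Lp ℝ 2 μ) :
    inner ℝ (E.resolvent hε h : Lp ℝ 2 μ) k = inner ℝ h (E.resolvent hε k : Lp ℝ 2 μ) := by
  have h1 := E.resolvent_spec hε h (E.resolvent hε k)
  have h2 := E.resolvent_spec hε k (E.resolvent hε h)
  rw [E.symm, real_inner_comm] at h2
  rw [real_inner_comm, ← h1, ← h2]

theorem form_resolvent_self_le (h : Lp ℝ 2 μ) :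
    ‖(E.resolvent hε h : Lp ℝ 2 μ)‖ ^ 2
      + ε * E.form (E.resolvent hε h) (E.resolvent hε h) ≤
      ‖h‖ * ‖(E.resolvent hε h : Lp ℝ 2 μ)‖ := by
  have h1 := E.resolvent_spec hε h (E.resolvent hε h)
  rw [real_inner_self_eq_norm_sq] at h1
  rw [h1]
  exact real_inner_le_norm _ _

theorem norm_resolvent_le (h : Lp ℝ 2 μ) : ‖(E.resolvent hε h : Lp ℝ 2 μ)‖ ≤ ‖h‖ := by
  have h1 := E.form_resolvent_self_le hε h
  have h2 := mul_nonneg hε.le (E.nonneg (E.resolvent hε h))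
  by_contra hlt
  push Not at hlt
  nlinarith [norm_nonneg h]

theorem form_resolvent_le_norm_sq (h : Lp ℝ 2 μ) :
    ε * E.form (E.resolvent hε h) (E.resolvent hε h) ≤ ‖h‖ ^ 2 := by
  have h1 := E.form_resolvent_self_le hε h
  have h2 := E.norm_resolvent_le hε h
  nlinarith [norm_nonneg h, sq_nonneg ‖(E.resolvent hε h : Lp ℝ 2 μ)‖]

/-- The resolvent as a bounded operator of `L²`. -/
noncomputable def resolventL : Lp ℝ 2 μ →L[ℝ] Lp ℝ 2 μ :=
  (E.domain.subtype ∘ₗ E.resolvent hε).mkContinuous 1 fun h => by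
    simpa using E.norm_resolvent_le hε h

theorem resolventL_apply (h : Lp ℝ 2 μ) : E.resolventL hε h = (E.resolvent hε h : Lp ℝ 2 μ) := rfl

theorem norm_resolventL_le : ‖E.resolventL hε‖ ≤ 1 :=
  LinearMap.mkContinuous_norm_le _ zero_le_one _

theorem resolventL_injective : Function.Injective (E.resolventL hε) := by
  rw [injective_iff_map_eq_zero]
  intro h hh
  have h0 : E.resolvent hε h = 0 := Subtype.ext hh
  refine E.dense_domain.eq_zero_of_inner_left ℝ fun v hv => ?_
  have := E.resolvent_spec hε h ⟨v, hv⟩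
  rw [h0] at this
  simpa using this.symm

/-- `f - ε Δf` is the function whose resolvent is `f`. -/
theorem HasLaplacian.resolvent_sub {f : E.domain} {k : Lp ℝ 2 μ} (hf : E.HasLaplacian f k) :
    E.resolvent hε ((f : Lp ℝ 2 μ) - ε • k) = f := by
  symm
  refine E.eq_resolvent hε fun g => ?_
  rw [hf g, inner_sub_left, real_inner_smul_left]
  ring

/-- The resolvent commutes with the Laplacian. -/
theorem HasLaplacian.resolvent {f : E.domain} {k : Lp ℝ 2 μ} (hf : E.HasLaplacian f k) :
    E.HasLaplacian (E.resolvent hε f) (E.resolvent hε k) := by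
  have h1 := HasLaplacian.resolvent_sub E hε hf
  rw [map_sub, map_smul] at h1
  have h2 := E.hasLaplacian_resolvent hε (f : Lp ℝ 2 μ)
  convert h2 using 1
  have h3 : (f : Lp ℝ 2 μ) = (E.resolvent hε f : Lp ℝ 2 μ) - ε • (E.resolvent hε k : Lp ℝ 2 μ) := by
    conv_lhs => rw [← h1]
    rfl
  rw [show (E.resolvent hε f : Lp ℝ 2 μ) - (f : Lp ℝ 2 μ)
    = ε • (E.resolvent hε k : Lp ℝ 2 μ) by nth_rewrite 2 [h3]; abel, smul_smul,
    inv_mul_cancel₀ hε.ne', one_smul]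

theorem resolvent_sub_self {f : E.domain} {k : Lp ℝ 2 μ} (hf : E.HasLaplacian f k) :
    E.resolvent hε f - f = ε • E.resolvent hε k := by
  have h1 := HasLaplacian.resolvent_sub E hε hf
  rw [map_sub, map_smul] at h1
  conv_lhs => enter [2]; rw [← h1]
  abel

theorem resolvent_comm {δ : ℝ} (hδ : 0 < δ) (h : Lp ℝ 2 μ) :
    E.resolvent hε (E.resolvent hδ h : Lp ℝ 2 μ)
      = E.resolvent hδ (E.resolvent hε h : Lp ℝ 2 μ) := by
  have h1 := HasLaplacian.resolvent E hε (E.hasLaplacian_resolvent hδ h)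
  have h2 := HasLaplacian.resolvent_sub E hδ h1
  rw [← h2]
  congr 1
  rw [map_smul, map_sub, Submodule.coe_smul, smul_smul, mul_inv_cancel₀ hδ.ne', one_smul,
    Submodule.coe_sub]
  abel

theorem form_resolvent_sub_self_le {f : E.domain} {k : Lp ℝ 2 μ} (hf : E.HasLaplacian f k) :
    E.form (E.resolvent hε f - f) (E.resolvent hε f - f) ≤ ε * ‖k‖ ^ 2 := by
  rw [E.resolvent_sub_self hε hf]
  simp only [map_smul, LinearMap.smul_apply, smul_eq_mul]
  have := E.form_resolvent_le_norm_sq hε k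
  nlinarith

/-- The resolvent `u = J_ε h` minimizes `v ↦ ‖v - h‖² + ε 𝓔(v, v)`, with a quadratic gap. -/
theorem resolvent_minimizes (h : Lp ℝ 2 μ) (v : E.domain) :
    ‖(v : Lp ℝ 2 μ) - h‖ ^ 2 + ε * E.form v v =
      ‖(E.resolvent hε h : Lp ℝ 2 μ) - h‖ ^ 2 + ε * E.form (E.resolvent hε h) (E.resolvent hε h)
      + ‖(v : Lp ℝ 2 μ) - E.resolvent hε h‖ ^ 2
      + ε * E.form (v - E.resolvent hε h) (v - E.resolvent hε h) := by
  set u := E.resolvent hε h with hu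
  have h1 := E.resolvent_spec hε h (v - u)
  rw [← hu] at h1
  have e1 : (v : Lp ℝ 2 μ) - h = ((u : Lp ℝ 2 μ) - h) + ((v : Lp ℝ 2 μ) - u) := by abel
  have e2 : E.form v v = E.form u u + 2 * E.form u (v - u) + E.form (v - u) (v - u) := by
    simp only [map_sub, LinearMap.sub_apply]
    rw [E.symm v u]; ring
  rw [e1, norm_add_sq_real, e2, inner_sub_left]
  rw [Submodule.coe_sub] at h1
  linear_combination 2 * h1

theorem form_resolvent_le (f : E.domain) :
    E.form (E.resolvent hε f) (E.resolvent hε f) ≤ E.form f f := by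
  have h := E.resolvent_minimizes hε f f
  rw [sub_self, norm_zero] at h
  have h1 := mul_nonneg hε.le (E.nonneg (f - E.resolvent hε f))
  have h2 : ε * E.form (E.resolvent hε f) (E.resolvent hε f) ≤ ε * E.form f f := by
    nlinarith [sq_nonneg ‖(E.resolvent hε f : Lp ℝ 2 μ) - f‖,
      sq_nonneg ‖(f : Lp ℝ 2 μ) - E.resolvent hε f‖]
  exact le_of_mul_le_mul_left h2 hε

theorem norm_resolvent_sub_self_sq_le (f : E.domain) :
    ‖(E.resolvent hε f : Lp ℝ 2 μ) - f‖ ^ 2 ≤ ε * E.form f f := by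
  have h := E.resolvent_minimizes hε f f
  rw [sub_self, norm_zero] at h
  have h1 := mul_nonneg hε.le (E.nonneg (f - E.resolvent hε f))
  have h2 := mul_nonneg hε.le (E.nonneg (E.resolvent hε f))
  nlinarith [sq_nonneg ‖(f : Lp ℝ 2 μ) - E.resolvent hε f‖]

/-- If `η` is a normal contraction which moves every value closer to the values of `h`, then it
leaves the resolvent of `h` unchanged. -/
theorem resolvent_ae_fixed {η : ℝ → ℝ} (hη : LipschitzWith 1 η) (h0 : η 0 = 0)
    {h : Lp ℝ 2 μ} (hh : ∀ᵐ x ∂μ, ∀ s : ℝ, |η s - h x| ≤ |s - h x|) :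
    ∀ᵐ x ∂μ, η ((E.resolvent hε h : Lp ℝ 2 μ) x) = (E.resolvent hε h : Lp ℝ 2 μ) x := by
  set u := E.resolvent hε h with hu
  obtain ⟨hv, hle⟩ := E.markov η hη h0 u
  set v : E.domain := ⟨hη.compLp h0 (u : Lp ℝ 2 μ), hv⟩ with hvdef
  have hvu : (v : Lp ℝ 2 μ) =ᵐ[μ] fun x => η ((u : Lp ℝ 2 μ) x) := hη.coeFn_compLp h0 _
  have h1 : ‖(v : Lp ℝ 2 μ) - h‖ ≤ ‖(u : Lp ℝ 2 μ) - h‖ := by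
    refine Lp.norm_le_norm_of_ae_le ?_
    filter_upwards [hh, hvu, Lp.coeFn_sub (v : Lp ℝ 2 μ) h, Lp.coeFn_sub (u : Lp ℝ 2 μ) h]
      with x h1 h2 h3 h4
    rw [h3, h4, Pi.sub_apply, Pi.sub_apply, h2, Real.norm_eq_abs, Real.norm_eq_abs]
    exact h1 _
  have h2 := E.resolvent_minimizes hε h v
  rw [← hu] at h2
  have h3 := mul_nonneg hε.le (E.nonneg (v - u))
  have h4 : ‖(v : Lp ℝ 2 μ) - h‖ ^ 2 ≤ ‖(u : Lp ℝ 2 μ) - h‖ ^ 2 :=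
    pow_le_pow_left₀ (norm_nonneg _) h1 2
  have h5 := mul_le_mul_of_nonneg_left hle hε.le
  have h6 : ‖(v : Lp ℝ 2 μ) - u‖ ^ 2 ≤ 0 := by linarith
  have h7 : (v : Lp ℝ 2 μ) = u := by
    rw [← sub_eq_zero, ← norm_eq_zero]
    exact pow_eq_zero_iff two_ne_zero |>.1 (le_antisymm h6 (sq_nonneg _))
  rw [h7] at hvu
  filter_upwards [hvu] with x hx using hx.symm

theorem resolvent_le_of_le {c : ℝ} (hc : 0 ≤ c) {h : Lp ℝ 2 μ} (hh : ∀ᵐ x ∂μ, h x ≤ c) :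
    ∀ᵐ x ∂μ, (E.resolvent hε h : Lp ℝ 2 μ) x ≤ c := by
  have hL : LipschitzWith 1 fun s : ℝ => min s c := LipschitzWith.id.min_const c
  have := E.resolvent_ae_fixed hε hL (by simp [hc]) (h := h) (by
    filter_upwards [hh] with x hx s
    rcases le_total s c with hs | hs
    · rw [min_eq_left hs]
    · rw [min_eq_right hs, abs_of_nonneg (by linarith), abs_of_nonneg (by linarith)]
      linarith)
  filter_upwards [this] with x hx
  rw [← hx]
  exact min_le_right _ _

theorem le_resolvent_of_le {c : ℝ} (hc : c ≤ 0) {h : Lp ℝ 2 μ} (hh : ∀ᵐ x ∂μ, c ≤ h x) :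
    ∀ᵐ x ∂μ, c ≤ (E.resolvent hε h : Lp ℝ 2 μ) x := by
  have := E.resolvent_le_of_le hε (neg_nonneg.2 hc) (h := -h) (by
    filter_upwards [hh, Lp.coeFn_neg h] with x hx h1
    rw [h1, Pi.neg_apply]
    linarith)
  rw [map_neg] at this
  filter_upwards [this, Lp.coeFn_neg (E.resolvent hε h : Lp ℝ 2 μ)] with x hx h1
  rw [Submodule.coe_neg, h1, Pi.neg_apply] at hx
  linarith

theorem abs_resolvent_le {c : ℝ} (hc : 0 ≤ c) {h : Lp ℝ 2 μ} (hh : ∀ᵐ x ∂μ, |h x| ≤ c) :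
    ∀ᵐ x ∂μ, |(E.resolvent hε h : Lp ℝ 2 μ) x| ≤ c := by
  filter_upwards [E.resolvent_le_of_le hε hc (hh.mono fun x hx => (abs_le.1 hx).2),
    E.le_resolvent_of_le hε (neg_nonpos.2 hc) (hh.mono fun x hx => (abs_le.1 hx).1)] with x h1 h2
  exact abs_le.2 ⟨h2, h1⟩

/-- The resolvent is order preserving. -/
theorem resolvent_mono {h k : Lp ℝ 2 μ} (hhk : ∀ᵐ x ∂μ, h x ≤ k x) :
    ∀ᵐ x ∂μ, (E.resolvent hε h : Lp ℝ 2 μ) x ≤ (E.resolvent hε k : Lp ℝ 2 μ) x := by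
  have := E.le_resolvent_of_le hε le_rfl (h := k - h) (by
    filter_upwards [hhk, Lp.coeFn_sub k h] with x hx h1
    rw [h1, Pi.sub_apply]
    linarith)
  rw [map_sub] at this
  filter_upwards [this, Lp.coeFn_sub (E.resolvent hε k : Lp ℝ 2 μ) (E.resolvent hε h)] with x hx h1
  rw [Submodule.coe_sub, h1, Pi.sub_apply] at hx
  linarith

end Resolvent

/-- The domain of the Laplacian is a core of the form. -/
theorem exists_mem_laplacianDomain_near (E : DirichletForm μ) (f : E.domain) {η : ℝ} (hη : 0 < η) :
    ∃ d ∈ E.laplacianDomain,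
      ‖((f - d : E.domain) : Lp ℝ 2 μ)‖ ^ 2 + E.form (f - d) (f - d) < η := by
  have hdense : (ContinuousLinearMap.adjoint E.inclusion).range.topologicalClosure = ⊤ := by
    rw [Submodule.topologicalClosure_eq_top_iff, ContinuousLinearMap.orthogonal_range,
      ContinuousLinearMap.adjoint_adjoint, LinearMap.ker_eq_bot]
    exact fun a b hab => E.ofFormSpace.injective (Subtype.ext hab)
  have hmem : E.ofFormSpace.symm f ∈
      (ContinuousLinearMap.adjoint E.inclusion).range.topologicalClosure := by
    rw [hdense]; trivial
  rw [← SetLike.mem_coe, Submodule.topologicalClosure_coe, Metric.mem_closure_iff] at hmem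
  obtain ⟨d, ⟨h, hd⟩, hdist⟩ := hmem (√η) (Real.sqrt_pos.2 hη)
  refine ⟨E.ofFormSpace d, ⟨(E.ofFormSpace d : Lp ℝ 2 μ) - h, fun g => ?_⟩, ?_⟩
  · have := ContinuousLinearMap.adjoint_inner_left E.inclusion (E.ofFormSpace.symm g) h
    change inner ℝ ((ContinuousLinearMap.adjoint E.inclusion).toLinearMap h) _ = _ at this
    rw [hd, formSpace_inner, inclusion_apply, LinearEquiv.apply_symm_apply] at this
    rw [inner_sub_left]
    linarith
  · rw [dist_eq_norm] at hdist
    have h1 : ‖E.ofFormSpace.symm f - d‖ ^ 2 < η := by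
      calc _ < (√η) ^ 2 := pow_lt_pow_left₀ hdist (norm_nonneg _) two_ne_zero
        _ = η := Real.sq_sqrt hη.le
    rw [formSpace_norm_sq] at h1
    simpa using h1

theorem tendsto_resolvent (E : DirichletForm μ) {ε : ℕ → ℝ} (hε : ∀ n, 0 < ε n)
    (hlim : Tendsto ε atTop (𝓝 0)) (h : Lp ℝ 2 μ) :
    Tendsto (fun n => (E.resolvent (hε n) h : Lp ℝ 2 μ)) atTop (𝓝 h) := by
  rw [Metric.tendsto_atTop]
  intro η hη
  obtain ⟨f, hf, hfh⟩ := Metric.mem_closure_iff.1 (E.dense_domain h) (η / 3) (by linarith)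
  have hz : Tendsto (fun n => √(ε n * E.form ⟨f, hf⟩ ⟨f, hf⟩)) atTop (𝓝 0) := by
    simpa using (hlim.mul_const (E.form ⟨f, hf⟩ ⟨f, hf⟩)).sqrt
  obtain ⟨N, hN⟩ := Metric.tendsto_atTop.1 hz (η / 3) (by linarith)
  refine ⟨N, fun n hn => ?_⟩
  have h1 : ‖(E.resolvent (hε n) f : Lp ℝ 2 μ) - f‖ < η / 3 := by
    have h2 := hN n hn
    rw [Real.dist_eq, sub_zero, abs_of_nonneg (Real.sqrt_nonneg _)] at h2
    refine lt_of_le_of_lt ?_ h2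
    exact Real.le_sqrt_of_sq_le (E.norm_resolvent_sub_self_sq_le (hε n) ⟨f, hf⟩)
  have h3 : ‖(E.resolvent (hε n) (h - f) : Lp ℝ 2 μ)‖ < η / 3 :=
    lt_of_le_of_lt (E.norm_resolvent_le (hε n) _) (by rwa [← dist_eq_norm])
  have h4 : (E.resolvent (hε n) h : Lp ℝ 2 μ) - h = (E.resolvent (hε n) (h - f) : Lp ℝ 2 μ)
      + ((E.resolvent (hε n) f : Lp ℝ 2 μ) - f) + (f - h) := by
    rw [map_sub, Submodule.coe_sub]; abel
  rw [dist_eq_norm, h4]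
  have h5 : ‖f - h‖ < η / 3 := by rwa [← dist_eq_norm, dist_comm]
  calc _ ≤ _ := norm_add₃_le
    _ < η := by linarith

/-- The approximating forms `ε⁻¹ ⟪f - J_ε f, g⟫` converge to the form. -/
theorem tendsto_approxForm (E : DirichletForm μ) {ε : ℕ → ℝ} (hε : ∀ n, 0 < ε n)
    (hlim : Tendsto ε atTop (𝓝 0)) (f g : E.domain) :
    Tendsto (fun n => (ε n)⁻¹ * inner ℝ ((f : Lp ℝ 2 μ) - E.resolvent (hε n) f) (g : Lp ℝ 2 μ))
      atTop (𝓝 (E.form f g)) := by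
  have key : ∀ n (g : E.domain), (ε n)⁻¹ * inner ℝ ((f : Lp ℝ 2 μ) - E.resolvent (hε n) f)
      (g : Lp ℝ 2 μ) = E.form (E.resolvent (hε n) f) g := by
    intro n g
    have := E.hasLaplacian_resolvent (hε n) (f : Lp ℝ 2 μ) g
    rw [this, real_inner_smul_left, ← neg_sub, inner_neg_left]
    ring
  simp only [key]
  rw [Metric.tendsto_atTop]
  intro η hη
  set c : ℝ := η / 3 / (√(E.form f f) + 1) with hcdef
  have hc1 : 0 < √(E.form f f) + 1 := by positivity
  have hc : 0 < c := by positivity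
  obtain ⟨d, ⟨k, hk⟩, hd⟩ := E.exists_mem_laplacianDomain_near g (pow_pos hc 2)
  have hgd : √(E.form (g - d) (g - d)) ≤ c := by
    refine Real.sqrt_le_iff.2 ⟨hc.le, ?_⟩
    linarith [sq_nonneg ‖((g - d : E.domain) : Lp ℝ 2 μ)‖]
  have hb : ∀ f' : E.domain, E.form f' f' ≤ E.form f f → |E.form f' (g - d)| ≤ η / 3 := by
    intro f' hf'
    have h1 : |E.form f' (g - d)| ≤ √(E.form f f) * √(E.form (g - d) (g - d)) := by
      rw [← Real.sqrt_mul (E.nonneg f)]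
      refine Real.abs_le_sqrt ?_
      rw [sq]
      exact (E.form_mul_self_le _ _).trans
        (mul_le_mul_of_nonneg_right hf' (E.nonneg _))
    calc _ ≤ _ := h1
      _ ≤ (√(E.form f f) + 1) * c :=
        mul_le_mul (by linarith) hgd (Real.sqrt_nonneg _) hc1.le
      _ = η / 3 := by rw [hcdef]; field_simp
  have hconv : Tendsto (fun n => E.form (E.resolvent (hε n) f) d) atTop (𝓝 (E.form f d)) := by
    have h1 : ∀ u : E.domain, E.form u d = -inner ℝ k (u : Lp ℝ 2 μ) := fun u => by
      rw [E.symm]; exact hk u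
    simp only [h1]
    exact (tendsto_const_nhds.inner (E.tendsto_resolvent hε hlim (f : Lp ℝ 2 μ))).neg
  obtain ⟨N, hN⟩ := Metric.tendsto_atTop.1 hconv (η / 3) (by linarith)
  refine ⟨N, fun n hn => ?_⟩
  have h1 := hb _ (E.form_resolvent_le (hε n) f)
  have h2 := hb f le_rfl
  have h3 := hN n hn
  rw [Real.dist_eq] at h3 ⊢
  simp only [map_sub] at h1 h2
  rw [abs_lt] at h3 ⊢
  rw [abs_le] at h1 h2
  constructor <;> linarith [h1.1, h1.2, h2.1, h2.2, h3.1, h3.2]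

end DirichletForm

namespace DirichletForm

variable {X : Type*} [MeasurableSpace X] {μ : Measure X}

/-! ### The heat flow -/

theorem lp_smul_nonneg {c : ℝ} (hc : 0 ≤ c) {f : Lp ℝ 2 μ} (hf : 0 ≤ f) : 0 ≤ c • f := by
  rw [← Lp.coeFn_nonneg] at hf ⊢
  filter_upwards [hf, Lp.coeFn_smul c f] with x h1 h2
  rw [h2, Pi.smul_apply]
  exact mul_nonneg hc h1

section HeatFlow

variable (E : DirichletForm μ) {ε δ : ℝ} (hε : 0 < ε) (hδ : 0 < δ)

/-- The Yosida approximation `ε⁻¹ (J_ε - 1) = Δ J_ε` of the Laplacian. -/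
noncomputable def yosida : Lp ℝ 2 μ →L[ℝ] Lp ℝ 2 μ := ε⁻¹ • (E.resolventL hε - 1)

/-- The semigroup `exp (t ε⁻¹ (J_ε - 1))`. -/
noncomputable def yosidaExp (t : ℝ) : Lp ℝ 2 μ →L[ℝ] Lp ℝ 2 μ :=
  NormedSpace.exp (t • E.yosida hε)

theorem norm_resolventL_pow_le (n : ℕ) : ‖E.resolventL hε ^ n‖ ≤ 1 := by
  induction n with
  | zero =>
    rw [pow_zero]
    exact ContinuousLinearMap.norm_id_le
  | succ n ih =>
    rw [pow_succ]
    exact (norm_mul_le _ _).trans (mul_le_one₀ ih (norm_nonneg _) (E.norm_resolventL_le hε))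

theorem yosidaExp_eq (t : ℝ) : E.yosidaExp hε t =
    Real.exp (-(t / ε)) • NormedSpace.exp ((t / ε) • E.resolventL hε) := by
  let _ : NormedAlgebra ℚ (Lp ℝ 2 μ →L[ℝ] Lp ℝ 2 μ) := NormedAlgebra.restrictScalars ℚ ℝ _
  have h1 : t • E.yosida hε = algebraMap ℝ (Lp ℝ 2 μ →L[ℝ] Lp ℝ 2 μ) (-(t / ε))
      + (t / ε) • E.resolventL hε := by
    rw [yosida, Algebra.algebraMap_eq_smul_one, smul_smul, smul_sub, ← div_eq_mul_inv, neg_smul]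
    abel
  rw [yosidaExp, h1, NormedSpace.exp_add_of_commute (Algebra.commutes _ _),
    ← NormedSpace.algebraMap_exp_comm, ← Real.exp_eq_exp_ℝ, Algebra.algebraMap_eq_smul_one,
    smul_mul_assoc, one_mul]

theorem norm_yosidaExp_le {t : ℝ} (ht : 0 ≤ t) : ‖E.yosidaExp hε t‖ ≤ 1 := by
  rw [yosidaExp_eq, norm_smul, Real.norm_eq_abs, Real.abs_exp]
  have h1 : ‖NormedSpace.exp ((t / ε) • E.resolventL hε)‖ ≤ Real.exp (t / ε) := by
    have h2 := NormedSpace.exp_series_hasSum_exp' (𝕂 := ℝ) ((t / ε) • E.resolventL hε)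
    have h3 := NormedSpace.exp_series_hasSum_exp' (𝕂 := ℝ) (t / ε)
    rw [← Real.exp_eq_exp_ℝ] at h3
    rw [← h2.tsum_eq]
    refine tsum_of_norm_bounded h3 fun n => ?_
    have hp : 0 ≤ (t / ε) ^ n := pow_nonneg (div_nonneg ht hε.le) n
    rw [smul_pow, norm_smul, norm_smul, Real.norm_of_nonneg hp, Real.norm_of_nonneg (by positivity),
      smul_eq_mul]
    refine mul_le_mul_of_nonneg_left ?_ (by positivity)
    exact mul_le_of_le_one_right hp (E.norm_resolventL_pow_le hε n)
  calc _ ≤ Real.exp (-(t / ε)) * Real.exp (t / ε) :=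
        mul_le_mul_of_nonneg_left h1 (Real.exp_pos _).le
    _ = 1 := by rw [← Real.exp_add]; simp

theorem norm_yosidaExp_apply_le {t : ℝ} (ht : 0 ≤ t) (f : Lp ℝ 2 μ) :
    ‖E.yosidaExp hε t f‖ ≤ ‖f‖ := by
  simpa using (E.yosidaExp hε t).le_of_opNorm_le (E.norm_yosidaExp_le hε ht) f

theorem yosidaExp_nonneg {t : ℝ} (ht : 0 ≤ t) {f : Lp ℝ 2 μ} (hf : 0 ≤ f) :
    0 ≤ E.yosidaExp hε t f := by
  have hJ : ∀ n : ℕ, 0 ≤ (E.resolventL hε ^ n) f := by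
    intro n
    induction n with
    | zero => simpa using hf
    | succ n ih =>
      rw [pow_succ', mul_apply_eq_comp, ← Lp.coeFn_nonneg]
      exact E.le_resolvent_of_le hε le_rfl ((Lp.coeFn_nonneg _).2 ih)
  rw [yosidaExp_eq, smul_apply]
  refine lp_smul_nonneg (Real.exp_pos _).le ?_
  have h2 := (NormedSpace.exp_series_hasSum_exp' (𝕂 := ℝ) ((t / ε) • E.resolventL hε)).mapL
    (ContinuousLinearMap.apply ℝ (Lp ℝ 2 μ) f)
  refine h2.nonneg fun n => ?_
  simp only [ContinuousLinearMap.apply_apply, smul_pow, smul_apply]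
  exact lp_smul_nonneg (by positivity)
    (lp_smul_nonneg (pow_nonneg (div_nonneg ht hε.le) n) (hJ n))

theorem commute_resolventL : Commute (E.resolventL hε) (E.resolventL hδ) := by
  ext1 f
  simp only [mul_apply_eq_comp, resolventL_apply]
  rw [E.resolvent_comm]

theorem commute_resolventL_yosida : Commute (E.resolventL hε) (E.yosida hδ) :=
  ((E.commute_resolventL hε hδ).sub_right (Commute.one_right _)).smul_right _

theorem commute_yosida : Commute (E.yosida hε) (E.yosida hδ) :=
  ((E.commute_resolventL_yosida hε hδ).sub_left (Commute.one_left _)).smul_left _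

theorem yosida_apply_of_hasLaplacian {f : E.domain} {k : Lp ℝ 2 μ} (hf : E.HasLaplacian f k) :
    E.yosida hε f = E.resolventL hε k := by
  have := congrArg (Subtype.val) (E.resolvent_sub_self hε hf)
  rw [Submodule.coe_sub, Submodule.coe_smul] at this
  rw [yosida, smul_apply, sub_apply,
    one_apply_eq_self, resolventL_apply, this, smul_smul, inv_mul_cancel₀ hε.ne',
    one_smul, resolventL_apply]

/-- Two commuting Yosida semigroups differ by at most `t` times the difference of their
generators. -/
theorem norm_yosidaExp_sub_le {t : ℝ} (ht : 0 ≤ t) (f : Lp ℝ 2 μ) :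
    ‖E.yosidaExp hε t f - E.yosidaExp hδ t f‖ ≤ ‖E.yosida hε f - E.yosida hδ f‖ * t := by
  let _ : NormedAlgebra ℚ (Lp ℝ 2 μ →L[ℝ] Lp ℝ 2 μ) := NormedAlgebra.restrictScalars ℚ ℝ _
  set A := E.yosida hε
  set B := E.yosida hδ
  have hAB : Commute A B := E.commute_yosida hε hδ
  have hsplit : ∀ s : ℝ, NormedSpace.exp (s • (A - B)) * NormedSpace.exp (t • B)
      = NormedSpace.exp (s • A) * NormedSpace.exp ((t - s) • B) := by
    intro s
    rw [← NormedSpace.exp_add_of_commute, ← NormedSpace.exp_add_of_commute]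
    · congr 1
      rw [smul_sub, sub_smul]; abel
    · exact (hAB.smul_left _).smul_right _
    · exact ((hAB.sub_left (Commute.refl B)).smul_left _).smul_right _
  have hd : ∀ s : ℝ, HasDerivAt
      (fun s : ℝ => (NormedSpace.exp (s • (A - B)) * NormedSpace.exp (t • B)) f)
      ((NormedSpace.exp (s • (A - B)) * (A - B) * NormedSpace.exp (t • B)) f) s := fun s =>
    (((hasDerivAt_exp_smul_const (A - B) s).mul_const (NormedSpace.exp (t • B))).clm_apply
      (hasDerivAt_const s f)).congr_deriv (by simp)
  have hc : Commute (A - B) (NormedSpace.exp (t • B)) :=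
    ((hAB.sub_left (Commute.refl B)).smul_right t).exp_right
  have hbound : ∀ s ∈ Set.Ico (0 : ℝ) t,
      ‖(NormedSpace.exp (s • (A - B)) * (A - B) * NormedSpace.exp (t • B)) f‖ ≤ ‖A f - B f‖ := by
    intro s hs
    rw [mul_assoc, hc.eq, ← mul_assoc, hsplit]
    change ‖E.yosidaExp hε s (E.yosidaExp hδ (t - s) ((A - B) f))‖ ≤ _
    refine (E.norm_yosidaExp_apply_le hε hs.1 _).trans ?_
    exact E.norm_yosidaExp_apply_le hδ (by linarith [hs.2]) _
  have := norm_image_sub_le_of_norm_deriv_le_segment' (fun s _ => (hd s).hasDerivWithinAt) hbound t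
    (Set.right_mem_Icc.2 ht)
  simpa [hsplit, yosidaExp] using this

/-- The Yosida semigroups applied to `f ∈ 𝔻` converge, locally uniformly in time. -/
theorem exists_tendsto_yosidaExp {ε : ℕ → ℝ} (hε : ∀ n, 0 < ε n) (hlim : Tendsto ε atTop (𝓝 0))
    {f : E.domain} {k : Lp ℝ 2 μ} (hf : E.HasLaplacian f k) :
    ∃ (u : ℝ → Lp ℝ 2 μ), ∀ n, ∀ t : ℝ, 0 ≤ t →
      ‖E.yosidaExp (hε n) t f - u t‖ ≤ ‖E.resolventL (hε n) k - k‖ * t := by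
  have hlimk : Tendsto (fun m => E.resolventL (hε m) k) atTop (𝓝 k) :=
    E.tendsto_resolvent hε hlim k
  have hex : ∀ t : ℝ, ∃ v, 0 ≤ t → Tendsto (fun n => E.yosidaExp (hε n) t f) atTop (𝓝 v) := by
    intro t
    by_cases ht : 0 ≤ t
    · have hC : CauchySeq fun n => E.yosidaExp (hε n) t f := by
        have hk := hlimk.cauchySeq
        rw [Metric.cauchySeq_iff] at hk ⊢
        intro η hη
        obtain ⟨N, hN⟩ := hk (η / (t + 1)) (by positivity)
        refine ⟨N, fun m hm n hn => ?_⟩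
        have h1 := hN m hm n hn
        rw [dist_eq_norm] at h1 ⊢
        have h2 := E.norm_yosidaExp_sub_le (hε m) (hε n) ht f
        rw [E.yosida_apply_of_hasLaplacian _ hf, E.yosida_apply_of_hasLaplacian _ hf] at h2
        rw [lt_div_iff₀ (by positivity)] at h1
        nlinarith [norm_nonneg (E.resolventL (hε m) k - E.resolventL (hε n) k)]
      obtain ⟨v, hv⟩ := cauchySeq_tendsto_of_complete hC
      exact ⟨v, fun _ => hv⟩
    · exact ⟨0, fun h => absurd h ht⟩
  choose u hu using hex
  refine ⟨u, fun n t ht => ?_⟩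
  have h1 : Tendsto (fun m => ‖E.yosidaExp (hε n) t f - E.yosidaExp (hε m) t f‖) atTop
      (𝓝 ‖E.yosidaExp (hε n) t f - u t‖) := (tendsto_const_nhds.sub (hu t ht)).norm
  have h2 : Tendsto (fun m => ‖E.resolventL (hε n) k - E.resolventL (hε m) k‖ * t) atTop
      (𝓝 (‖E.resolventL (hε n) k - k‖ * t)) :=
    ((tendsto_const_nhds.sub hlimk).norm).mul_const t
  refine le_of_tendsto_of_tendsto' h1 h2 fun m => ?_
  have h2 := E.norm_yosidaExp_sub_le (hε n) (hε m) ht f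
  rwa [E.yosida_apply_of_hasLaplacian _ hf, E.yosida_apply_of_hasLaplacian _ hf] at h2

theorem one_div_add_one_pos (n : ℕ) : 0 < 1 / ((n : ℝ) + 1) := Nat.one_div_pos_of_nat

/-- The graph of the Laplacian is closed. -/
theorem HasLaplacian.of_tendsto {f : ℕ → E.domain} {k : ℕ → Lp ℝ 2 μ} {u v : Lp ℝ 2 μ}
    (hf : ∀ n, E.HasLaplacian (f n) (k n)) (hu : Tendsto (fun n => (f n : Lp ℝ 2 μ)) atTop (𝓝 u))
    (hv : Tendsto k atTop (𝓝 v)) :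
    ∃ h : u ∈ E.domain, E.HasLaplacian ⟨u, h⟩ v := by
  have h1 : ∀ n, E.resolventL one_pos ((f n : Lp ℝ 2 μ) - k n) = f n := fun n => by
    have := HasLaplacian.resolvent_sub E one_pos (hf n)
    rw [one_smul] at this
    rw [resolventL_apply, this]
  have h2 : Tendsto (fun n => (f n : Lp ℝ 2 μ)) atTop (𝓝 (E.resolventL one_pos (u - v))) := by
    have := ((E.resolventL one_pos).continuous.tendsto (u - v)).comp (hu.sub hv)
    refine this.congr fun n => ?_
    exact h1 n
  have h3 : u = E.resolventL one_pos (u - v) := tendsto_nhds_unique hu h2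
  have h4 : u ∈ E.domain := by rw [h3]; exact (E.resolvent one_pos (u - v)).2
  refine ⟨h4, ?_⟩
  have h5 : (⟨u, h4⟩ : E.domain) = E.resolvent one_pos (u - v) := Subtype.ext h3
  rw [h5]
  have h6 := E.hasLaplacian_resolvent one_pos (u - v)
  rw [← h5] at h6 ⊢
  simpa using h6

/-- Existence of the heat flow from `f ≥ 0`, when `f` and `Δf` are in `𝔻`: it is the limit of the
Yosida semigroups, hence nonnegative. The flow from `Δf` provides the time derivative. -/
theorem exists_isHeatFlow {f g : E.domain} {k : Lp ℝ 2 μ} (hf : E.HasLaplacian f g)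
    (hg : E.HasLaplacian g k) (hf0 : 0 ≤ (f : Lp ℝ 2 μ)) :
    ∃ u : ℝ → Lp ℝ 2 μ, E.IsHeatFlow f u ∧ ∀ t, 0 ≤ t → 0 ≤ u t := by
  set hε : ∀ n : ℕ, 0 < 1 / ((n : ℝ) + 1) := one_div_add_one_pos with hεdef
  have hlim : Tendsto (fun n : ℕ => 1 / ((n : ℝ) + 1)) atTop (𝓝 0) :=
    tendsto_one_div_add_atTop_nhds_zero_nat
  obtain ⟨u, hu⟩ := E.exists_tendsto_yosidaExp hε hlim hf
  obtain ⟨v, hv⟩ := E.exists_tendsto_yosidaExp hε hlim hg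
  have hJ : ∀ h : Lp ℝ 2 μ, Tendsto (fun n => ‖E.resolventL (hε n) h - h‖) atTop (𝓝 0) :=
    fun h => tendsto_iff_norm_sub_tendsto_zero.1 (E.tendsto_resolvent hε hlim h)
  have hut : ∀ t, 0 ≤ t → Tendsto (fun n => E.yosidaExp (hε n) t f) atTop (𝓝 (u t)) := by
    intro t ht
    rw [tendsto_iff_norm_sub_tendsto_zero]
    refine squeeze_zero (fun _ => norm_nonneg _) (fun n => hu n t ht) ?_
    simpa using (hJ g).mul_const t
  -- the time derivative of the approximate flow
  have hder : ∀ n (t : ℝ), HasDerivAt (fun s => E.yosidaExp (hε n) s f)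
      (E.resolventL (hε n) (E.yosidaExp (hε n) t g)) t := by
    intro n t
    have h1 := (hasDerivAt_exp_smul_const (E.yosida (hε n)) t).clm_apply
      (hasDerivAt_const t (f : Lp ℝ 2 μ))
    refine h1.congr_deriv ?_
    rw [map_zero, add_zero, mul_apply_eq_comp, E.yosida_apply_of_hasLaplacian _ hf]
    have hc : Commute (E.resolventL (hε n)) (NormedSpace.exp (t • E.yosida (hε n))) :=
      ((E.commute_resolventL_yosida (hε n) (hε n)).smul_right t).exp_right
    exact (DFunLike.congr_fun hc.eq (g : Lp ℝ 2 μ)).symm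
  have hdist : ∀ n (t : ℝ), 0 ≤ t → ‖E.resolventL (hε n) (E.yosidaExp (hε n) t g) - v t‖ ≤
      ‖E.resolventL (hε n) g - g‖ + ‖E.resolventL (hε n) k - k‖ * t := by
    intro n t ht
    have hc : Commute (E.resolventL (hε n)) (NormedSpace.exp (t • E.yosida (hε n))) :=
      ((E.commute_resolventL_yosida (hε n) (hε n)).smul_right t).exp_right
    have e1 : E.resolventL (hε n) (E.yosidaExp (hε n) t g)
        = E.yosidaExp (hε n) t (E.resolventL (hε n) g) := DFunLike.congr_fun hc.eq (g : Lp ℝ 2 μ)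
    have e2 : E.resolventL (hε n) (E.yosidaExp (hε n) t g) - v t
        = E.yosidaExp (hε n) t (E.resolventL (hε n) g - g)
          + (E.yosidaExp (hε n) t g - v t) := by
      rw [e1, map_sub]; abel
    rw [e2]
    exact (norm_add_le _ _).trans (add_le_add (E.norm_yosidaExp_apply_le _ ht _) (hv n t ht))
  have hunif : ∀ T : ℝ, TendstoUniformlyOn
      (fun n t => E.resolventL (hε n) (E.yosidaExp (hε n) t g)) v atTop (Set.Ioo 0 T) := by
    intro T
    rw [Metric.tendstoUniformlyOn_iff]
    intro η hη
    have h0 : Tendsto (fun n => ‖E.resolventL (hε n) g - g‖ + ‖E.resolventL (hε n) k - k‖ * T)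
        atTop (𝓝 0) := by simpa using (hJ g).add ((hJ k).mul_const T)
    filter_upwards [h0.eventually (gt_mem_nhds hη)] with n hn t ht
    rw [dist_comm, dist_eq_norm]
    refine lt_of_le_of_lt ((hdist n t ht.1.le).trans ?_) hn
    have := mul_le_mul_of_nonneg_left ht.2.le (norm_nonneg (E.resolventL (hε n) k - k))
    linarith
  have hvt : ∀ t, 0 ≤ t → Tendsto (fun n => E.resolventL (hε n) (E.yosidaExp (hε n) t g)) atTop
      (𝓝 (v t)) := by
    intro t ht
    rw [tendsto_iff_norm_sub_tendsto_zero]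
    refine squeeze_zero (fun _ => norm_nonneg _) (fun n => hdist n t ht) ?_
    simpa using (hJ g).add ((hJ k).mul_const t)
  have hlap : ∀ t, 0 ≤ t → ∃ h : u t ∈ E.domain, E.HasLaplacian ⟨u t, h⟩ (v t) := by
    intro t ht
    refine HasLaplacian.of_tendsto E
      (f := fun n => E.resolvent (hε n) (E.yosidaExp (hε n) t f))
      (k := fun n => E.resolventL (hε n) (E.yosidaExp (hε n) t g)) (fun n => ?_) ?_ (hvt t ht)
    · have h1 := E.hasLaplacian_resolvent (hε n) (E.yosidaExp (hε n) t f)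
      convert h1 using 1
      have hc : Commute (E.yosida (hε n)) (NormedSpace.exp (t • E.yosida (hε n))) :=
        ((Commute.refl _).smul_right t).exp_right
      have hc' : Commute (E.resolventL (hε n)) (NormedSpace.exp (t • E.yosida (hε n))) :=
        ((E.commute_resolventL_yosida (hε n) (hε n)).smul_right t).exp_right
      have h2 : E.yosida (hε n) (E.yosidaExp (hε n) t f)
        = E.yosidaExp (hε n) t (E.yosida (hε n) f) := DFunLike.congr_fun hc.eq (f : Lp ℝ 2 μ)
      rw [E.yosida_apply_of_hasLaplacian _ hf] at h2
      exact (DFunLike.congr_fun hc'.eq (g : Lp ℝ 2 μ)).trans h2.symm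
    · rw [tendsto_iff_norm_sub_tendsto_zero]
      refine squeeze_zero (fun _ => norm_nonneg _)
        (g := fun n => ‖E.yosidaExp (hε n) t f - u t‖ + ‖E.resolventL (hε n) (u t) - u t‖)
        (fun n => ?_) ?_
      · have e : (E.resolvent (hε n) (E.yosidaExp (hε n) t f) : Lp ℝ 2 μ) - u t
            = E.resolventL (hε n) (E.yosidaExp (hε n) t f - u t)
              + (E.resolventL (hε n) (u t) - u t) := by
          rw [map_sub, resolventL_apply]; abel
        rw [e]
        refine (norm_add_le _ _).trans (add_le_add ?_ le_rfl)
        exact E.norm_resolvent_le _ _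
      · simpa using (tendsto_iff_norm_sub_tendsto_zero.1 (hut t ht)).add (hJ (u t))
  refine ⟨u, ⟨?_, ?_, ?_⟩, fun t ht => ?_⟩
  · have h1 := hut 0 le_rfl
    have h2 : ∀ n, E.yosidaExp (hε n) 0 (f : Lp ℝ 2 μ) = f := fun n => by simp [yosidaExp]
    simp only [h2] at h1
    exact tendsto_nhds_unique h1 tendsto_const_nhds
  · -- local uniform limit of continuous functions
    refine TendstoLocallyUniformlyOn.continuousOn (p := atTop)
      (F := fun n t => E.yosidaExp (hε n) t f) ?_
      (Frequently.of_forall fun n =>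
        (continuous_iff_continuousAt.2 fun t => (hder n t).continuousAt).continuousOn)
    rw [Metric.tendstoLocallyUniformlyOn_iff]
    intro η hη t _
    refine ⟨Set.Iio (t + 1) ∩ Set.Ici 0, inter_mem
      (mem_nhdsWithin_of_mem_nhds (Iio_mem_nhds (by linarith))) self_mem_nhdsWithin, ?_⟩
    have h0 : Tendsto (fun n => ‖E.resolventL (hε n) g - g‖ * (t + 1)) atTop (𝓝 0) := by
      simpa using (hJ g).mul_const (t + 1)
    filter_upwards [h0.eventually (gt_mem_nhds hη)] with n hn s hs
    rw [dist_comm, dist_eq_norm]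
    refine lt_of_le_of_lt ((hu n s hs.2).trans ?_) hn
    exact mul_le_mul_of_nonneg_left (le_of_lt hs.1) (norm_nonneg _)
  · intro t ht
    obtain ⟨h, hL⟩ := hlap t ht.le
    refine ⟨h, ⟨v t, hL⟩, ?_⟩
    rw [hL.laplacian_eq]
    exact hasDerivAt_of_tendstoUniformlyOn isOpen_Ioo (hunif (t + 1))
      (Eventually.of_forall fun n s _ => hder n s) (fun s hs => hut s hs.1.le) ⟨ht, by linarith⟩
  · exact ge_of_tendsto' (hut t ht) fun n => E.yosidaExp_nonneg (hε n) ht hf0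

end HeatFlow

end DirichletForm

namespace DirichletForm

variable {X : Type*} [MeasurableSpace X] {μ : Measure X}

/-! ### Conservativeness -/

theorem lp_inner_eq (f g : Lp ℝ 2 μ) : inner ℝ f g = ∫ x, f x * g x ∂μ := by
  rw [L2.inner_def]
  exact integral_congr_ae (ae_of_all _ fun x => by simp [mul_comm])

theorem lp_integrable_mul (f g : Lp ℝ 2 μ) : Integrable (fun x => f x * g x) μ := by
  simpa [mul_comm] using L2.integrable_inner (𝕜 := ℝ) f g

/-- The Laplace transform in time of the mass of the heat flow `u` issuing from `f` is bounded by
`⟪f, J_ε 1⟫`: the function `t ↦ - exp (-t/ε) ⟪u t, J_ε e⟫` has derivative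
`ε⁻¹ exp (-t/ε) ⟪u t, e⟫`. -/
theorem integral_heatFlow_le (E : DirichletForm μ) {ε : ℝ} (hε : 0 < ε) {f : Lp ℝ 2 μ}
    {u : ℝ → Lp ℝ 2 μ} (hu : E.IsHeatFlow f u) (hu0 : ∀ t, 0 ≤ t → 0 ≤ u t)
    {e : Lp ℝ 2 μ} (he : ∀ᵐ x ∂μ, 0 ≤ e x) {T : ℝ} (hT : 0 ≤ T) :
    ∫ t in (0 : ℝ)..T, ε⁻¹ * Real.exp (-(ε⁻¹ * t)) * inner ℝ (u t) e ≤
      inner ℝ f (E.resolvent hε e : Lp ℝ 2 μ) := by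
  set G := E.resolvent hε e with hG
  have hcont : ContinuousOn u (Set.Icc 0 T) := hu.continuousOn.mono Set.Icc_subset_Ici_self
  have hexp : Continuous fun t : ℝ => Real.exp (-(ε⁻¹ * t)) := by fun_prop
  have hd : ∀ t ∈ Set.Ioo 0 T, HasDerivAt
      (fun t => -(Real.exp (-(ε⁻¹ * t)) * inner ℝ (u t) (G : Lp ℝ 2 μ)))
      (ε⁻¹ * Real.exp (-(ε⁻¹ * t)) * inner ℝ (u t) e) t := by
    intro t ht
    obtain ⟨hV, hL, hdu⟩ := hu.evolution t ht.1
    have h1 : HasDerivAt (fun t : ℝ => Real.exp (-(ε⁻¹ * t)))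
        (Real.exp (-(ε⁻¹ * t)) * -(ε⁻¹ * 1)) t :=
      (((hasDerivAt_id t).const_mul ε⁻¹).neg).exp
    have h2 := (h1.mul (hdu.inner ℝ (hasDerivAt_const t (G : Lp ℝ 2 μ)))).neg
    refine h2.congr_deriv ?_
    -- both sides of `⟪Δ u, G⟫ = ⟪u, Δ G⟫` are `-𝓔(u, G)`
    have h3 := E.hasLaplacian_laplacian hL G
    have h4 := E.hasLaplacian_resolvent hε e ⟨u t, hV⟩
    rw [E.symm, ← hG, h3, real_inner_smul_left, inner_sub_left] at h4
    have h5 : inner ℝ (E.laplacian ⟨u t, hV⟩) (G : Lp ℝ 2 μ)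
        = ε⁻¹ * (inner ℝ (u t) (G : Lp ℝ 2 μ) - inner ℝ (u t) e) := by
      have c1 : inner ℝ (G : Lp ℝ 2 μ) (u t) = inner ℝ (u t) (G : Lp ℝ 2 μ) := real_inner_comm _ _
      have c2 : inner ℝ e (u t) = inner ℝ (u t) e := real_inner_comm _ _
      rw [c1, c2] at h4
      linarith
    rw [inner_zero_right, zero_add, h5]
    ring
  have hc1 : ContinuousOn
      (fun t => -(Real.exp (-(ε⁻¹ * t)) * inner ℝ (u t) (G : Lp ℝ 2 μ))) (Set.Icc 0 T) :=
    (hexp.continuousOn.mul (hcont.inner continuousOn_const)).neg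
  have hc2 : ContinuousOn
      (fun t => ε⁻¹ * Real.exp (-(ε⁻¹ * t)) * inner ℝ (u t) e) (Set.uIcc 0 T) := by
    rw [Set.uIcc_of_le hT]
    exact (continuousOn_const.mul hexp.continuousOn).mul (hcont.inner continuousOn_const)
  rw [intervalIntegral.integral_eq_sub_of_hasDerivAt_of_le hT hc1 hd hc2.intervalIntegrable]
  have h0 : 0 ≤ inner ℝ (u T) (G : Lp ℝ 2 μ) := by
    rw [lp_inner_eq]
    refine integral_nonneg_of_ae ?_
    filter_upwards [(Lp.coeFn_nonneg _).2 (hu0 T hT), E.le_resolvent_of_le hε le_rfl he]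
      with x h1 h2 using mul_nonneg h1 h2
  have h1 := mul_nonneg (Real.exp_pos (-(ε⁻¹ * T))).le h0
  rw [hu.initial]
  simp only [mul_zero, neg_zero, Real.exp_zero, one_mul]
  linarith

section Exhaustion

variable (μ) [SigmaFinite μ]

/-- The indicator functions, in `L²`, of an increasing exhaustion of the space by sets of finite
measure. -/
noncomputable def exhaustion (n : ℕ) : Lp ℝ 2 μ :=
  indicatorConstLp 2 (measurableSet_spanningSets μ n) (measure_spanningSets_lt_top μ n).ne 1

theorem exhaustion_ae (n : ℕ) :
    exhaustion μ n =ᵐ[μ] (spanningSets μ n).indicator fun _ => (1 : ℝ) :=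
  indicatorConstLp_coeFn

theorem aecover_spanningSets : AECover μ atTop (spanningSets μ) where
  ae_eventually_mem := ae_of_all _ fun x => by
    have : x ∈ ⋃ n, spanningSets μ n := by rw [iUnion_spanningSets]; trivial
    obtain ⟨n, hn⟩ := Set.mem_iUnion.1 this
    filter_upwards [eventually_ge_atTop n] with m hm using monotone_spanningSets μ hm hn
  measurableSet := measurableSet_spanningSets μ

theorem exhaustion_mem_Icc (n : ℕ) : ∀ᵐ x ∂μ, 0 ≤ exhaustion μ n x ∧ exhaustion μ n x ≤ 1 := by
  filter_upwards [exhaustion_ae μ n] with x hx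
  rw [hx]
  by_cases h : x ∈ spanningSets μ n <;> simp [h]

theorem exhaustion_mono {m n : ℕ} (h : m ≤ n) : ∀ᵐ x ∂μ, exhaustion μ m x ≤ exhaustion μ n x := by
  filter_upwards [exhaustion_ae μ m, exhaustion_ae μ n] with x h1 h2
  rw [h1, h2]
  exact Set.indicator_le_indicator_of_subset (monotone_spanningSets μ h) (fun _ => zero_le_one) x

theorem inner_exhaustion (n : ℕ) (f : Lp ℝ 2 μ) :
    inner ℝ f (exhaustion μ n) = ∫ x in spanningSets μ n, f x ∂μ := by
  rw [real_inner_comm]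
  exact L2.inner_indicatorConstLp_one _ _ f

theorem ae_tendsto_exhaustion : ∀ᵐ x ∂μ, Tendsto (fun n => exhaustion μ n x) atTop (𝓝 1) := by
  filter_upwards [ae_all_iff.2 (exhaustion_ae μ), (aecover_spanningSets μ).ae_eventually_mem]
    with x h1 h2
  refine tendsto_const_nhds.congr' ?_
  filter_upwards [h2] with n hn
  rw [h1 n, Set.indicator_of_mem hn]

theorem integrable_exhaustion (n : ℕ) : Integrable (exhaustion μ n) μ := by
  refine Integrable.congr ?_ (exhaustion_ae μ n).symm
  exact (integrable_indicator_iff (measurableSet_spanningSets μ n)).2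
    (integrableOn_const (measure_spanningSets_lt_top μ n).ne)

theorem tendsto_inner_exhaustion {f : Lp ℝ 2 μ} (hf : Integrable f μ) :
    Tendsto (fun n => inner ℝ f (exhaustion μ n)) atTop (𝓝 (∫ x, f x ∂μ)) := by
  simp only [inner_exhaustion]
  exact (aecover_spanningSets μ).integral_tendsto_of_countably_generated hf

end Exhaustion

section Conservative

variable [SigmaFinite μ] (E : DirichletForm μ) {ε : ℝ} (hε : 0 < ε)

/-- The resolvent maps nonnegative functions of `L¹ ∩ L²` to `L¹`. -/
theorem integrable_resolvent_of_nonneg {h : Lp ℝ 2 μ} (hh : ∀ᵐ x ∂μ, 0 ≤ h x)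
    (hi : Integrable h μ) : Integrable (E.resolvent hε h : Lp ℝ 2 μ) μ := by
  refine (aecover_spanningSets μ).integrable_of_integral_bounded_of_nonneg_ae (∫ x, h x ∂μ)
    (fun n => integrableOn_Lp_of_measure_ne_top _ Fact.out (measure_spanningSets_lt_top μ n).ne)
    (E.le_resolvent_of_le hε le_rfl hh) (Eventually.of_forall fun n => ?_)
  rw [← inner_exhaustion, E.inner_resolvent_left, lp_inner_eq]
  refine integral_mono_ae (lp_integrable_mul _ _) hi ?_
  filter_upwards [hh, E.resolvent_le_of_le hε zero_le_one
    ((exhaustion_mem_Icc μ n).mono fun _ => And.right)] with x h1 h2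
  exact mul_le_of_le_one_right h1 h2

theorem exhaustion_resolvent_mem_Icc (n : ℕ) :
    ∀ᵐ x ∂μ, 0 ≤ (E.resolvent hε (exhaustion μ n) : Lp ℝ 2 μ) x ∧
      (E.resolvent hε (exhaustion μ n) : Lp ℝ 2 μ) x ≤ 1 :=
  (E.le_resolvent_of_le hε le_rfl ((exhaustion_mem_Icc μ n).mono fun _ => And.left)).and
    (E.resolvent_le_of_le hε zero_le_one ((exhaustion_mem_Icc μ n).mono fun _ => And.right))

/-- `∫ f ≤ ⟪f, J_ε 1⟫`, where `J_ε 1` is the increasing limit of the resolvents of the exhaustion: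
the mass of the heat flow from `f` is constant, so that its Laplace transform in time is `∫ f`. -/
theorem MassPreserving.integral_le {E : DirichletForm μ} (hmass : E.MassPreserving)
    {f g : E.domain} {k : Lp ℝ 2 μ} (hf : E.HasLaplacian f g)
    (hg : E.HasLaplacian g k) (hf0 : 0 ≤ (f : Lp ℝ 2 μ)) (hfi : Integrable (f : Lp ℝ 2 μ) μ)
    {c : ℝ} (hc : ∀ n, inner ℝ (f : Lp ℝ 2 μ) (E.resolvent hε (exhaustion μ n) : Lp ℝ 2 μ) ≤ c) :
    ∫ x, (f : Lp ℝ 2 μ) x ∂μ ≤ c := by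
  obtain ⟨u, hu, hu'⟩ := E.exists_isHeatFlow hf hg hf0
  set m := ∫ x, (f : Lp ℝ 2 μ) x ∂μ with hm
  have hinner : ∀ n t, 0 ≤ t → 0 ≤ inner ℝ (u t) (exhaustion μ n) ∧
      inner ℝ (u t) (exhaustion μ n) ≤ m := by
    intro n t ht
    obtain ⟨hi, hmt⟩ := hmass f u hfi hu t ht
    have h0 := (Lp.coeFn_nonneg _).2 (hu' t ht)
    rw [inner_exhaustion]
    refine ⟨integral_nonneg_of_ae (ae_restrict_of_ae h0), ?_⟩
    rw [hm, ← hmt]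
    exact setIntegral_le_integral hi h0
  have hlow : ∀ T : ℝ, 0 ≤ T → (1 - Real.exp (-(ε⁻¹ * T))) * m ≤ c := by
    intro T hT
    have hcont : ContinuousOn u (Set.uIcc 0 T) := by
      rw [Set.uIcc_of_le hT]
      exact hu.continuousOn.mono Set.Icc_subset_Ici_self
    have hexp : Continuous fun t : ℝ => ε⁻¹ * Real.exp (-(ε⁻¹ * t)) := by fun_prop
    have hlim : Tendsto (fun n => ∫ t in (0 : ℝ)..T, ε⁻¹ * Real.exp (-(ε⁻¹ * t))
        * inner ℝ (u t) (exhaustion μ n)) atTop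
        (𝓝 (∫ t in (0 : ℝ)..T, ε⁻¹ * Real.exp (-(ε⁻¹ * t)) * m)) := by
      refine intervalIntegral.tendsto_integral_filter_of_dominated_convergence
        (fun t => ε⁻¹ * Real.exp (-(ε⁻¹ * t)) * m) (Eventually.of_forall fun n => ?_)
        (Eventually.of_forall fun n => ?_) ?_ ?_
      · exact ((hexp.continuousOn.mul (hcont.inner continuousOn_const)).mono
          Set.uIoc_subset_uIcc).aestronglyMeasurable measurableSet_uIoc
      · refine ae_of_all _ fun t ht => ?_
        rw [Set.uIoc_of_le hT] at ht
        have h1 := hinner n t ht.1.le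
        have h2 : 0 ≤ ε⁻¹ * Real.exp (-(ε⁻¹ * t)) := by positivity
        rw [Real.norm_of_nonneg (mul_nonneg h2 h1.1)]
        exact mul_le_mul_of_nonneg_left h1.2 h2
      · exact (hexp.mul continuous_const).intervalIntegrable _ _
      · refine ae_of_all _ fun t ht => ?_
        rw [Set.uIoc_of_le hT] at ht
        obtain ⟨hi, hmt⟩ := hmass f u hfi hu t ht.1.le
        have h1 := tendsto_inner_exhaustion μ hi
        rw [hmt] at h1
        exact h1.const_mul _
    have hval : ∫ t in (0 : ℝ)..T, ε⁻¹ * Real.exp (-(ε⁻¹ * t)) * m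
        = (1 - Real.exp (-(ε⁻¹ * T))) * m := by
      rw [intervalIntegral.integral_mul_const]
      congr 1
      rw [intervalIntegral.integral_eq_sub_of_hasDerivAt
        (f := fun t => -Real.exp (-(ε⁻¹ * t))) (fun t _ => ?_) (hexp.intervalIntegrable _ _)]
      · simp; ring
      · refine ((((hasDerivAt_id t).const_mul ε⁻¹).neg).exp.neg).congr_deriv ?_
        simp only [id_eq, Pi.neg_apply]; ring
    rw [hval] at hlim
    exact le_of_tendsto' hlim fun n => (E.integral_heatFlow_le hε hu hu'
      ((exhaustion_mem_Icc μ n).mono fun _ => And.left) hT).trans (hc n)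
  have hlim : Tendsto (fun T : ℝ => (1 - Real.exp (-(ε⁻¹ * T))) * m) atTop (𝓝 ((1 - 0) * m)) := by
    have h1 : Tendsto (fun T : ℝ => ε⁻¹ * T) atTop atTop :=
      tendsto_id.const_mul_atTop (inv_pos.2 hε)
    exact ((Real.tendsto_exp_neg_atTop_nhds_zero.comp h1).const_sub 1).mul_const m
  rw [sub_zero, one_mul] at hlim
  exact le_of_tendsto hlim ((eventually_ge_atTop 0).mono hlow)

/-- A mass preserving form is conservative: `J_ε 1 = 1`. As `1` need not be in `L²`, this is stated
for the limit of the resolvents of the exhaustion. -/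
theorem MassPreserving.ae_tendsto_resolvent_exhaustion {E : DirichletForm μ}
    (hmass : E.MassPreserving) :
    ∀ᵐ x ∂μ, Tendsto (fun n => (E.resolvent hε (exhaustion μ n) : Lp ℝ 2 μ) x) atTop (𝓝 1) := by
  set G : ℕ → X → ℝ := fun n => (E.resolvent hε (exhaustion μ n) : Lp ℝ 2 μ) with hG
  have hGmono : ∀ᵐ x ∂μ, Monotone fun n => G n x := by
    filter_upwards [ae_all_iff.2 fun n => E.resolvent_mono hε (exhaustion_mono μ (Nat.le_succ n))]
      with x hx using monotone_nat_of_le_succ hx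
  have hG01 := ae_all_iff.2 (E.exhaustion_resolvent_mem_Icc hε)
  set w : X → ℝ := fun x => 1 - ⨆ n, G n x with hw
  have hlim : ∀ᵐ x ∂μ, Tendsto (fun n => 1 - G n x) atTop (𝓝 (w x)) := by
    filter_upwards [hGmono, hG01] with x h1 h2
    exact (tendsto_atTop_ciSup h1 ⟨1, by rintro _ ⟨n, rfl⟩; exact (h2 n).2⟩).const_sub 1
  have hw01 : ∀ᵐ x ∂μ, 0 ≤ w x ∧ w x ≤ 1 := by
    filter_upwards [hlim, hG01] with x h1 h2
    exact ⟨ge_of_tendsto' h1 fun n => by linarith [(h2 n).2],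
      le_of_tendsto' h1 fun n => by linarith [(h2 n).1]⟩
  have hwm : AEStronglyMeasurable w μ :=
    aestronglyMeasurable_of_tendsto_ae atTop
      (fun n => aestronglyMeasurable_const.sub (Lp.aestronglyMeasurable _)) hlim
  -- `w = 1 - J_ε 1` is orthogonal to the functions `J₁ J₁ e`
  have hfw : ∀ m, ∀ᵐ x ∂μ,
      (E.resolvent one_pos (E.resolvent one_pos (exhaustion μ m) : Lp ℝ 2 μ) : Lp ℝ 2 μ) x * w x
        = 0 := by
    intro m
    set a := E.resolvent one_pos (exhaustion μ m) with ha
    set f := E.resolvent one_pos (a : Lp ℝ 2 μ) with hf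
    have ha0 : ∀ᵐ x ∂μ, 0 ≤ (a : Lp ℝ 2 μ) x :=
      E.le_resolvent_of_le one_pos le_rfl ((exhaustion_mem_Icc μ m).mono fun _ => And.left)
    have hai : Integrable (a : Lp ℝ 2 μ) μ := E.integrable_resolvent_of_nonneg one_pos
      ((exhaustion_mem_Icc μ m).mono fun _ => And.left) (integrable_exhaustion μ m)
    have hf0 : ∀ᵐ x ∂μ, 0 ≤ (f : Lp ℝ 2 μ) x := E.le_resolvent_of_le one_pos le_rfl ha0
    have hfi : Integrable (f : Lp ℝ 2 μ) μ := E.integrable_resolvent_of_nonneg one_pos ha0 hai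
    have hbound : ∀ n, ∀ᵐ x ∂μ, ‖(f : Lp ℝ 2 μ) x * (1 - G n x)‖ ≤ (f : Lp ℝ 2 μ) x := by
      intro n
      filter_upwards [hf0, E.exhaustion_resolvent_mem_Icc hε n] with x h1 h2
      have h3 : 0 ≤ 1 - G n x := sub_nonneg.2 h2.2
      rw [Real.norm_of_nonneg (mul_nonneg h1 h3)]
      refine mul_le_of_le_one_right h1 ?_
      have : 0 ≤ G n x := h2.1
      linarith
    have hDCT := tendsto_integral_of_dominated_convergence (fun x => (f : Lp ℝ 2 μ) x)
      (fun n => (Lp.aestronglyMeasurable _).mul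
        (aestronglyMeasurable_const.sub (Lp.aestronglyMeasurable _)))
      hfi hbound (hlim.mono fun x hx => hx.const_mul ((f : Lp ℝ 2 μ) x))
    have hsplit : ∀ n, ∫ x, (f : Lp ℝ 2 μ) x * (1 - G n x) ∂μ = ∫ x, (f : Lp ℝ 2 μ) x ∂μ
        - inner ℝ (f : Lp ℝ 2 μ) (E.resolvent hε (exhaustion μ n) : Lp ℝ 2 μ) := by
      intro n
      rw [lp_inner_eq, ← integral_sub hfi (lp_integrable_mul _ _)]
      exact integral_congr_ae (ae_of_all _ fun x => by simp only [hG]; ring)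
    have hint : Integrable (fun x => (f : Lp ℝ 2 μ) x * w x) μ := by
      refine hfi.mono' ((Lp.aestronglyMeasurable _).mul hwm) ?_
      filter_upwards [hf0, hw01] with x h1 h2
      rw [Real.norm_of_nonneg (mul_nonneg h1 h2.1)]
      exact mul_le_of_le_one_right h1 h2.2
    have hnn : ∀ᵐ x ∂μ, 0 ≤ (f : Lp ℝ 2 μ) x * w x := by
      filter_upwards [hf0, hw01] with x h1 h2 using mul_nonneg h1 h2.1
    have hle : ∫ x, (f : Lp ℝ 2 μ) x * w x ∂μ ≤ 0 := by
      have hL := HasLaplacian.resolvent E one_pos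
        (E.hasLaplacian_resolvent one_pos (exhaustion μ m))
      have h1 := hmass.integral_le hε hL (E.hasLaplacian_resolvent one_pos _)
        ((Lp.coeFn_nonneg _).1 hf0) hfi
        (c := ∫ x, (f : Lp ℝ 2 μ) x ∂μ - ∫ x, (f : Lp ℝ 2 μ) x * w x ∂μ) (fun n => ?_)
      · linarith
      · have h2 := hsplit n
        have h3 : ∫ x, (f : Lp ℝ 2 μ) x * w x ∂μ ≤ ∫ x, (f : Lp ℝ 2 μ) x * (1 - G n x) ∂μ := by
          refine integral_mono_ae hint (hfi.mono' ((Lp.aestronglyMeasurable _).mul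
            (aestronglyMeasurable_const.sub (Lp.aestronglyMeasurable _))) (hbound n)) ?_
          filter_upwards [hf0, hGmono, hlim] with x h1 h2 h3
          refine mul_le_mul_of_nonneg_left ?_ h1
          exact Antitone.le_of_tendsto (fun i j hij => sub_le_sub_left (h2 hij) 1) h3 n
        linarith
    have hz : ∫ x, (f : Lp ℝ 2 μ) x * w x ∂μ = 0 := le_antisymm hle (integral_nonneg_of_ae hnn)
    exact (integral_eq_zero_iff_of_nonneg_ae hnn hint).1 hz
  -- hence `J₁ J₁ w = 0` locally, and `w = 0` by injectivity of the resolvent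
  have hwk : ∀ k, ∀ᵐ x ∂μ, exhaustion μ k x * w x = 0 := by
    intro k
    have hmem : MemLp (fun x => exhaustion μ k x * w x) 2 μ := by
      refine (Lp.memLp (exhaustion μ k)).mono ((Lp.aestronglyMeasurable _).mul hwm) ?_
      filter_upwards [hw01] with x hx
      rw [norm_mul, Real.norm_of_nonneg hx.1]
      exact mul_le_of_le_one_right (norm_nonneg _) hx.2
    set W : Lp ℝ 2 μ := hmem.toLp _ with hW
    have hWae : W =ᵐ[μ] fun x => exhaustion μ k x * w x := hmem.coeFn_toLp
    have hW0 : ∀ᵐ x ∂μ, 0 ≤ W x := by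
      filter_upwards [hWae, hw01, exhaustion_mem_Icc μ k] with x h1 h2 h3
      rw [h1]; exact mul_nonneg h3.1 h2.1
    set V := E.resolvent one_pos (E.resolvent one_pos W : Lp ℝ 2 μ) with hV
    have hV0 : ∀ᵐ x ∂μ, 0 ≤ (V : Lp ℝ 2 μ) x :=
      E.le_resolvent_of_le one_pos le_rfl (E.le_resolvent_of_le one_pos le_rfl hW0)
    have hVm : ∀ m, ∀ᵐ x ∂μ, exhaustion μ m x * (V : Lp ℝ 2 μ) x = 0 := by
      intro m
      have h1 : ∫ x, exhaustion μ m x * (V : Lp ℝ 2 μ) x ∂μ = 0 := by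
        rw [← lp_inner_eq, hV, ← E.inner_resolvent_left, ← E.inner_resolvent_left, lp_inner_eq]
        refine integral_eq_zero_of_ae ?_
        filter_upwards [hfw m, hWae] with x h1 h2
        rw [h2, Pi.zero_apply, mul_left_comm, h1, mul_zero]
      refine (integral_eq_zero_iff_of_nonneg_ae ?_ (lp_integrable_mul _ _)).1 h1
      filter_upwards [hV0, exhaustion_mem_Icc μ m] with x h2 h3 using mul_nonneg h3.1 h2
    have hVz : (V : Lp ℝ 2 μ) = 0 := by
      rw [Lp.eq_zero_iff_ae_eq_zero]
      filter_upwards [ae_all_iff.2 hVm, ae_tendsto_exhaustion μ] with x h1 h2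
      have h3 := h2.mul_const ((V : Lp ℝ 2 μ) x)
      simp only [h1, one_mul] at h3
      exact tendsto_nhds_unique h3 tendsto_const_nhds
    have h1 : E.resolventL one_pos (E.resolventL one_pos W) = 0 := hVz
    have h2 : W = 0 := by
      have h3 := (E.resolventL_injective one_pos) (h1.trans (map_zero _).symm)
      exact (E.resolventL_injective one_pos) (h3.trans (map_zero _).symm)
    rw [Lp.eq_zero_iff_ae_eq_zero] at h2
    filter_upwards [h2, hWae] with x h3 h4
    rw [← h4, h3, Pi.zero_apply]
  filter_upwards [ae_all_iff.2 hwk, ae_tendsto_exhaustion μ, hlim] with x h1 h2 h3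
  have h4 := h2.mul_const (w x)
  simp only [h1, one_mul] at h4
  have h5 : w x = 0 := tendsto_nhds_unique h4 tendsto_const_nhds
  rw [h5] at h3
  have h6 := h3.const_sub 1
  simpa using h6

end Conservative

end DirichletForm

namespace DirichletForm

variable {X : Type*} [MeasurableSpace X] {μ : Measure X}

/-! ### The algebra of bounded functions of finite energy -/

theorem exists_abs_le {f : X → ℝ} (hf : MemLp f ∞ μ) : ∃ M, 0 < M ∧ ∀ᵐ x ∂μ, |f x| ≤ M := by
  obtain ⟨M, hM⟩ := eLpNormEssSup_lt_top_iff_isBoundedUnder.1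
    (eLpNorm_exponent_top (f := f) (μ := μ) ▸ hf.2)
  rw [eventually_map] at hM
  refine ⟨M + 1, by positivity, ?_⟩
  filter_upwards [hM] with x hx
  have : ‖f x‖ ≤ M := by exact_mod_cast hx
  rw [Real.norm_eq_abs] at this
  linarith

theorem memLp_top_of_abs_le {f : Lp ℝ 2 μ} {M : ℝ} (hf : ∀ᵐ x ∂μ, |f x| ≤ M) : MemLp f ∞ μ :=
  memLp_top_of_bound (Lp.aestronglyMeasurable f) M hf

theorem memLp_top_mul {f g h : Lp ℝ 2 μ} (hf : MemLp f ∞ μ) (hg : MemLp g ∞ μ)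
    (hh : ∀ᵐ x ∂μ, h x = f x * g x) : MemLp h ∞ μ := by
  obtain ⟨M, hM, hfM⟩ := exists_abs_le hf
  obtain ⟨N, hN, hgN⟩ := exists_abs_le hg
  refine memLp_top_of_abs_le (M := M * N) ?_
  filter_upwards [hh, hfM, hgN] with x h1 h2 h3
  rw [h1, abs_mul]
  exact mul_le_mul h2 h3 (abs_nonneg _) hM.le

theorem memLp_top_resolvent (E : DirichletForm μ) {ε : ℝ} (hε : 0 < ε) {h : Lp ℝ 2 μ}
    (hh : MemLp h ∞ μ) : MemLp (E.resolvent hε h : Lp ℝ 2 μ) ∞ μ := by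
  obtain ⟨M, hM, hhM⟩ := exists_abs_le hh
  exact memLp_top_of_abs_le (E.abs_resolvent_le hε hM.le hhM)

/-- `f² / (2M)` is a normal contraction of `f` when `|f| ≤ M`. -/
theorem exists_sq_mem (E : DirichletForm μ) {f : E.domain} (hf : MemLp (f : Lp ℝ 2 μ) ∞ μ) :
    ∃ h : E.domain, ∀ᵐ x ∂μ, (h : Lp ℝ 2 μ) x = (f : Lp ℝ 2 μ) x ^ 2 := by
  obtain ⟨M, hM, hfM⟩ := exists_abs_le hf
  set η : ℝ → ℝ := fun s => (max (-M) (min s M)) ^ 2 / (2 * M) with hη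
  have hcl : ∀ s, |max (-M) (min s M)| ≤ M := fun s =>
    abs_le.2 ⟨le_max_left _ _, max_le (by linarith) (min_le_right _ _)⟩
  have hL : LipschitzWith 1 fun s : ℝ => max (-M) (min s M) :=
    (LipschitzWith.id.min_const M).const_max (-M)
  have hηL : LipschitzWith 1 η := by
    refine LipschitzWith.of_dist_le_mul fun s t => ?_
    have h1 := hL.dist_le_mul s t
    rw [Real.dist_eq] at h1 ⊢
    simp only [hη]
    set a := max (-M) (min s M)
    set b := max (-M) (min t M)
    have h2 : |a + b| ≤ 2 * M := (abs_add_le a b).trans (by linarith [hcl s, hcl t])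
    have h3 : a ^ 2 / (2 * M) - b ^ 2 / (2 * M) = (a + b) / (2 * M) * (a - b) := by ring
    rw [h3, abs_mul, abs_div, abs_of_pos (by linarith : 0 < 2 * M)]
    refine le_trans ?_ h1
    refine mul_le_of_le_one_left (abs_nonneg _) ?_
    exact (div_le_one (by linarith)).2 h2
  have hη0 : η 0 = 0 := by simp [hη, hM.le]
  obtain ⟨h, -⟩ := E.markov η hηL hη0 f
  refine ⟨(2 * M) • ⟨_, h⟩, ?_⟩
  filter_upwards [hηL.coeFn_compLp hη0 (f : Lp ℝ 2 μ), hfM,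
    Lp.coeFn_smul (2 * M) (hηL.compLp hη0 (f : Lp ℝ 2 μ))] with x h1 h2 h3
  rw [Submodule.coe_smul, h3, Pi.smul_apply, h1, smul_eq_mul, Function.comp_apply]
  simp only [hη]
  rw [min_eq_left (abs_le.1 h2).2, max_eq_right (abs_le.1 h2).1]
  field_simp

/-- `𝕍 ∩ L^∞` is an algebra, by polarization. -/
theorem exists_mul_mem (E : DirichletForm μ) {f g : E.domain} (hf : MemLp (f : Lp ℝ 2 μ) ∞ μ)
    (hg : MemLp (g : Lp ℝ 2 μ) ∞ μ) :
    ∃ h : E.domain, ∀ᵐ x ∂μ, (h : Lp ℝ 2 μ) x = (f : Lp ℝ 2 μ) x * (g : Lp ℝ 2 μ) x := by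
  have hadd : MemLp ((f + g : E.domain) : Lp ℝ 2 μ) ∞ μ :=
    (memLp_congr_ae (Lp.coeFn_add (f : Lp ℝ 2 μ) g)).2 (hf.add hg)
  obtain ⟨a, ha⟩ := E.exists_sq_mem hf
  obtain ⟨b, hb⟩ := E.exists_sq_mem hg
  obtain ⟨c, hc⟩ := E.exists_sq_mem hadd
  refine ⟨(1 / 2 : ℝ) • (c - a - b), ?_⟩
  filter_upwards [ha, hb, hc, Lp.coeFn_add (f : Lp ℝ 2 μ) g,
    Lp.coeFn_smul (1 / 2 : ℝ) ((c : Lp ℝ 2 μ) - (a : Lp ℝ 2 μ) - (b : Lp ℝ 2 μ)),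
    Lp.coeFn_sub ((c : Lp ℝ 2 μ) - (a : Lp ℝ 2 μ)) (b : Lp ℝ 2 μ),
    Lp.coeFn_sub (c : Lp ℝ 2 μ) (a : Lp ℝ 2 μ)] with x h1 h2 h3 h4 h5 h6 h7
  rw [Submodule.coe_smul, Submodule.coe_sub, Submodule.coe_sub, h5, Pi.smul_apply, h6, Pi.sub_apply,
    h7, Pi.sub_apply, h1, h2, h3, Submodule.coe_add, h4, Pi.add_apply, smul_eq_mul]
  ring

theorem exists_posPart_mem (E : DirichletForm μ) (f : E.domain) :
    ∃ h : E.domain, ∀ᵐ x ∂μ, (h : Lp ℝ 2 μ) x = max ((f : Lp ℝ 2 μ) x) 0 := by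
  have hL : LipschitzWith 1 fun s : ℝ => max s 0 := LipschitzWith.id.max_const 0
  obtain ⟨h, -⟩ := E.markov _ hL (by simp) f
  refine ⟨⟨_, h⟩, ?_⟩
  filter_upwards [hL.coeFn_compLp (by simp) (f : Lp ℝ 2 μ)] with x h1
  exact h1

/-! ### Calculus of the Carré du Champ -/

theorem tendsto_integral_mul_of_bounded {F : X → ℝ} (hF : Integrable F μ) {a : ℕ → X → ℝ}
    {b : X → ℝ} (ha : ∀ n, AEStronglyMeasurable (a n) μ) {c : ℝ}
    (hc : ∀ n, ∀ᵐ x ∂μ, |a n x| ≤ c)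
    (hlim : ∀ᵐ x ∂μ, Tendsto (fun n => a n x) atTop (𝓝 (b x))) :
    Tendsto (fun n => ∫ x, F x * a n x ∂μ) atTop (𝓝 (∫ x, F x * b x ∂μ)) := by
  refine tendsto_integral_of_dominated_convergence (fun x => |F x| * c)
    (fun n => hF.1.mul (ha n)) (hF.abs.mul_const c) (fun n => ?_) ?_
  · filter_upwards [hc n] with x hx
    rw [norm_mul, Real.norm_eq_abs, Real.norm_eq_abs]
    exact mul_le_mul_of_nonneg_left hx (abs_nonneg _)
  · filter_upwards [hlim] with x hx using hx.const_mul _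

theorem integral_add_sub {A B C : X → ℝ} (hA : Integrable A μ) (hB : Integrable B μ)
    (hC : Integrable C μ) :
    ∫ x, A x + B x - C x ∂μ = ∫ x, A x ∂μ + ∫ x, B x ∂μ - ∫ x, C x ∂μ := by
  rw [← integral_add hA hB]
  exact integral_sub (hA.add hB) hC

theorem integrable_mul_of_memLp_top {F g : X → ℝ} (hF : Integrable F μ) (hg : MemLp g ∞ μ) :
    Integrable (fun x => F x * g x) μ := by
  obtain ⟨M, -, hM⟩ := exists_abs_le hg
  exact hF.mul_bdd hg.1 hM

namespace CarreDuChamp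

variable {E : DirichletForm μ} (Γ : E.CarreDuChamp)

theorem integrable_gamma (f g : E.domain) : Integrable (Γ.gamma f g) μ :=
  memLp_one_iff_integrable.1 (Lp.memLp _)

theorem integrable_gamma_mul (f g : E.domain) {φ : X → ℝ} (hφ : MemLp φ ∞ μ) :
    Integrable (fun x => Γ.gamma f g x * φ x) μ :=
  integrable_mul_of_memLp_top (Γ.integrable_gamma f g) hφ

/-- Pointwise Cauchy–Schwarz inequality for the Carré du Champ. -/
theorem gamma_sq_le (f g : E.domain) :
    ∀ᵐ x ∂μ, Γ.gamma f g x ^ 2 ≤ Γ.gamma f f x * Γ.gamma g g x := by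
  have h1 : ∀ q : ℚ, ∀ᵐ x ∂μ,
      0 ≤ Γ.gamma g g x * ((q : ℝ) * q) + 2 * Γ.gamma f g x * q + Γ.gamma f f x := by
    intro q
    have e : Γ.gamma (f + (q : ℝ) • g) (f + (q : ℝ) • g) = Γ.gamma f f
        + ((2 * q : ℝ) • Γ.gamma f g + ((q : ℝ) * q) • Γ.gamma g g) := by
      simp only [map_add, map_smul, LinearMap.add_apply, LinearMap.smul_apply]
      rw [Γ.symm g f]
      module
    have h2 := Γ.nonneg (f + (q : ℝ) • g)
    rw [e] at h2
    filter_upwards [h2, Lp.coeFn_add (Γ.gamma f f)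
        ((2 * q : ℝ) • Γ.gamma f g + ((q : ℝ) * q) • Γ.gamma g g),
      Lp.coeFn_add ((2 * q : ℝ) • Γ.gamma f g) (((q : ℝ) * q) • Γ.gamma g g),
      Lp.coeFn_smul (2 * q : ℝ) (Γ.gamma f g), Lp.coeFn_smul ((q : ℝ) * q) (Γ.gamma g g)]
      with x h2 h3 h4 h5 h6
    rw [h3, Pi.add_apply, h4, Pi.add_apply, h5, Pi.smul_apply, h6, Pi.smul_apply, smul_eq_mul,
      smul_eq_mul] at h2
    linarith
  filter_upwards [ae_all_iff.2 h1] with x hx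
  have h2 : ∀ t : ℝ,
      0 ≤ Γ.gamma g g x * (t * t) + 2 * Γ.gamma f g x * t + Γ.gamma f f x := by
    intro t
    refine Rat.denseRange_cast.induction_on (p := fun t : ℝ =>
      0 ≤ Γ.gamma g g x * (t * t) + 2 * Γ.gamma f g x * t + Γ.gamma f f x) t ?_ hx
    exact isClosed_le continuous_const (by fun_prop)
  have := discrim_le_zero h2
  rw [discrim] at this
  linarith

/-- The Leibniz rule, in integrated form. It only uses the identity defining the Carré du Champ:
the remaining terms of the three instances of that identity cancel. -/
theorem integral_gamma_leibniz {f g φ gφ : E.domain} (hf : MemLp (f : Lp ℝ 2 μ) ∞ μ)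
    (hg : MemLp (g : Lp ℝ 2 μ) ∞ μ) (hφ : MemLp (φ : Lp ℝ 2 μ) ∞ μ)
    (hgφ : ∀ᵐ x ∂μ, (gφ : Lp ℝ 2 μ) x = (g : Lp ℝ 2 μ) x * (φ : Lp ℝ 2 μ) x) :
    ∫ x, Γ.gamma f g x * (φ : Lp ℝ 2 μ) x ∂μ + ∫ x, Γ.gamma f φ x * (g : Lp ℝ 2 μ) x ∂μ
      = E.form f gφ := by
  obtain ⟨fφ, hfφ⟩ := E.exists_mul_mem hf hφ
  obtain ⟨fg, hfg⟩ := E.exists_mul_mem hf hg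
  have h1 := Γ.form_eq f g φ gφ fφ fg hf hg hφ hgφ hfφ hfg
  have h2 := Γ.form_eq f φ g gφ fg fφ hf hφ hg (hgφ.mono fun x hx => by rw [hx, mul_comm]) hfg hfφ
  rw [E.symm fg φ] at h1
  rw [E.symm fφ g] at h2
  linarith

/-- `Δ f² = 2 f Δf + 2 Γ(f)`, tested against bounded functions. -/
theorem form_sq_eq {f f2 φ : E.domain} {k : Lp ℝ 2 μ} (hf : MemLp (f : Lp ℝ 2 μ) ∞ μ)
    (hk : E.HasLaplacian f k) (hφ : MemLp (φ : Lp ℝ 2 μ) ∞ μ)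
    (hf2 : ∀ᵐ x ∂μ, (f2 : Lp ℝ 2 μ) x = (f : Lp ℝ 2 μ) x * (f : Lp ℝ 2 μ) x) :
    E.form f2 φ = -2 * ∫ x, k x * ((f : Lp ℝ 2 μ) x * (φ : Lp ℝ 2 μ) x) ∂μ
      - 2 * ∫ x, Γ.gamma f f x * (φ : Lp ℝ 2 μ) x ∂μ := by
  obtain ⟨fφ, hfφ⟩ := E.exists_mul_mem hf hφ
  have h1 := Γ.form_eq f f φ fφ fφ f2 hf hf hφ hfφ hfφ hf2
  rw [hk fφ, lp_inner_eq] at h1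
  have h2 : ∫ x, k x * (fφ : Lp ℝ 2 μ) x ∂μ
      = ∫ x, k x * ((f : Lp ℝ 2 μ) x * (φ : Lp ℝ 2 μ) x) ∂μ :=
    integral_congr_ae (hfφ.mono fun x hx => by simp only [hx])
  rw [h2] at h1
  linarith

/-- For a conservative form the energy is the integral of the Carré du Champ. -/
theorem integral_gamma_eq_form [SigmaFinite μ] (hmass : E.MassPreserving) {f g : E.domain}
    {k l : Lp ℝ 2 μ} (hf : MemLp (f : Lp ℝ 2 μ) ∞ μ) (hg : MemLp (g : Lp ℝ 2 μ) ∞ μ)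
    (hk : E.HasLaplacian f k) (hl : E.HasLaplacian g l) :
    ∫ x, Γ.gamma f g x ∂μ = E.form f g := by
  obtain ⟨fg, hfg⟩ := E.exists_mul_mem hf hg
  set χ : ℕ → E.domain := fun n => E.resolvent one_pos (exhaustion μ n) with hχ
  have hχ01 := E.exhaustion_resolvent_mem_Icc (μ := μ) one_pos
  have hχabs : ∀ n, ∀ᵐ x ∂μ, |(χ n : Lp ℝ 2 μ) x| ≤ 1 := fun n =>
    (hχ01 n).mono fun x hx => abs_le.2 ⟨by linarith [hx.1], hx.2⟩
  have hχlim : ∀ᵐ x ∂μ, Tendsto (fun n => (χ n : Lp ℝ 2 μ) x) atTop (𝓝 1) :=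
    hmass.ae_tendsto_resolvent_exhaustion one_pos
  have hχb : ∀ n, MemLp (χ n : Lp ℝ 2 μ) ∞ μ := fun n => memLp_top_of_abs_le (hχabs n)
  have hχm : ∀ n, AEStronglyMeasurable (χ n : Lp ℝ 2 μ) μ := fun n => Lp.aestronglyMeasurable _
  have key : ∀ n, 2 * ∫ x, Γ.gamma f g x * (χ n : Lp ℝ 2 μ) x ∂μ =
      -(∫ x, (k x * (g : Lp ℝ 2 μ) x) * (χ n : Lp ℝ 2 μ) x ∂μ)
      - (∫ x, (l x * (f : Lp ℝ 2 μ) x) * (χ n : Lp ℝ 2 μ) x ∂μ)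
      + ∫ x, ((f : Lp ℝ 2 μ) x * (g : Lp ℝ 2 μ) x)
        * ((χ n : Lp ℝ 2 μ) x - exhaustion μ n x) ∂μ := by
    intro n
    obtain ⟨gχ, hgχ⟩ := E.exists_mul_mem hg (hχb n)
    obtain ⟨fχ, hfχ⟩ := E.exists_mul_mem hf (hχb n)
    have h1 := Γ.form_eq f g (χ n) gχ fχ fg hf hg (hχb n) hgχ hfχ hfg
    rw [hk gχ, hl fχ, E.symm fg, E.hasLaplacian_resolvent one_pos (exhaustion μ n) fg, inv_one,
      one_smul, lp_inner_eq, lp_inner_eq, lp_inner_eq] at h1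
    have e1 : ∫ x, k x * (gχ : Lp ℝ 2 μ) x ∂μ
        = ∫ x, (k x * (g : Lp ℝ 2 μ) x) * (χ n : Lp ℝ 2 μ) x ∂μ :=
      integral_congr_ae (hgχ.mono fun x hx => by simp only [hx]; ring)
    have e2 : ∫ x, l x * (fχ : Lp ℝ 2 μ) x ∂μ
        = ∫ x, (l x * (f : Lp ℝ 2 μ) x) * (χ n : Lp ℝ 2 μ) x ∂μ :=
      integral_congr_ae (hfχ.mono fun x hx => by simp only [hx]; ring)
    have e3 : ∫ x, ((χ n : Lp ℝ 2 μ) - exhaustion μ n : Lp ℝ 2 μ) x * (fg : Lp ℝ 2 μ) x ∂μ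
        = ∫ x, ((f : Lp ℝ 2 μ) x * (g : Lp ℝ 2 μ) x)
          * ((χ n : Lp ℝ 2 μ) x - exhaustion μ n x) ∂μ := by
      refine integral_congr_ae ?_
      filter_upwards [hfg, Lp.coeFn_sub (χ n : Lp ℝ 2 μ) (exhaustion μ n)] with x h2 h3
      rw [h3, Pi.sub_apply, h2]
      ring
    linarith
  have l0 := (tendsto_integral_mul_of_bounded (Γ.integrable_gamma f g) hχm hχabs hχlim).const_mul 2
  have l1 := tendsto_integral_mul_of_bounded (lp_integrable_mul k g) hχm hχabs hχlim
  have l2 := tendsto_integral_mul_of_bounded (lp_integrable_mul l f) hχm hχabs hχlim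
  have l3 : Tendsto (fun n => ∫ x, ((f : Lp ℝ 2 μ) x * (g : Lp ℝ 2 μ) x)
      * ((χ n : Lp ℝ 2 μ) x - exhaustion μ n x) ∂μ) atTop
      (𝓝 (∫ x, ((f : Lp ℝ 2 μ) x * (g : Lp ℝ 2 μ) x) * 0 ∂μ)) := by
    refine tendsto_integral_mul_of_bounded (lp_integrable_mul _ _)
      (fun n => (hχm n).sub (Lp.aestronglyMeasurable _)) (c := 1) (fun n => ?_) ?_
    · filter_upwards [hχ01 n, exhaustion_mem_Icc μ n] with x h1 h2
      have h3 : 0 ≤ (χ n : Lp ℝ 2 μ) x := h1.1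
      have h4 : (χ n : Lp ℝ 2 μ) x ≤ 1 := h1.2
      rw [abs_le]
      constructor <;> linarith [h2.1, h2.2]
    · filter_upwards [hχlim, ae_tendsto_exhaustion μ] with x h1 h2
      simpa using h1.sub h2
  simp only [mul_one] at l0 l1 l2
  simp only [mul_zero, integral_zero] at l3
  have h2 := tendsto_nhds_unique l0 (((l1.neg.sub l2).add l3).congr fun n => (key n).symm)
  have h3 := hk g
  have h4 := hl f
  rw [E.symm g f] at h4
  rw [lp_inner_eq] at h3 h4
  linarith

/-- For `|f| ≤ M`, comparison of `Γ(f, f²)` with `Γ(f)`, tested against `ψ ≥ 0`: the function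
`2 M Γ(f) - Γ(f, f²)` is the limit as `ε → 0` of `(2 ε)⁻¹ J_ε ((f - c)² (2 M - f - c))`, evaluated
at `c = f`, and the function under the resolvent is nonnegative. -/
theorem integral_gamma_sq_le {f f2 ψ : E.domain} {M : ℝ} (hM : ∀ᵐ x ∂μ, |(f : Lp ℝ 2 μ) x| ≤ M)
    (hf2 : ∀ᵐ x ∂μ, (f2 : Lp ℝ 2 μ) x = (f : Lp ℝ 2 μ) x * (f : Lp ℝ 2 μ) x)
    (hψ : MemLp (ψ : Lp ℝ 2 μ) ∞ μ) (hψ0 : ∀ᵐ x ∂μ, 0 ≤ (ψ : Lp ℝ 2 μ) x) :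
    ∫ x, Γ.gamma f f2 x * (ψ : Lp ℝ 2 μ) x ∂μ
      ≤ 2 * M * ∫ x, Γ.gamma f f x * (ψ : Lp ℝ 2 μ) x ∂μ := by
  have hf : MemLp (f : Lp ℝ 2 μ) ∞ μ := memLp_top_of_abs_le hM
  have hf2b := memLp_top_mul hf hf hf2
  obtain ⟨f3, hf3⟩ := E.exists_mul_mem hf hf2b
  obtain ⟨fψ, hfψ⟩ := E.exists_mul_mem hf hψ
  obtain ⟨f2ψ, hf2ψ⟩ := E.exists_mul_mem hf2b hψ
  have h1 := Γ.form_eq f f2 ψ f2ψ fψ f3 hf hf2b hψ hf2ψ hfψ hf3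
  have h2 := Γ.form_eq f f ψ fψ fψ f2 hf hf hψ hfψ hfψ hf2
  have hε : ∀ n : ℕ, 0 < 1 / ((n : ℝ) + 1) := one_div_add_one_pos
  have hlim : Tendsto (fun n : ℕ => 1 / ((n : ℝ) + 1)) atTop (𝓝 0) :=
    tendsto_one_div_add_atTop_nhds_zero_nat
  have hT := fun a b : E.domain => E.tendsto_approxForm hε hlim a b
  have hL := (((hT f fψ).add (hT f fψ)).sub (hT f2 ψ)).const_mul (2 * M) |>.sub
    (((hT f f2ψ).add (hT f2 fψ)).sub (hT f3 ψ))
  rw [h1, h2] at hL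
  suffices h : 0 ≤ 2 * M * (2 * ∫ x, Γ.gamma f f x * (ψ : Lp ℝ 2 μ) x ∂μ)
      - 2 * ∫ x, Γ.gamma f f2 x * (ψ : Lp ℝ 2 μ) x ∂μ by linarith
  refine ge_of_tendsto' hL fun n => ?_
  set J := E.resolvent (hε n) with hJ
  -- the pointwise inequality, for rational constants `c ≤ M`
  have hrat : ∀ c : ℚ, (c : ℝ) ≤ M → ∀ᵐ x ∂μ, 0 ≤ (2 * M + c) * (J f2 : Lp ℝ 2 μ) x
      + ((c : ℝ) ^ 2 - 4 * M * c) * (J f : Lp ℝ 2 μ) x - (J f3 : Lp ℝ 2 μ) x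
      + (2 * M - c) * (c : ℝ) ^ 2 := by
    intro c hc
    by_cases hMneg : M < 0
    · filter_upwards [hM] with x hx
      exact absurd (abs_nonneg _) (not_le.2 (lt_of_le_of_lt hx hMneg))
    push Not at hMneg
    set q : Lp ℝ 2 μ := (2 * M + c) • (f2 : Lp ℝ 2 μ) + ((c : ℝ) ^ 2 - 4 * M * c) • (f : Lp ℝ 2 μ)
      - f3 with hq
    have hκ : -((2 * M - c) * (c : ℝ) ^ 2) ≤ 0 := by
      have : 0 ≤ (2 * M - c) * (c : ℝ) ^ 2 := mul_nonneg (by linarith) (sq_nonneg _)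
      linarith
    have hcoe : ∀ a b d : Lp ℝ 2 μ, ∀ᵐ x ∂μ,
        ((2 * M + c) • a + ((c : ℝ) ^ 2 - 4 * M * c) • b - d : Lp ℝ 2 μ) x
          = (2 * M + c) * a x + ((c : ℝ) ^ 2 - 4 * M * c) * b x - d x := by
      intro a b d
      filter_upwards [Lp.coeFn_sub ((2 * M + c) • a + ((c : ℝ) ^ 2 - 4 * M * c) • b) d,
        Lp.coeFn_add ((2 * M + c) • a) (((c : ℝ) ^ 2 - 4 * M * c) • b),
        Lp.coeFn_smul (2 * M + (c : ℝ)) a, Lp.coeFn_smul ((c : ℝ) ^ 2 - 4 * M * c) b]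
        with x h1 h2 h3 h4
      rw [h1, Pi.sub_apply, h2, Pi.add_apply, h3, h4]
      rfl
    have hqge : ∀ᵐ x ∂μ, -((2 * M - c) * (c : ℝ) ^ 2) ≤ q x := by
      filter_upwards [hcoe f2 f f3, hM, hf2, hf3] with x h1 h2 h3 h4
      rw [hq, h1, h4, h3]
      have h5 : 0 ≤ ((f : Lp ℝ 2 μ) x - c) ^ 2 * (2 * M - (f : Lp ℝ 2 μ) x - c) :=
        mul_nonneg (sq_nonneg _) (by linarith [(abs_le.1 h2).2])
      linarith
    have hJq : (J q : Lp ℝ 2 μ) = (2 * M + c) • (J f2 : Lp ℝ 2 μ)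
        + ((c : ℝ) ^ 2 - 4 * M * c) • (J f : Lp ℝ 2 μ) - J f3 := by
      rw [hq, map_sub, map_add, map_smul, map_smul]
      rfl
    filter_upwards [E.le_resolvent_of_le (hε n) hκ hqge, hcoe (J f2) (J f) (J f3)] with x h1 h2
    rw [← hJ, hJq, h2] at h1
    linarith
  have hpt : ∀ᵐ x ∂μ, 0 ≤ (2 * M + (f : Lp ℝ 2 μ) x) * (J f2 : Lp ℝ 2 μ) x
      + ((f : Lp ℝ 2 μ) x ^ 2 - 4 * M * (f : Lp ℝ 2 μ) x) * (J f : Lp ℝ 2 μ) x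
      - (J f3 : Lp ℝ 2 μ) x + (2 * M - (f : Lp ℝ 2 μ) x) * (f : Lp ℝ 2 μ) x ^ 2 := by
    have hrat' : ∀ᵐ x ∂μ, ∀ c : ℚ, (c : ℝ) ≤ M → 0 ≤ (2 * M + c) * (J f2 : Lp ℝ 2 μ) x
      + ((c : ℝ) ^ 2 - 4 * M * c) * (J f : Lp ℝ 2 μ) x - (J f3 : Lp ℝ 2 μ) x
      + (2 * M - c) * (c : ℝ) ^ 2 := by
      rw [ae_all_iff]
      intro c
      by_cases hc : (c : ℝ) ≤ M
      · filter_upwards [hrat c hc] with x hx _ using hx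
      · exact ae_of_all _ fun x h => absurd h hc
    filter_upwards [hrat', hM] with x h1 h2
    by_contra hneg
    push Not at hneg
    have hcont : Continuous fun c : ℝ => (2 * M + c) * (J f2 : Lp ℝ 2 μ) x
      + (c ^ 2 - 4 * M * c) * (J f : Lp ℝ 2 μ) x - (J f3 : Lp ℝ 2 μ) x
      + (2 * M - c) * c ^ 2 := by fun_prop
    have hev := hcont.continuousAt.eventually (gt_mem_nhds hneg)
    obtain ⟨l, hl, hsub⟩ := (mem_nhdsLE_iff_exists_Ioc_subset).1 (mem_nhdsWithin_of_mem_nhds hev)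
    obtain ⟨c, hc1, hc2⟩ := exists_rat_btwn (Set.mem_Iio.1 hl)
    have h3 := hsub ⟨hc1, hc2.le⟩
    exact absurd (h1 c (hc2.le.trans (abs_le.1 h2).2)) (not_le.2 h3)
  have hε0 : 0 ≤ (1 / ((n : ℝ) + 1))⁻¹ := (inv_pos.2 (hε n)).le
  have hI : 0 ≤ 2 * M * (inner ℝ ((f : Lp ℝ 2 μ) - J f) (fψ : Lp ℝ 2 μ)
      + inner ℝ ((f : Lp ℝ 2 μ) - J f) (fψ : Lp ℝ 2 μ)
      - inner ℝ ((f2 : Lp ℝ 2 μ) - J f2) (ψ : Lp ℝ 2 μ))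
      - (inner ℝ ((f : Lp ℝ 2 μ) - J f) (f2ψ : Lp ℝ 2 μ)
        + inner ℝ ((f2 : Lp ℝ 2 μ) - J f2) (fψ : Lp ℝ 2 μ)
        - inner ℝ ((f3 : Lp ℝ 2 μ) - J f3) (ψ : Lp ℝ 2 μ)) := by
    simp only [lp_inner_eq]
    have hi := fun a b : Lp ℝ 2 μ => lp_integrable_mul a b
    have hi3 : ∀ a b c d p q : Lp ℝ 2 μ,
        Integrable (fun x => a x * b x + c x * d x - p x * q x) μ :=
      fun a b c d p q => ((hi a b).add (hi c d)).sub (hi p q)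
    rw [← integral_add_sub (hi _ _) (hi _ _) (hi _ _),
      ← integral_add_sub (hi _ _) (hi _ _) (hi _ _),
      ← integral_const_mul, ← integral_sub ((hi3 _ _ _ _ _ _).const_mul _) (hi3 _ _ _ _ _ _)]
    refine integral_nonneg_of_ae ?_
    filter_upwards [hpt, hψ0, hf2, hf3, hfψ, hf2ψ, Lp.coeFn_sub (f : Lp ℝ 2 μ) (J f),
      Lp.coeFn_sub (f2 : Lp ℝ 2 μ) (J f2), Lp.coeFn_sub (f3 : Lp ℝ 2 μ) (J f3)]
      with x h1 h2 h3 h4 h5 h6 h7 h8 h9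
    simp only [Pi.zero_apply, h7, h8, h9, h6, h5, h4, h3, Pi.sub_apply]
    have := mul_nonneg h1 h2
    linarith
  have := mul_nonneg hε0 hI
  linarith

/-- For `|f| ≤ M`, `|∫ Γ(f, f²) g| ≤ 2 M ∫ Γ(f) |g|`: the two-sided form of
`integral_gamma_sq_le`, for `g` of arbitrary sign. -/
theorem abs_integral_gamma_sq_le {f f2 g : E.domain} {M : ℝ}
    (hM : ∀ᵐ x ∂μ, |(f : Lp ℝ 2 μ) x| ≤ M)
    (hf2 : ∀ᵐ x ∂μ, (f2 : Lp ℝ 2 μ) x = (f : Lp ℝ 2 μ) x * (f : Lp ℝ 2 μ) x)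
    (hg : MemLp (g : Lp ℝ 2 μ) ∞ μ) :
    |∫ x, Γ.gamma f f2 x * (g : Lp ℝ 2 μ) x ∂μ|
      ≤ 2 * M * ∫ x, Γ.gamma f f x * |(g : Lp ℝ 2 μ) x| ∂μ := by
  -- the estimate against `ψ ≥ 0` for both `f` and `-f`
  have hpos : ∀ ψ : E.domain, MemLp (ψ : Lp ℝ 2 μ) ∞ μ → (∀ᵐ x ∂μ, 0 ≤ (ψ : Lp ℝ 2 μ) x) →
      |∫ x, Γ.gamma f f2 x * (ψ : Lp ℝ 2 μ) x ∂μ|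
        ≤ 2 * M * ∫ x, Γ.gamma f f x * (ψ : Lp ℝ 2 μ) x ∂μ := by
    intro ψ hψ hψ0
    rw [abs_le']
    refine ⟨Γ.integral_gamma_sq_le hM hf2 hψ hψ0, ?_⟩
    have hneg := Lp.coeFn_neg (f : Lp ℝ 2 μ)
    have h1 := Γ.integral_gamma_sq_le (f := -f) (f2 := f2) (M := M) (by
      filter_upwards [hneg, hM] with x h1 h2
      rw [Submodule.coe_neg, h1, Pi.neg_apply, abs_neg]
      exact h2) (by
      filter_upwards [hneg, hf2] with x h1 h2
      rw [Submodule.coe_neg, h1, Pi.neg_apply, h2]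
      ring) hψ hψ0
    have e1 : Γ.gamma (-f) f2 = -Γ.gamma f f2 := by rw [map_neg]; rfl
    have e2 : Γ.gamma (-f) (-f) = Γ.gamma f f := by
      simp only [map_neg, LinearMap.neg_apply, neg_neg]
    rw [e1, e2] at h1
    refine le_trans (le_of_eq ?_) h1
    rw [← integral_neg]
    refine integral_congr_ae ?_
    filter_upwards [Lp.coeFn_neg (Γ.gamma f f2)] with x hx
    rw [hx, Pi.neg_apply]
    ring
  obtain ⟨p, hp⟩ := E.exists_posPart_mem g
  obtain ⟨m, hm⟩ := E.exists_posPart_mem (-g)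
  obtain ⟨N, hN, hgN⟩ := exists_abs_le hg
  have hm' : ∀ᵐ x ∂μ, (m : Lp ℝ 2 μ) x = max (-(g : Lp ℝ 2 μ) x) 0 := by
    filter_upwards [hm, Lp.coeFn_neg (g : Lp ℝ 2 μ)] with x h1 h2
    rw [h1, Submodule.coe_neg, h2, Pi.neg_apply]
  have hpb : MemLp (p : Lp ℝ 2 μ) ∞ μ := memLp_top_of_abs_le (M := N) (by
    filter_upwards [hp, hgN] with x h1 h2
    rw [h1, abs_of_nonneg (le_max_right _ _)]
    exact max_le (abs_le.1 h2).2 hN.le)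
  have hmb : MemLp (m : Lp ℝ 2 μ) ∞ μ := memLp_top_of_abs_le (M := N) (by
    filter_upwards [hm', hgN] with x h1 h2
    rw [h1, abs_of_nonneg (le_max_right _ _)]
    exact max_le (by linarith [(abs_le.1 h2).1]) hN.le)
  have h1 := hpos p hpb (hp.mono fun x hx => by rw [hx]; exact le_max_right _ _)
  have h2 := hpos m hmb (hm.mono fun x hx => by rw [hx]; exact le_max_right _ _)
  have e1 : ∫ x, Γ.gamma f f2 x * (g : Lp ℝ 2 μ) x ∂μ =
      ∫ x, Γ.gamma f f2 x * (p : Lp ℝ 2 μ) x ∂μ - ∫ x, Γ.gamma f f2 x * (m : Lp ℝ 2 μ) x ∂μ := by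
    rw [← integral_sub (Γ.integrable_gamma_mul _ _ hpb) (Γ.integrable_gamma_mul _ _ hmb)]
    refine integral_congr_ae ?_
    filter_upwards [hp, hm'] with x h3 h4
    rw [h3, h4, ← mul_sub]
    congr 1
    rcases le_total ((g : Lp ℝ 2 μ) x) 0 with h | h
    · rw [max_eq_right h, max_eq_left (by linarith)]; ring
    · rw [max_eq_left h, max_eq_right (by linarith)]; ring
  have e2 : ∫ x, Γ.gamma f f x * |(g : Lp ℝ 2 μ) x| ∂μ =
      ∫ x, Γ.gamma f f x * (p : Lp ℝ 2 μ) x ∂μ + ∫ x, Γ.gamma f f x * (m : Lp ℝ 2 μ) x ∂μ := by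
    rw [← integral_add (Γ.integrable_gamma_mul _ _ hpb) (Γ.integrable_gamma_mul _ _ hmb)]
    refine integral_congr_ae ?_
    filter_upwards [hp, hm'] with x h3 h4
    rw [h3, h4, ← mul_add]
    congr 1
    rcases le_total ((g : Lp ℝ 2 μ) x) 0 with h | h
    · rw [max_eq_right h, max_eq_left (by linarith), abs_of_nonpos h]; ring
    · rw [max_eq_left h, max_eq_right (by linarith), abs_of_nonneg h]; ring
  rw [e1, e2, mul_add]
  exact (abs_sub _ _).trans (add_le_add h1 h2)

end CarreDuChamp

end DirichletForm

namespace DirichletForm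

variable {X : Type*} [MeasurableSpace X] {μ : Measure X}

/-! ### Convergence in `L²` -/

theorem lp_norm_sq_eq (f : Lp ℝ 2 μ) : ‖f‖ ^ 2 = ∫ x, f x ^ 2 ∂μ := by
  rw [← real_inner_self_eq_norm_sq, lp_inner_eq]
  exact integral_congr_ae (ae_of_all _ fun x => (sq _).symm)

theorem exists_subseq_tendsto_ae {p : ℝ≥0∞} [Fact (1 ≤ p)] {u : ℕ → Lp ℝ p μ} {v : Lp ℝ p μ}
    (h : Tendsto u atTop (𝓝 v)) :
    ∃ ns : ℕ → ℕ, StrictMono ns ∧ ∀ᵐ x ∂μ, Tendsto (fun i => u (ns i) x) atTop (𝓝 (v x)) :=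
  (tendstoInMeasure_of_tendsto_Lp h).exists_seq_tendsto_ae

theorem tendsto_lp_mul_of_bounded {h p : Lp ℝ 2 μ} {q : ℕ → Lp ℝ 2 μ} {a : ℕ → X → ℝ} {b : X → ℝ}
    (ha : ∀ n, AEStronglyMeasurable (a n) μ) (hb : AEStronglyMeasurable b μ) {c : ℝ}
    (hac : ∀ n, ∀ᵐ x ∂μ, |a n x| ≤ c) (hbc : ∀ᵐ x ∂μ, |b x| ≤ c)
    (hlim : ∀ᵐ x ∂μ, Tendsto (fun n => a n x) atTop (𝓝 (b x)))
    (hq : ∀ n, ∀ᵐ x ∂μ, q n x = h x * a n x) (hp : ∀ᵐ x ∂μ, p x = h x * b x) :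
    Tendsto q atTop (𝓝 p) := by
  have key : ∀ n, ‖q n - p‖ ^ 2 = ∫ x, (h x * h x) * (a n x - b x) ^ 2 ∂μ := by
    intro n
    rw [lp_norm_sq_eq]
    refine integral_congr_ae ?_
    filter_upwards [Lp.coeFn_sub (q n) p, hq n, hp] with x h1 h2 h3
    rw [h1, Pi.sub_apply, h2, h3]
    ring
  have h0 : Tendsto (fun n => ‖q n - p‖ ^ 2) atTop (𝓝 0) := by
    simp only [key]
    have := tendsto_integral_mul_of_bounded (lp_integrable_mul h h)
      (a := fun n x => (a n x - b x) ^ 2) (b := fun _ => 0) (c := (2 * c) ^ 2)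
      (fun n => ((ha n).sub hb).pow 2) (fun n => by
        filter_upwards [hac n, hbc] with x h1 h2
        rw [abs_of_nonneg (sq_nonneg _), sq_le_sq]
        have : |a n x - b x| ≤ 2 * c := (abs_sub _ _).trans (by linarith)
        exact this.trans (le_abs_self _)) (by
        filter_upwards [hlim] with x hx
        have h1 : Tendsto (fun n => a n x - b x) atTop (𝓝 0) := by
          simpa using hx.sub_const (b x)
        simpa using h1.pow 2)
    simpa using this
  rw [tendsto_iff_norm_sub_tendsto_zero]
  have h1 := h0.sqrt
  simpa [Real.sqrt_sq (norm_nonneg _)] using h1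

/-- Fatou's lemma in `L²`. -/
theorem exists_memLp_of_tendsto_ae {h : ℕ → Lp ℝ 2 μ} {F : X → ℝ} {C : ℝ}
    (hC : ∀ n, ‖h n‖ ^ 2 ≤ C) (hlim : ∀ᵐ x ∂μ, Tendsto (fun n => h n x) atTop (𝓝 (F x))) :
    ∃ hF : MemLp F 2 μ, ‖hF.toLp F‖ ^ 2 ≤ C := by
  have hm : AEStronglyMeasurable F μ :=
    aestronglyMeasurable_of_tendsto_ae atTop (fun n => Lp.aestronglyMeasurable (h n)) hlim
  have hC0 : 0 ≤ C := (sq_nonneg _).trans (hC 0)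
  have hle : eLpNorm F 2 μ ≤ ENNReal.ofReal (√C) := by
    refine (Lp.eLpNorm_lim_le_liminf_eLpNorm
      (fun n => Lp.aestronglyMeasurable (h n)) F hlim).trans ?_
    refine liminf_le_of_le (by isBoundedDefault) fun b hb => ?_
    obtain ⟨n, hn⟩ := hb.exists
    refine hn.trans ?_
    rw [← ENNReal.ofReal_toReal (Lp.eLpNorm_ne_top (h n)), ← Lp.norm_def]
    exact ENNReal.ofReal_le_ofReal (Real.le_sqrt_of_sq_le (hC n))
  have hF : MemLp F 2 μ := ⟨hm, hle.trans_lt ENNReal.ofReal_lt_top⟩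
  refine ⟨hF, ?_⟩
  rw [Lp.norm_toLp]
  have h1 : (eLpNorm F 2 μ).toReal ≤ √C := by
    refine ENNReal.toReal_le_of_le_ofReal (Real.sqrt_nonneg _) hle
  calc _ ≤ (√C) ^ 2 := pow_le_pow_left₀ ENNReal.toReal_nonneg h1 2
    _ = C := Real.sq_sqrt hC0

/-! ### The Bakry–Émery condition tested against resolvents -/

namespace CarreDuChamp

variable {E : DirichletForm μ} {Γ : E.CarreDuChamp} {K : ℝ}

/-- The Bakry–Émery inequality for the test function `φ = J_δ h`, whose Laplacian is
`δ⁻¹ (J_δ h - h)`. -/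
theorem BE.apply_resolvent {N : ℝ≥0∞} (hBE : Γ.BE K N) {f g : E.domain} (hfg : E.HasLaplacian f g)
    {δ : ℝ} (hδ : 0 < δ) {h : Lp ℝ 2 μ} (hb : MemLp h ∞ μ) (h0 : ∀ᵐ x ∂μ, 0 ≤ h x) :
    K * ∫ x, Γ.gamma f f x * (E.resolvent hδ h : Lp ℝ 2 μ) x ∂μ
      + N⁻¹.toReal * ∫ x, (g : Lp ℝ 2 μ) x ^ 2 * (E.resolvent hδ h : Lp ℝ 2 μ) x ∂μ
      ≤ 1 / 2 * ∫ x, Γ.gamma f f x * (δ⁻¹ * ((E.resolvent hδ h : Lp ℝ 2 μ) x - h x)) ∂μ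
        - ∫ x, Γ.gamma f g x * (E.resolvent hδ h : Lp ℝ 2 μ) x ∂μ := by
  set φ := E.resolvent hδ h with hφ
  have hφb : MemLp (φ : Lp ℝ 2 μ) ∞ μ := E.memLp_top_resolvent hδ hb
  have hlap : E.laplacian φ = δ⁻¹ • ((φ : Lp ℝ 2 μ) - h) := E.laplacian_resolvent hδ h
  have hlapae : ∀ᵐ x ∂μ, E.laplacian φ x = δ⁻¹ * ((φ : Lp ℝ 2 μ) x - h x) := by
    rw [hlap]
    filter_upwards [Lp.coeFn_smul δ⁻¹ ((φ : Lp ℝ 2 μ) - h), Lp.coeFn_sub (φ : Lp ℝ 2 μ) h]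
      with x h1 h2
    rw [h1, Pi.smul_apply, h2]
    rfl
  have hlapb' : MemLp (fun x => δ⁻¹ * ((φ : Lp ℝ 2 μ) x - h x)) ∞ μ := (hφb.sub hb).const_mul δ⁻¹
  have hlapb : MemLp (E.laplacian φ) ∞ μ := (memLp_congr_ae hlapae).2 hlapb'
  have hΔf : E.laplacian f = g := hfg.laplacian_eq
  have hfV : f ∈ E.domV := ⟨⟨g, hfg⟩, by rw [hΔf]; exact g.2⟩
  have hgV : E.laplacianV ⟨f, hfV⟩ = g := Subtype.ext hΔf
  have key := hBE ⟨f, hfV⟩ ⟨φ, ⟨E.resolvent_mem hδ h, hφb, hlapb⟩⟩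
    (E.le_resolvent_of_le hδ le_rfl h0)
  rw [gamma2, hgV] at key
  simp only at key
  rw [hΔf] at key
  refine key.trans (le_of_eq ?_)
  have i1 := Γ.integrable_gamma_mul f f hlapb'
  have i2 := Γ.integrable_gamma_mul f g hφb
  have e : ∫ x, (Γ.gamma f f x * E.laplacian φ x
      - (Γ.gamma f g x + Γ.gamma f g x) * (φ : Lp ℝ 2 μ) x) ∂μ
      = ∫ x, Γ.gamma f f x * (δ⁻¹ * ((φ : Lp ℝ 2 μ) x - h x)) ∂μ
        - 2 * ∫ x, Γ.gamma f g x * (φ : Lp ℝ 2 μ) x ∂μ := by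
    rw [← integral_const_mul, ← integral_sub i1 (i2.const_mul 2)]
    refine integral_congr_ae ?_
    filter_upwards [hlapae] with x hx
    rw [hx]
    ring
  rw [e]
  ring

variable [SigmaFinite μ]

/-- The Bakry–Émery inequality for the test function `J_δ (M² - f²) = M² - J_δ f²`, where
`|f| ≤ M`. This function is not in `L²`; it is the limit of `J_δ (1_A (M² - f²))` as `A` exhausts
the space, by conservativeness. -/
theorem BE.apply_sq (hBE : Γ.BE K ∞) (hmass : E.MassPreserving) {f g f2 : E.domain}
    (hfg : E.HasLaplacian f g) {M : ℝ} (hM : ∀ᵐ x ∂μ, |(f : Lp ℝ 2 μ) x| ≤ M)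
    (hf2 : ∀ᵐ x ∂μ, (f2 : Lp ℝ 2 μ) x = (f : Lp ℝ 2 μ) x * (f : Lp ℝ 2 μ) x)
    {δ : ℝ} (hδ : 0 < δ) :
    K * ∫ x, Γ.gamma f f x * (M ^ 2 - (E.resolvent hδ f2 : Lp ℝ 2 μ) x) ∂μ
      ≤ 1 / 2 * ∫ x, Γ.gamma f f x *
          (δ⁻¹ * ((f2 : Lp ℝ 2 μ) x - (E.resolvent hδ f2 : Lp ℝ 2 μ) x)) ∂μ
        - ∫ x, Γ.gamma f g x * (M ^ 2 - (E.resolvent hδ f2 : Lp ℝ 2 μ) x) ∂μ := by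
  set e : ℕ → Lp ℝ 2 μ := exhaustion μ with he
  have he01 := exhaustion_mem_Icc μ
  have hsq : ∀ᵐ x ∂μ, 0 ≤ (f2 : Lp ℝ 2 μ) x ∧ (f2 : Lp ℝ 2 μ) x ≤ M ^ 2 := by
    filter_upwards [hM, hf2] with x h1 h2
    rw [h2, ← sq]
    exact ⟨sq_nonneg _, sq_le_sq.2 (h1.trans (le_abs_self M))⟩
  -- the truncation `1_A f²`
  have hpmem : ∀ n, MemLp (fun x => (f2 : Lp ℝ 2 μ) x * e n x) 2 μ := by
    intro n
    refine (Lp.memLp (f2 : Lp ℝ 2 μ)).mono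
      ((Lp.aestronglyMeasurable _).mul (Lp.aestronglyMeasurable _)) ?_
    filter_upwards [he01 n] with x hx
    rw [norm_mul, Real.norm_of_nonneg hx.1]
    exact mul_le_of_le_one_right (norm_nonneg _) hx.2
  set p : ℕ → Lp ℝ 2 μ := fun n => (hpmem n).toLp _ with hpdef
  have hpae : ∀ n, ∀ᵐ x ∂μ, p n x = (f2 : Lp ℝ 2 μ) x * e n x := fun n => (hpmem n).coeFn_toLp
  have hplim : Tendsto p atTop (𝓝 (f2 : Lp ℝ 2 μ)) := by
    refine tendsto_lp_mul_of_bounded (h := (f2 : Lp ℝ 2 μ)) (a := fun n => e n) (b := fun _ => 1)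
      (c := 1) (fun n => Lp.aestronglyMeasurable _) aestronglyMeasurable_const (fun n => ?_) ?_
      (ae_tendsto_exhaustion μ) hpae (ae_of_all _ fun x => (mul_one _).symm)
    · filter_upwards [he01 n] with x hx
      exact abs_le.2 ⟨by linarith [hx.1], hx.2⟩
    · exact ae_of_all _ fun x => by simp
  have hJp : Tendsto (fun n => (E.resolvent hδ (p n) : Lp ℝ 2 μ)) atTop
      (𝓝 (E.resolvent hδ f2 : Lp ℝ 2 μ)) := ((E.resolventL hδ).continuous.tendsto _).comp hplim
  obtain ⟨ns, hns, hJpae⟩ := exists_subseq_tendsto_ae hJp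
  -- the test functions `h = 1_A (M² - f²)`
  set h : ℕ → Lp ℝ 2 μ := fun n => M ^ 2 • e n - p n with hh
  have hcoe : ∀ a b : Lp ℝ 2 μ, ∀ᵐ x ∂μ, (M ^ 2 • a - b : Lp ℝ 2 μ) x = M ^ 2 * a x - b x := by
    intro a b
    filter_upwards [Lp.coeFn_sub (M ^ 2 • a) b, Lp.coeFn_smul (M ^ 2) a] with x h1 h2
    rw [h1, Pi.sub_apply, h2]
    rfl
  have hh01 : ∀ n, ∀ᵐ x ∂μ, 0 ≤ h n x ∧ h n x ≤ M ^ 2 := by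
    intro n
    filter_upwards [hcoe (e n) (p n), hpae n, he01 n, hsq] with x h1 h2 h3 h4
    rw [hh, h1, h2]
    have h5 : M ^ 2 * e n x - (f2 : Lp ℝ 2 μ) x * e n x = (M ^ 2 - (f2 : Lp ℝ 2 μ) x) * e n x := by
      ring
    rw [h5]
    refine ⟨mul_nonneg (by linarith [h4.2]) h3.1, ?_⟩
    nlinarith [h4.1, h4.2, h3.1, h3.2]
  have hhlim : ∀ᵐ x ∂μ, Tendsto (fun i => h (ns i) x) atTop (𝓝 (M ^ 2 - (f2 : Lp ℝ 2 μ) x)) := by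
    filter_upwards [ae_all_iff.2 fun n => hcoe (e n) (p n), ae_all_iff.2 hpae,
      ae_tendsto_exhaustion μ] with x h1 h2 h3
    have h4 := (h3.comp hns.tendsto_atTop).const_mul (M ^ 2 - (f2 : Lp ℝ 2 μ) x)
    rw [mul_one] at h4
    refine h4.congr fun i => ?_
    simp only [hh, h1, h2, Function.comp_apply]
    ring
  have hJh : ∀ n, ∀ᵐ x ∂μ, (E.resolvent hδ (h n) : Lp ℝ 2 μ) x
      = M ^ 2 * (E.resolvent hδ (e n) : Lp ℝ 2 μ) x - (E.resolvent hδ (p n) : Lp ℝ 2 μ) x := by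
    intro n
    have h1 : (E.resolvent hδ (h n) : Lp ℝ 2 μ)
        = M ^ 2 • (E.resolvent hδ (e n) : Lp ℝ 2 μ) - (E.resolvent hδ (p n) : Lp ℝ 2 μ) := by
      simp only [hh, map_sub, map_smul]
      rfl
    rw [h1]
    exact hcoe _ _
  have hJhlim : ∀ᵐ x ∂μ, Tendsto (fun i => (E.resolvent hδ (h (ns i)) : Lp ℝ 2 μ) x) atTop
      (𝓝 (M ^ 2 - (E.resolvent hδ f2 : Lp ℝ 2 μ) x)) := by
    filter_upwards [ae_all_iff.2 hJh, hmass.ae_tendsto_resolvent_exhaustion hδ, hJpae]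
      with x h1 h2 h3
    have h4 := ((h2.comp hns.tendsto_atTop).const_mul (M ^ 2)).sub h3
    rw [mul_one] at h4
    refine h4.congr fun i => ?_
    rw [h1]
    rfl
  have hJh01 : ∀ n, ∀ᵐ x ∂μ, |(E.resolvent hδ (h n) : Lp ℝ 2 μ) x| ≤ M ^ 2 := fun n =>
    E.abs_resolvent_le hδ (sq_nonneg M) ((hh01 n).mono fun x hx =>
      abs_le.2 ⟨by linarith [hx.1, sq_nonneg M], hx.2⟩)
  have hBEn := fun i => hBE.apply_resolvent hfg hδ (h := h (ns i))
    (memLp_top_of_abs_le (M := M ^ 2) ((hh01 (ns i)).mono fun x hx =>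
      abs_le.2 ⟨by linarith [hx.1, sq_nonneg M], hx.2⟩))
    ((hh01 (ns i)).mono fun _ => And.left)
  have l1 := tendsto_integral_mul_of_bounded (Γ.integrable_gamma f f)
    (fun i => Lp.aestronglyMeasurable _) (fun i => hJh01 (ns i)) hJhlim
  have l2 := tendsto_integral_mul_of_bounded (Γ.integrable_gamma f g)
    (fun i => Lp.aestronglyMeasurable _) (fun i => hJh01 (ns i)) hJhlim
  have l3 := tendsto_integral_mul_of_bounded (Γ.integrable_gamma f f)
    (a := fun i x => δ⁻¹ * ((E.resolvent hδ (h (ns i)) : Lp ℝ 2 μ) x - h (ns i) x))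
    (b := fun x => δ⁻¹ * ((f2 : Lp ℝ 2 μ) x - (E.resolvent hδ f2 : Lp ℝ 2 μ) x))
    (c := δ⁻¹ * (2 * M ^ 2))
    (fun i => ((Lp.aestronglyMeasurable _).sub (Lp.aestronglyMeasurable _)).const_mul _)
    (fun i => by
      filter_upwards [hJh01 (ns i), hh01 (ns i)] with x h1 h2
      rw [abs_mul, abs_of_pos (inv_pos.2 hδ)]
      refine mul_le_mul_of_nonneg_left ?_ (inv_pos.2 hδ).le
      rw [abs_le] at h1 ⊢
      constructor <;> linarith [h1.1, h1.2, h2.1, h2.2])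
    (by
      filter_upwards [hJhlim, hhlim] with x h1 h2
      have h3 := (h1.sub h2).const_mul δ⁻¹
      rwa [sub_sub_sub_cancel_left] at h3)
  refine le_of_tendsto_of_tendsto' (l1.const_mul K) ((l3.const_mul (1 / 2)).sub l2) fun i => ?_
  have := hBEn i
  simpa using this

/-- `δ⁻¹ (f² - J_δ f²) = - J_δ Δ f²`, with `Δ f² = 2 f Δf + 2 Γ(f)`, as an upper bound in terms of
a function `G ≤ Γ(f)` of `L²`. -/
theorem resolvent_sq_le {f g f2 fg : E.domain} {G : Lp ℝ 2 μ}
    (hf : MemLp (f : Lp ℝ 2 μ) ∞ μ) (hfg : E.HasLaplacian f g)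
    (hf2 : ∀ᵐ x ∂μ, (f2 : Lp ℝ 2 μ) x = (f : Lp ℝ 2 μ) x * (f : Lp ℝ 2 μ) x)
    (hmul : ∀ᵐ x ∂μ, (fg : Lp ℝ 2 μ) x = (f : Lp ℝ 2 μ) x * (g : Lp ℝ 2 μ) x)
    (hG : ∀ᵐ x ∂μ, G x ≤ Γ.gamma f f x) {δ : ℝ} (hδ : 0 < δ) :
    ∀ᵐ x ∂μ, δ⁻¹ * ((f2 : Lp ℝ 2 μ) x - (E.resolvent hδ f2 : Lp ℝ 2 μ) x) ≤
      -2 * (E.resolvent hδ fg : Lp ℝ 2 μ) x - 2 * (E.resolvent hδ G : Lp ℝ 2 μ) x := by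
  set d : Lp ℝ 2 μ := -(2 : ℝ) • (E.resolvent hδ fg : Lp ℝ 2 μ)
    - (2 : ℝ) • (E.resolvent hδ G : Lp ℝ 2 μ)
    - δ⁻¹ • ((f2 : Lp ℝ 2 μ) - (E.resolvent hδ f2 : Lp ℝ 2 μ)) with hd
  have hdnn : ∀ᵐ x ∂μ, 0 ≤ d x := by
    refine ae_nonneg_of_forall_setIntegral_nonneg_of_sigmaFinite
      (fun s _ hμs => integrableOn_Lp_of_measure_ne_top _ Fact.out hμs.ne) fun s hs hμs => ?_
    set ψ : Lp ℝ 2 μ := indicatorConstLp 2 hs hμs.ne 1 with hψ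
    have hψ01 : ∀ᵐ x ∂μ, 0 ≤ ψ x ∧ ψ x ≤ 1 := by
      filter_upwards [indicatorConstLp_coeFn (hs := hs) (hμs := hμs.ne) (p := 2) (c := (1 : ℝ))]
        with x hx
      rw [hψ, hx]
      by_cases h : x ∈ s <;> simp [h]
    have hψb : MemLp ψ ∞ μ := memLp_top_of_abs_le (M := 1) (hψ01.mono fun x hx =>
      abs_le.2 ⟨by linarith [hx.1], hx.2⟩)
    have e0 : ∫ x in s, d x ∂μ = inner ℝ d ψ := by
      rw [real_inner_comm]
      exact (L2.inner_indicatorConstLp_one hs hμs.ne d).symm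
    set φ := E.resolvent hδ ψ with hφ
    have hφ0 : ∀ᵐ x ∂μ, 0 ≤ (φ : Lp ℝ 2 μ) x :=
      E.le_resolvent_of_le hδ le_rfl (hψ01.mono fun _ => And.left)
    have hφb : MemLp (φ : Lp ℝ 2 μ) ∞ μ := E.memLp_top_resolvent hδ hψb
    have h1 := Γ.form_sq_eq hf hfg hφb hf2
    have h2 := E.hasLaplacian_resolvent hδ ψ f2
    rw [← hφ, E.symm, h1, real_inner_smul_left, inner_sub_left] at h2
    have h3 : inner ℝ (fg : Lp ℝ 2 μ) (φ : Lp ℝ 2 μ)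
        = ∫ x, (g : Lp ℝ 2 μ) x * ((f : Lp ℝ 2 μ) x * (φ : Lp ℝ 2 μ) x) ∂μ := by
      rw [lp_inner_eq]
      exact integral_congr_ae (hmul.mono fun x hx => by simp only [hx]; ring)
    have h4 : inner ℝ G (φ : Lp ℝ 2 μ) ≤ ∫ x, Γ.gamma f f x * (φ : Lp ℝ 2 μ) x ∂μ := by
      rw [lp_inner_eq]
      refine integral_mono_ae (lp_integrable_mul _ _) (Γ.integrable_gamma_mul f f hφb) ?_
      filter_upwards [hG, hφ0] with x h5 h6 using mul_le_mul_of_nonneg_right h5 h6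
    have c1 : inner ℝ (φ : Lp ℝ 2 μ) (f2 : Lp ℝ 2 μ)
        = inner ℝ (E.resolvent hδ f2 : Lp ℝ 2 μ) ψ := by
      rw [hφ, E.inner_resolvent_left, real_inner_comm]
    have c2 : inner ℝ ψ (f2 : Lp ℝ 2 μ) = inner ℝ (f2 : Lp ℝ 2 μ) ψ := real_inner_comm _ _
    rw [c1, c2] at h2
    rw [e0, hd, inner_sub_left, inner_sub_left, real_inner_smul_left, real_inner_smul_left,
      real_inner_smul_left, inner_sub_left, E.inner_resolvent_left, E.inner_resolvent_left,
      ← hφ, h3]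
    linarith
  filter_upwards [hdnn, Lp.coeFn_sub (-(2 : ℝ) • (E.resolvent hδ fg : Lp ℝ 2 μ)
      - (2 : ℝ) • (E.resolvent hδ G : Lp ℝ 2 μ))
      (δ⁻¹ • ((f2 : Lp ℝ 2 μ) - (E.resolvent hδ f2 : Lp ℝ 2 μ))),
    Lp.coeFn_sub (-(2 : ℝ) • (E.resolvent hδ fg : Lp ℝ 2 μ))
      ((2 : ℝ) • (E.resolvent hδ G : Lp ℝ 2 μ)),
    Lp.coeFn_smul (-(2 : ℝ)) (E.resolvent hδ fg : Lp ℝ 2 μ),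
    Lp.coeFn_smul (2 : ℝ) (E.resolvent hδ G : Lp ℝ 2 μ),
    Lp.coeFn_smul δ⁻¹ ((f2 : Lp ℝ 2 μ) - (E.resolvent hδ f2 : Lp ℝ 2 μ)),
    Lp.coeFn_sub (f2 : Lp ℝ 2 μ) (E.resolvent hδ f2 : Lp ℝ 2 μ)] with x h1 h2 h3 h4 h5 h6 h7
  rw [hd, h2, Pi.sub_apply, h3, Pi.sub_apply, h4, h5, h6, Pi.smul_apply, Pi.smul_apply,
    Pi.smul_apply, h7, Pi.sub_apply, smul_eq_mul, smul_eq_mul, smul_eq_mul] at h1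
  linarith

end CarreDuChamp

end DirichletForm

namespace DirichletForm

variable {X : Type*} [MeasurableSpace X] {μ : Measure X}

/-! ### Interpolation: square integrability of the Carré du Champ -/

namespace CarreDuChamp

variable {E : DirichletForm μ} {Γ : E.CarreDuChamp} {K : ℝ}

theorem gamma_sub_eq (Γ : E.CarreDuChamp) (f f' φ φ' : E.domain) :
    Γ.gamma f φ - Γ.gamma f' φ' = Γ.gamma (f - f') φ + Γ.gamma f' (φ - φ') := by
  simp only [map_sub, LinearMap.sub_apply]
  abel

/-- Continuity of the Carré du Champ along the resolvents of a function of `𝔻`. -/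
theorem tendsto_gamma_resolvent (Γ : E.CarreDuChamp) {f : E.domain} {k : Lp ℝ 2 μ}
    (hf : E.HasLaplacian f k) {ε : ℕ → ℝ} (hε : ∀ n, 0 < ε n) (hlim : Tendsto ε atTop (𝓝 0)) :
    Tendsto (fun n => Γ.gamma (E.resolvent (hε n) f) (E.resolvent (hε n) f)) atTop
      (𝓝 (Γ.gamma f f)) := by
  obtain ⟨C, hC⟩ := Γ.continuous
  have hC' : ∀ a b, ‖Γ.gamma a b‖ ≤ |C| * E.normV a * E.normV b := fun a b => by
    refine (hC a b).trans ?_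
    refine mul_le_mul_of_nonneg_right ?_ (Real.sqrt_nonneg _)
    exact mul_le_mul_of_nonneg_right (le_abs_self C) (Real.sqrt_nonneg _)
  have hb : ∀ n, E.normV (E.resolvent (hε n) f) ≤ E.normV f := fun n => by
    refine Real.sqrt_le_sqrt (add_le_add ?_ (E.form_resolvent_le (hε n) f))
    exact pow_le_pow_left₀ (norm_nonneg _) (E.norm_resolvent_le (hε n) _) 2
  have hd : Tendsto (fun n => E.normV (E.resolvent (hε n) f - f)) atTop (𝓝 0) := by
    have h1 : Tendsto (fun n => √(ε n * E.form f f + ε n * ‖k‖ ^ 2)) atTop (𝓝 0) := by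
      simpa using ((hlim.mul_const (E.form f f)).add (hlim.mul_const (‖k‖ ^ 2))).sqrt
    refine squeeze_zero (fun _ => Real.sqrt_nonneg _) (fun n => Real.sqrt_le_sqrt ?_) h1
    exact add_le_add (E.norm_resolvent_sub_self_sq_le (hε n) f)
      (E.form_resolvent_sub_self_le (hε n) hf)
  rw [tendsto_iff_norm_sub_tendsto_zero]
  have h2 : Tendsto (fun n => |C| * E.normV (E.resolvent (hε n) f - f) * E.normV f
      + |C| * E.normV f * E.normV (E.resolvent (hε n) f - f)) atTop (𝓝 0) := by
    simpa using ((hd.const_mul |C|).mul_const (E.normV f)).add (hd.const_mul (|C| * E.normV f))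
  refine squeeze_zero (fun _ => norm_nonneg _) (fun n => ?_) h2
  rw [gamma_sub_eq]
  refine (norm_add_le _ _).trans (add_le_add ((hC' _ _).trans ?_) (hC' _ _))
  exact mul_le_mul_of_nonneg_left (hb n) (mul_nonneg (abs_nonneg _) (Real.sqrt_nonneg _))

variable [SigmaFinite μ]

/-- Bound of a truncation `G ≤ Γ(f)` of the Carré du Champ, obtained from the test function
`J_δ (M² - f²)` in the limit `δ → 0`. -/
theorem BE.norm_sq_truncation_le (hBE : Γ.BE K ∞) (hmass : E.MassPreserving) {f g f2 : E.domain}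
    (hfg : E.HasLaplacian f g) (hg : MemLp (g : Lp ℝ 2 μ) ∞ μ) {M : ℝ}
    (hM : ∀ᵐ x ∂μ, |(f : Lp ℝ 2 μ) x| ≤ M)
    (hf2 : ∀ᵐ x ∂μ, (f2 : Lp ℝ 2 μ) x = (f : Lp ℝ 2 μ) x * (f : Lp ℝ 2 μ) x)
    {G : Lp ℝ 2 μ} (hGb : MemLp G ∞ μ) (hG : ∀ᵐ x ∂μ, 0 ≤ G x ∧ G x ≤ Γ.gamma f f x) :
    ‖G‖ ^ 2 ≤ -(∫ x, Γ.gamma f f x * ((f : Lp ℝ 2 μ) x * (g : Lp ℝ 2 μ) x) ∂μ)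
      - ∫ x, Γ.gamma f g x * (M ^ 2 - (f2 : Lp ℝ 2 μ) x) ∂μ
      - K * ∫ x, Γ.gamma f f x * (M ^ 2 - (f2 : Lp ℝ 2 μ) x) ∂μ := by
  have hf : MemLp (f : Lp ℝ 2 μ) ∞ μ := memLp_top_of_abs_le hM
  obtain ⟨fg, hmul⟩ := E.exists_mul_mem hf hg
  have hfgb : MemLp (fg : Lp ℝ 2 μ) ∞ μ := memLp_top_mul hf hg hmul
  have hf2b : MemLp (f2 : Lp ℝ 2 μ) ∞ μ := memLp_top_mul hf hf hf2
  have hf2M : ∀ᵐ x ∂μ, |(f2 : Lp ℝ 2 μ) x| ≤ M ^ 2 := by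
    filter_upwards [hM, hf2] with x h1 h2
    rw [h2, abs_mul, ← sq]
    exact pow_le_pow_left₀ (abs_nonneg _) h1 2
  obtain ⟨B, hB, hfgB⟩ := exists_abs_le hfgb
  have hδ0 : ∀ n : ℕ, 0 < 1 / ((n : ℝ) + 1) := one_div_add_one_pos
  have hlim0 : Tendsto (fun n : ℕ => 1 / ((n : ℝ) + 1)) atTop (𝓝 0) :=
    tendsto_one_div_add_atTop_nhds_zero_nat
  -- a sequence `δ → 0` along which the resolvents of `f Δf` and of `f²` converge a.e.
  obtain ⟨ns, hns, hae1⟩ := exists_subseq_tendsto_ae (E.tendsto_resolvent hδ0 hlim0 (fg : Lp ℝ 2 μ))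
  obtain ⟨ms, hms, hae2⟩ := exists_subseq_tendsto_ae
    ((E.tendsto_resolvent hδ0 hlim0 (f2 : Lp ℝ 2 μ)).comp hns.tendsto_atTop)
  set δ : ℕ → ℝ := fun i => 1 / ((ns (ms i) : ℝ) + 1) with hδdef
  have hδ : ∀ i, 0 < δ i := fun i => hδ0 _
  have hδlim : Tendsto δ atTop (𝓝 0) := hlim0.comp (hns.tendsto_atTop.comp hms.tendsto_atTop)
  have hae1' : ∀ᵐ x ∂μ, Tendsto (fun i => (E.resolvent (hδ i) fg : Lp ℝ 2 μ) x) atTop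
      (𝓝 ((fg : Lp ℝ 2 μ) x)) := by
    filter_upwards [hae1] with x hx using hx.comp hms.tendsto_atTop
  have hae2' : ∀ᵐ x ∂μ, Tendsto (fun i => (E.resolvent (hδ i) f2 : Lp ℝ 2 μ) x) atTop
      (𝓝 ((f2 : Lp ℝ 2 μ) x)) := hae2
  have key : ∀ i, inner ℝ G (E.resolvent (hδ i) G : Lp ℝ 2 μ) ≤
      -(∫ x, Γ.gamma f f x * (E.resolvent (hδ i) fg : Lp ℝ 2 μ) x ∂μ)
      - ∫ x, Γ.gamma f g x * (M ^ 2 - (E.resolvent (hδ i) f2 : Lp ℝ 2 μ) x) ∂μ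
      - K * ∫ x, Γ.gamma f f x * (M ^ 2 - (E.resolvent (hδ i) f2 : Lp ℝ 2 μ) x) ∂μ := by
    intro i
    have h1 := hBE.apply_sq hmass hfg hM hf2 (hδ i)
    have h2 := resolvent_sq_le (Γ := Γ) hf hfg hf2 hmul (hG.mono fun _ => And.right) (hδ i)
    have hJfg := E.memLp_top_resolvent (hδ i) hfgb
    have hJG := E.memLp_top_resolvent (hδ i) hGb
    have hJf2 := E.memLp_top_resolvent (hδ i) hf2b
    have i1 := Γ.integrable_gamma_mul f f hJfg
    have i2 := Γ.integrable_gamma_mul f f hJG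
    have h3 : ∫ x, Γ.gamma f f x *
          ((δ i)⁻¹ * ((f2 : Lp ℝ 2 μ) x - (E.resolvent (hδ i) f2 : Lp ℝ 2 μ) x)) ∂μ
        ≤ -2 * ∫ x, Γ.gamma f f x * (E.resolvent (hδ i) fg : Lp ℝ 2 μ) x ∂μ
          - 2 * ∫ x, Γ.gamma f f x * (E.resolvent (hδ i) G : Lp ℝ 2 μ) x ∂μ := by
      rw [← integral_const_mul, ← integral_const_mul,
        ← integral_sub (i1.const_mul _) (i2.const_mul _)]
      refine integral_mono_ae (Γ.integrable_gamma_mul f f ((hf2b.sub hJf2).const_mul _))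
        ((i1.const_mul _).sub (i2.const_mul _)) ?_
      filter_upwards [h2, Γ.nonneg f] with x h4 h5
      have := mul_le_mul_of_nonneg_left h4 h5
      refine this.trans (le_of_eq ?_)
      ring
    have h4 : inner ℝ G (E.resolvent (hδ i) G : Lp ℝ 2 μ)
        ≤ ∫ x, Γ.gamma f f x * (E.resolvent (hδ i) G : Lp ℝ 2 μ) x ∂μ := by
      rw [lp_inner_eq]
      refine integral_mono_ae (lp_integrable_mul _ _) i2 ?_
      filter_upwards [hG, E.le_resolvent_of_le (hδ i) le_rfl (hG.mono fun _ => And.left)]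
        with x h5 h6 using mul_le_mul_of_nonneg_right h5.2 h6
    linarith
  have l0 : Tendsto (fun i => inner ℝ G (E.resolvent (hδ i) G : Lp ℝ 2 μ)) atTop (𝓝 (‖G‖ ^ 2)) := by
    rw [← real_inner_self_eq_norm_sq]
    exact tendsto_const_nhds.inner (E.tendsto_resolvent hδ hδlim G)
  have l1 := tendsto_integral_mul_of_bounded (Γ.integrable_gamma f f)
    (fun i => Lp.aestronglyMeasurable _) (fun i => E.abs_resolvent_le (hδ i) hB.le hfgB) hae1'
  have hsub : ∀ i, ∀ᵐ x ∂μ, |M ^ 2 - (E.resolvent (hδ i) f2 : Lp ℝ 2 μ) x| ≤ 2 * M ^ 2 := by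
    intro i
    filter_upwards [E.abs_resolvent_le (hδ i) (sq_nonneg M) hf2M] with x hx
    rw [abs_le] at hx ⊢
    constructor <;> linarith [hx.1, hx.2, sq_nonneg M]
  have hsublim : ∀ᵐ x ∂μ, Tendsto (fun i => M ^ 2 - (E.resolvent (hδ i) f2 : Lp ℝ 2 μ) x) atTop
      (𝓝 (M ^ 2 - (f2 : Lp ℝ 2 μ) x)) := by
    filter_upwards [hae2'] with x hx using hx.const_sub _
  have l2 := fun a b => tendsto_integral_mul_of_bounded (Γ.integrable_gamma a b)
    (fun i => aestronglyMeasurable_const.sub (Lp.aestronglyMeasurable _)) hsub hsublim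
  have hval : ∫ x, Γ.gamma f f x * (fg : Lp ℝ 2 μ) x ∂μ
      = ∫ x, Γ.gamma f f x * ((f : Lp ℝ 2 μ) x * (g : Lp ℝ 2 μ) x) ∂μ :=
    integral_congr_ae (hmul.mono fun x hx => by simp only [hx])
  rw [hval] at l1
  exact le_of_tendsto_of_tendsto' l0 ((l1.neg.sub (l2 f g)).sub ((l2 f f).const_mul K)) key

/-- The interpolation estimate for functions with a bounded Laplacian which is itself in `𝔻`. The
constant `11 = 2 + 9` comes from absorbing `3 M ‖Γ(f)‖ ‖Δf‖` into the left-hand side. -/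
theorem BE.interpolation_of_regular (hBE : Γ.BE K ∞) (hmass : E.MassPreserving) {f g : E.domain}
    {l : Lp ℝ 2 μ} (hfg : E.HasLaplacian f g) (hgl : E.HasLaplacian g l)
    (hg : MemLp (g : Lp ℝ 2 μ) ∞ μ) {M : ℝ} (hM0 : 0 ≤ M)
    (hM : ∀ᵐ x ∂μ, |(f : Lp ℝ 2 μ) x| ≤ M) :
    ∃ h : MemLp (Γ.gamma f f) 2 μ, ‖h.toLp _‖ ^ 2
      ≤ M ^ 2 * (11 * ‖(g : Lp ℝ 2 μ)‖ ^ 2 + 2 * |K| * E.form f f) := by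
  have hf : MemLp (f : Lp ℝ 2 μ) ∞ μ := memLp_top_of_abs_le hM
  obtain ⟨f2, hf2⟩ := E.exists_mul_mem hf hf
  have hf2b : MemLp (f2 : Lp ℝ 2 μ) ∞ μ := memLp_top_mul hf hf hf2
  have hf2M : ∀ᵐ x ∂μ, 0 ≤ (f2 : Lp ℝ 2 μ) x ∧ (f2 : Lp ℝ 2 μ) x ≤ M ^ 2 := by
    filter_upwards [hM, hf2] with x h1 h2
    rw [h2, ← sq]
    exact ⟨sq_nonneg _, sq_le_sq.2 (h1.trans (le_abs_self M))⟩
  set R : ℝ := -(∫ x, Γ.gamma f f x * ((f : Lp ℝ 2 μ) x * (g : Lp ℝ 2 μ) x) ∂μ)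
      - ∫ x, Γ.gamma f g x * (M ^ 2 - (f2 : Lp ℝ 2 μ) x) ∂μ
      - K * ∫ x, Γ.gamma f f x * (M ^ 2 - (f2 : Lp ℝ 2 μ) x) ∂μ with hR
  have hΓ0 := Γ.nonneg f
  -- the truncations `min Γ(f) n` are bounded in `L²`, uniformly in `n`
  have htr : ∀ n : ℕ, MemLp (fun x => min (Γ.gamma f f x) n) 2 μ := by
    intro n
    have hm : AEStronglyMeasurable (fun x => min (Γ.gamma f f x) (n : ℝ)) μ :=
      (Lp.aestronglyMeasurable _).inf aestronglyMeasurable_const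
    rw [memLp_two_iff_integrable_sq hm]
    refine ((Γ.integrable_gamma f f).mul_const (n : ℝ)).mono' (hm.pow 2) ?_
    filter_upwards [hΓ0] with x hx
    have h0 : 0 ≤ min (Γ.gamma f f x) (n : ℝ) := le_min hx n.cast_nonneg
    rw [Real.norm_of_nonneg (sq_nonneg _), sq]
    exact mul_le_mul (min_le_left _ _) (min_le_right _ _) h0 hx
  have htrae : ∀ n, ∀ᵐ x ∂μ, (htr n).toLp _ x = min (Γ.gamma f f x) n := fun n =>
    (htr n).coeFn_toLp
  obtain ⟨hmem, hle⟩ : ∃ h : MemLp (Γ.gamma f f) 2 μ, ‖h.toLp _‖ ^ 2 ≤ R := by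
    refine exists_memLp_of_tendsto_ae (h := fun n => (htr n).toLp _) (fun n => ?_) ?_
    · have h01 : ∀ᵐ x ∂μ, 0 ≤ (htr n).toLp _ x ∧ (htr n).toLp _ x ≤ Γ.gamma f f x := by
        filter_upwards [htrae n, hΓ0] with x h1 h2
        rw [h1]
        exact ⟨le_min h2 n.cast_nonneg, min_le_left _ _⟩
      refine hBE.norm_sq_truncation_le hmass hfg hg hM hf2 (memLp_top_of_abs_le (M := n) ?_) h01
      filter_upwards [htrae n, h01] with x h1 h2
      rw [abs_of_nonneg h2.1, h1]
      exact min_le_right _ _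
    · filter_upwards [ae_all_iff.2 htrae] with x hx
      simp only [hx]
      refine tendsto_const_nhds.congr' ?_
      filter_upwards [tendsto_natCast_atTop_atTop.eventually_ge_atTop (Γ.gamma f f x)] with n hn
      exact (min_eq_left hn).symm
  refine ⟨hmem, ?_⟩
  -- now that `Γ(f) ∈ L²`, each term of `R` is bounded in terms of `A = ‖Γ(f)‖` and `D = ‖Δf‖`
  set H : Lp ℝ 2 μ := hmem.toLp _ with hH
  have hHae : ∀ᵐ x ∂μ, H x = Γ.gamma f f x := hmem.coeFn_toLp
  set A := ‖H‖
  set D := ‖(g : Lp ℝ 2 μ)‖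
  have hgabs := Lp.coeFn_abs (g : Lp ℝ 2 μ)
  have iabs : Integrable (fun x => Γ.gamma f f x * |(g : Lp ℝ 2 μ) x|) μ :=
    Γ.integrable_gamma_mul f f hg.abs
  have hAD : ∫ x, Γ.gamma f f x * |(g : Lp ℝ 2 μ) x| ∂μ ≤ A * D := by
    have h1 : ∫ x, Γ.gamma f f x * |(g : Lp ℝ 2 μ) x| ∂μ = inner ℝ H |(g : Lp ℝ 2 μ)| := by
      rw [lp_inner_eq]
      refine integral_congr_ae ?_
      filter_upwards [hHae, hgabs] with x h1 h2
      rw [h1, h2]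
    rw [h1]
    refine (real_inner_le_norm _ _).trans (le_of_eq ?_)
    rw [norm_abs_eq_norm]
  have t1 : -(∫ x, Γ.gamma f f x * ((f : Lp ℝ 2 μ) x * (g : Lp ℝ 2 μ) x) ∂μ) ≤ M * (A * D) := by
    refine le_trans ?_ (mul_le_mul_of_nonneg_left hAD hM0)
    rw [← integral_neg, ← integral_const_mul]
    refine integral_mono_ae (Γ.integrable_gamma_mul f f (hg.mul hf (r := ∞))).neg
      (iabs.const_mul M) ?_
    filter_upwards [hΓ0, hM] with x h1 h2
    have h3 : -((f : Lp ℝ 2 μ) x * (g : Lp ℝ 2 μ) x) ≤ M * |(g : Lp ℝ 2 μ) x| := by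
      refine (neg_le_abs _).trans ?_
      rw [abs_mul]
      exact mul_le_mul_of_nonneg_right h2 (abs_nonneg _)
    have := mul_le_mul_of_nonneg_left h3 h1
    linarith
  have t2 : ∫ x, Γ.gamma f g x * (f2 : Lp ℝ 2 μ) x ∂μ ≤ 2 * M * (A * D) := by
    obtain ⟨gf2, hgf2⟩ := E.exists_mul_mem hg hf2b
    have h1 := Γ.integral_gamma_leibniz hf hg hf2b hgf2
    have h2 := (abs_le.1 (Γ.abs_integral_gamma_sq_le hM hf2 hg)).1
    have h3 : 0 ≤ inner ℝ (g : Lp ℝ 2 μ) (gf2 : Lp ℝ 2 μ) := by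
      rw [lp_inner_eq]
      refine integral_nonneg_of_ae ?_
      filter_upwards [hgf2, hf2M] with x h4 h5
      rw [h4, Pi.zero_apply, ← mul_assoc]
      exact mul_nonneg (mul_self_nonneg _) h5.1
    rw [hfg gf2] at h1
    have h4 := mul_le_mul_of_nonneg_left hAD (by positivity : 0 ≤ 2 * M)
    linarith
  have t3 : ∫ x, Γ.gamma f g x * (M ^ 2 - (f2 : Lp ℝ 2 μ) x) ∂μ
      = -(M ^ 2 * D ^ 2) - ∫ x, Γ.gamma f g x * (f2 : Lp ℝ 2 μ) x ∂μ := by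
    have h1 : ∫ x, Γ.gamma f g x ∂μ = -(D ^ 2) := by
      rw [Γ.integral_gamma_eq_form hmass hf hg hfg hgl, hfg g, real_inner_self_eq_norm_sq]
    have h2 : ∫ x, Γ.gamma f g x * (M ^ 2 - (f2 : Lp ℝ 2 μ) x) ∂μ
        = ∫ x, (Γ.gamma f g x * M ^ 2 - Γ.gamma f g x * (f2 : Lp ℝ 2 μ) x) ∂μ :=
      integral_congr_ae (ae_of_all _ fun x => by simp only; ring)
    rw [h2, integral_sub ((Γ.integrable_gamma f g).mul_const _) (Γ.integrable_gamma_mul f g hf2b),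
      integral_mul_const, h1]
    ring
  have t4 : -(K * ∫ x, Γ.gamma f f x * (M ^ 2 - (f2 : Lp ℝ 2 μ) x) ∂μ)
      ≤ |K| * (M ^ 2 * E.form f f) := by
    have h1 : ∫ x, Γ.gamma f f x ∂μ = E.form f f :=
      Γ.integral_gamma_eq_form hmass hf hf hfg hfg
    have h0 : 0 ≤ ∫ x, Γ.gamma f f x * (M ^ 2 - (f2 : Lp ℝ 2 μ) x) ∂μ := by
      refine integral_nonneg_of_ae ?_
      filter_upwards [hΓ0, hf2M] with x h2 h3
      exact mul_nonneg h2 (by linarith [h3.2])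
    have h2 : ∫ x, Γ.gamma f f x * (M ^ 2 - (f2 : Lp ℝ 2 μ) x) ∂μ ≤ M ^ 2 * E.form f f := by
      rw [← h1, ← integral_const_mul]
      refine integral_mono_ae (Γ.integrable_gamma_mul f f ((memLp_top_const _).sub hf2b))
        ((Γ.integrable_gamma f f).const_mul _) ?_
      filter_upwards [hΓ0, hf2M] with x h3 h4
      rw [mul_comm]
      exact mul_le_mul_of_nonneg_right (by linarith [h4.1]) h3
    calc _ ≤ |K| * ∫ x, Γ.gamma f f x * (M ^ 2 - (f2 : Lp ℝ 2 μ) x) ∂μ := by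
          rw [← neg_mul]
          exact mul_le_mul_of_nonneg_right (neg_le_abs K) h0
      _ ≤ _ := mul_le_mul_of_nonneg_left h2 (abs_nonneg K)
  rw [hR, t3] at hle
  have h5 : A ^ 2 ≤ 3 * (M * (A * D)) + M ^ 2 * D ^ 2 + |K| * (M ^ 2 * E.form f f) := by linarith
  -- `3 M A D ≤ A² / 2 + 9 M² D² / 2`
  have h6 : 3 * (M * (A * D)) ≤ A ^ 2 / 2 + 9 / 2 * (M ^ 2 * D ^ 2) := by
    nlinarith [sq_nonneg (A - 3 * (M * D))]
  nlinarith

/-- **Interpolation.** Under `BE(K, ∞)`, a bounded function of `𝔻` has `Γ(f) ∈ L²`, and the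
`L²` norm of `Γ(f)` is controlled by `‖f‖_∞`, `‖Δf‖` and the energy. -/
theorem BE.interpolation (hBE : Γ.BE K ∞) (hmass : E.MassPreserving) {f : E.domain}
    {k : Lp ℝ 2 μ} (hf : E.HasLaplacian f k) {M : ℝ} (hM0 : 0 ≤ M)
    (hM : ∀ᵐ x ∂μ, |(f : Lp ℝ 2 μ) x| ≤ M) :
    ∃ h : MemLp (Γ.gamma f f) 2 μ, ‖h.toLp _‖ ^ 2
      ≤ M ^ 2 * (11 * ‖k‖ ^ 2 + 2 * |K| * E.form f f) := by
  have hε : ∀ n : ℕ, 0 < 1 / ((n : ℝ) + 1) := one_div_add_one_pos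
  have hlim : Tendsto (fun n : ℕ => 1 / ((n : ℝ) + 1)) atTop (𝓝 0) :=
    tendsto_one_div_add_atTop_nhds_zero_nat
  obtain ⟨ns, -, hae⟩ := exists_subseq_tendsto_ae (Γ.tendsto_gamma_resolvent hf hε hlim)
  have hreg : ∀ n, ∃ h : MemLp (Γ.gamma (E.resolvent (hε n) f) (E.resolvent (hε n) f)) 2 μ,
      ‖h.toLp _‖ ^ 2 ≤ M ^ 2 * (11 * ‖k‖ ^ 2 + 2 * |K| * E.form f f) := by
    intro n
    have hL := HasLaplacian.resolvent E (hε n) hf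
    have hb : MemLp (E.resolvent (hε n) k : Lp ℝ 2 μ) ∞ μ := by
      have h1 := E.laplacian_resolvent (hε n) (f : Lp ℝ 2 μ)
      rw [hL.laplacian_eq] at h1
      have hfb : MemLp (f : Lp ℝ 2 μ) ∞ μ := memLp_top_of_abs_le hM
      have h2 : MemLp (((E.resolvent (hε n) f : Lp ℝ 2 μ) - f : Lp ℝ 2 μ)) ∞ μ :=
        (memLp_congr_ae (Lp.coeFn_sub _ _)).2 ((E.memLp_top_resolvent (hε n) hfb).sub hfb)
      rw [h1]
      exact (memLp_congr_ae (Lp.coeFn_smul _ _)).2 (h2.const_smul _)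
    obtain ⟨h, hle⟩ := hBE.interpolation_of_regular hmass hL
      (E.hasLaplacian_resolvent (hε n) k) hb hM0 (E.abs_resolvent_le (hε n) hM0 hM)
    refine ⟨h, hle.trans ?_⟩
    refine mul_le_mul_of_nonneg_left ?_ (sq_nonneg M)
    have h3 := pow_le_pow_left₀ (norm_nonneg _) (E.norm_resolvent_le (hε n) k) 2
    have h4 := mul_le_mul_of_nonneg_left (E.form_resolvent_le (hε n) f)
      (by positivity : 0 ≤ 2 * |K|)
    linarith
  choose hmem hle using hreg
  refine exists_memLp_of_tendsto_ae (h := fun i => (hmem (ns i)).toLp _) (fun i => hle (ns i)) ?_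
  filter_upwards [hae, ae_all_iff.2 fun n => (hmem n).coeFn_toLp] with x h1 h2
  refine h1.congr fun i => ?_
  rw [h2 (ns i)]

end CarreDuChamp

end DirichletForm

namespace DirichletForm

variable {X : Type*} [MeasurableSpace X] {μ : Measure X}

/-! ### Passage to the limit in the Bakry–Émery inequality -/

theorem HasLaplacian.sub {E : DirichletForm μ} {f g : E.domain} {k l : Lp ℝ 2 μ}
    (hf : E.HasLaplacian f k) (hg : E.HasLaplacian g l) : E.HasLaplacian (f - g) (k - l) := by
  intro v
  rw [map_sub, LinearMap.sub_apply, hf v, hg v, inner_sub_left]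
  ring

namespace CarreDuChamp

variable {E : DirichletForm μ} {Γ : E.CarreDuChamp} {K : ℝ}

theorem memLp_gamma {f g : E.domain} (hf : MemLp (Γ.gamma f f) 2 μ)
    (hg : MemLp (Γ.gamma g g) 2 μ) : MemLp (Γ.gamma f g) 2 μ := by
  refine (hf.add hg).mono (Lp.aestronglyMeasurable _) ?_
  filter_upwards [Γ.gamma_sq_le f g, Γ.nonneg f, Γ.nonneg g] with x h1 h2 h3
  rw [Pi.add_apply, Real.norm_eq_abs, Real.norm_eq_abs, ← sq_le_sq]
  nlinarith

/-- Cauchy–Schwarz inequality for the Carré du Champ, in `L²` norm. -/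
theorem norm_toLp_gamma_sq_le {f g : E.domain} (hf : MemLp (Γ.gamma f f) 2 μ)
    (hg : MemLp (Γ.gamma g g) 2 μ) (hfg : MemLp (Γ.gamma f g) 2 μ) :
    ‖hfg.toLp _‖ ^ 2 ≤ ‖hf.toLp _‖ * ‖hg.toLp _‖ := by
  refine le_trans ?_ (real_inner_le_norm _ _)
  rw [← real_inner_self_eq_norm_sq, lp_inner_eq, lp_inner_eq]
  refine integral_mono_ae (lp_integrable_mul _ _) (lp_integrable_mul _ _) ?_
  filter_upwards [hf.coeFn_toLp, hg.coeFn_toLp, hfg.coeFn_toLp, Γ.gamma_sq_le f g]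
    with x h1 h2 h3 h4
  rw [h1, h2, h3, ← sq]
  exact h4

/-- `BE(K, N)` implies `BE(K, ∞)`, since `ν ∫ (Δf)² φ ≥ 0`. -/
theorem BE.of_dimension {N : ℝ≥0∞} (hBE : Γ.BE K N) : Γ.BE K ∞ := by
  intro f φ hφ
  refine le_trans ?_ (hBE f φ hφ)
  have h : 0 ≤ ∫ x, (E.laplacian f x) ^ 2 * ((φ : E.domain) : Lp ℝ 2 μ) x ∂μ :=
    integral_nonneg_of_ae (hφ.mono fun x hx => mul_nonneg (sq_nonneg _) hx)
  have := mul_nonneg (ENNReal.toReal_nonneg (a := N⁻¹)) h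
  simpa using this

theorem resolvent_mem_boundedLaplacianDomain {f : E.domain} (hf : MemLp (f : Lp ℝ 2 μ) ∞ μ) {ε : ℝ}
    (hε : 0 < ε) : E.resolvent hε f ∈ E.boundedLaplacianDomain :=
  ⟨E.resolvent_mem hε _, E.memLp_top_resolvent hε hf⟩

/-- The Bakry–Émery inequality for `J_ε f`, `J_ε φ`, with `Γ(f, Δf)` integrated by parts. -/
theorem BE.apply_resolvent_resolvent {N : ℝ≥0∞} (hBE : Γ.BE K N) {f φ w : E.domain}
    {k l : Lp ℝ 2 μ} (hfk : E.HasLaplacian f k) (hφl : E.HasLaplacian φ l)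
    (hf : MemLp (f : Lp ℝ 2 μ) ∞ μ) (hφ : MemLp (φ : Lp ℝ 2 μ) ∞ μ)
    (hφ0 : ∀ᵐ x ∂μ, 0 ≤ (φ : Lp ℝ 2 μ) x) {ε : ℝ} (hε : 0 < ε)
    (hw : ∀ᵐ x ∂μ, (w : Lp ℝ 2 μ) x
      = (E.resolvent hε k : Lp ℝ 2 μ) x * (E.resolvent hε φ : Lp ℝ 2 μ) x) :
    K * ∫ x, Γ.gamma (E.resolvent hε f) (E.resolvent hε f) x
        * (E.resolvent hε φ : Lp ℝ 2 μ) x ∂μ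
      + N⁻¹.toReal * inner ℝ (E.resolvent hε k : Lp ℝ 2 μ) (w : Lp ℝ 2 μ)
      ≤ 1 / 2 * ∫ x, Γ.gamma (E.resolvent hε f) (E.resolvent hε f) x
          * (E.resolvent hε l : Lp ℝ 2 μ) x ∂μ
        + ∫ x, Γ.gamma (E.resolvent hε f) (E.resolvent hε φ) x
          * (E.resolvent hε k : Lp ℝ 2 μ) x ∂μ
        + inner ℝ (E.resolvent hε k : Lp ℝ 2 μ) (w : Lp ℝ 2 μ) := by
  have hL := HasLaplacian.resolvent E hε hfk
  have hLφ := HasLaplacian.resolvent E hε hφl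
  have h1 := hBE.apply_resolvent hL hε hφ hφ0
  have hfb := E.memLp_top_resolvent hε hf
  have hφb := E.memLp_top_resolvent hε hφ
  have hkb : MemLp (E.resolvent hε k : Lp ℝ 2 μ) ∞ μ := by
    rw [← hL.laplacian_eq, E.laplacian_resolvent]
    refine (memLp_congr_ae (Lp.coeFn_smul _ _)).2 (MemLp.const_smul ?_ _)
    exact (memLp_congr_ae (Lp.coeFn_sub _ _)).2 (hfb.sub hf)
  have h2 := Γ.integral_gamma_leibniz hfb hkb hφb hw
  rw [hL w] at h2
  have h3 : ∫ x, Γ.gamma (E.resolvent hε f) (E.resolvent hε f) x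
      * (ε⁻¹ * ((E.resolvent hε φ : Lp ℝ 2 μ) x - (φ : Lp ℝ 2 μ) x)) ∂μ
      = ∫ x, Γ.gamma (E.resolvent hε f) (E.resolvent hε f) x
          * (E.resolvent hε l : Lp ℝ 2 μ) x ∂μ := by
    refine integral_congr_ae ?_
    have h4 := E.laplacian_resolvent hε (φ : Lp ℝ 2 μ)
    rw [hLφ.laplacian_eq] at h4
    filter_upwards [Lp.coeFn_smul ε⁻¹ ((E.resolvent hε φ : Lp ℝ 2 μ) - (φ : Lp ℝ 2 μ)),
      Lp.coeFn_sub (E.resolvent hε φ : Lp ℝ 2 μ) (φ : Lp ℝ 2 μ)] with x h5 h6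
    rw [h4, h5, Pi.smul_apply, h6]
    rfl
  have h4 : ∫ x, (E.resolvent hε k : Lp ℝ 2 μ) x ^ 2 * (E.resolvent hε φ : Lp ℝ 2 μ) x ∂μ
      = inner ℝ (E.resolvent hε k : Lp ℝ 2 μ) (w : Lp ℝ 2 μ) := by
    rw [lp_inner_eq]
    exact integral_congr_ae (hw.mono fun x hx => by simp only [hx]; ring)
  rw [h3, h4] at h1
  linarith

variable [SigmaFinite μ]

theorem BE.memLp_gamma (hBE : Γ.BE K ∞) (hmass : E.MassPreserving) {f g : E.domain}
    (hf : f ∈ E.boundedLaplacianDomain) (hg : g ∈ E.boundedLaplacianDomain) :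
    MemLp (Γ.gamma f g) 2 μ := by
  have h : ∀ f ∈ E.boundedLaplacianDomain, MemLp (Γ.gamma f f) 2 μ := by
    rintro f ⟨⟨k, hk⟩, hfb⟩
    obtain ⟨M, hM, hfM⟩ := exists_abs_le hfb
    exact (hBE.interpolation hmass hk hM.le hfM).choose
  exact CarreDuChamp.memLp_gamma (h f hf) (h g hg)

/-- Convergence in `L²` of the Carré du Champ along the resolvents, a consequence of the
interpolation estimate for `J_ε f - f`. -/
theorem BE.tendsto_toLp_gamma (hBE : Γ.BE K ∞) (hmass : E.MassPreserving) {f φ : E.domain}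
    (hf : f ∈ E.boundedLaplacianDomain) (hφ : φ ∈ E.boundedLaplacianDomain)
    {ε : ℕ → ℝ} (hε : ∀ n, 0 < ε n) (hlim : Tendsto ε atTop (𝓝 0)) :
    Tendsto (fun n => (hBE.memLp_gamma hmass
        (resolvent_mem_boundedLaplacianDomain hf.2 (hε n))
        (resolvent_mem_boundedLaplacianDomain hφ.2 (hε n))).toLp _) atTop
      (𝓝 ((hBE.memLp_gamma hmass hf hφ).toLp _)) := by
  -- the norm of `Γ(J_ε a - a, b)` tends to `0`, uniformly for `b` with `‖Γ(b)‖` bounded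
  have key : ∀ a ∈ E.boundedLaplacianDomain, ∀ C : ℝ, 0 ≤ C → ∃ r : ℕ → ℝ, Tendsto r atTop (𝓝 0) ∧
      ∀ (n : ℕ) (b : E.domain) (hb : MemLp (Γ.gamma b b) 2 μ), ‖hb.toLp _‖ ^ 2 ≤ C →
        ∃ h : MemLp (Γ.gamma (E.resolvent (hε n) a - a) b) 2 μ, ‖h.toLp _‖ ≤ r n := by
    rintro a ⟨⟨k, hk⟩, hab⟩ C hC
    obtain ⟨M, hM, haM⟩ := exists_abs_le hab
    set s : ℕ → ℝ := fun n => (2 * M) ^ 2 * (11 * ‖(E.resolvent (hε n) k : Lp ℝ 2 μ) - k‖ ^ 2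
      + 2 * |K| * (ε n * ‖k‖ ^ 2)) with hs
    have hslim : Tendsto s atTop (𝓝 0) := by
      have h1 := (tendsto_iff_norm_sub_tendsto_zero.1 (E.tendsto_resolvent hε hlim k)).pow 2
      have h2 := hlim.mul_const (‖k‖ ^ 2)
      simpa using ((h1.const_mul 11).add (h2.const_mul (2 * |K|))).const_mul ((2 * M) ^ 2)
    refine ⟨fun n => √(√(s n) * √C), by simpa using (hslim.sqrt.mul_const (√C)).sqrt, ?_⟩
    intro n b hb hbC
    have hL := (HasLaplacian.resolvent E (hε n) hk).sub hk
    have hbd : ∀ᵐ x ∂μ, |((E.resolvent (hε n) a - a : E.domain) : Lp ℝ 2 μ) x| ≤ 2 * M := by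
      filter_upwards [haM, E.abs_resolvent_le (hε n) hM.le haM,
        Lp.coeFn_sub (E.resolvent (hε n) a : Lp ℝ 2 μ) (a : Lp ℝ 2 μ)] with x h1 h2 h3
      rw [Submodule.coe_sub, h3, Pi.sub_apply]
      exact (abs_sub _ _).trans (by linarith)
    obtain ⟨hm, hle⟩ := hBE.interpolation hmass hL (by positivity) hbd
    have hle' : ‖hm.toLp _‖ ^ 2 ≤ s n := by
      refine hle.trans (mul_le_mul_of_nonneg_left ?_ (sq_nonneg _))
      have := mul_le_mul_of_nonneg_left (E.form_resolvent_sub_self_le (hε n) hk)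
        (by positivity : 0 ≤ 2 * |K|)
      linarith
    refine ⟨CarreDuChamp.memLp_gamma hm hb, Real.le_sqrt_of_sq_le ?_⟩
    refine (norm_toLp_gamma_sq_le hm hb _).trans ?_
    exact mul_le_mul (Real.le_sqrt_of_sq_le hle') (Real.le_sqrt_of_sq_le hbC) (norm_nonneg _)
      (Real.sqrt_nonneg _)
  -- uniform bound of `Γ(J_ε φ)` in `L²`
  obtain ⟨C, hC0, hC⟩ : ∃ C : ℝ, 0 ≤ C ∧ ∀ n, ∃ h : MemLp (Γ.gamma (E.resolvent (hε n) φ)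
      (E.resolvent (hε n) φ)) 2 μ, ‖h.toLp _‖ ^ 2 ≤ C := by
    obtain ⟨⟨l, hl⟩, hφb⟩ := hφ
    obtain ⟨N, hN, hφN⟩ := exists_abs_le hφb
    have hnn := E.nonneg φ
    refine ⟨N ^ 2 * (11 * ‖l‖ ^ 2 + 2 * |K| * E.form φ φ), by positivity, fun n => ?_⟩
    obtain ⟨h, hle⟩ := hBE.interpolation hmass (HasLaplacian.resolvent E (hε n) hl) hN.le
      (E.abs_resolvent_le (hε n) hN.le hφN)
    refine ⟨h, hle.trans (mul_le_mul_of_nonneg_left ?_ (sq_nonneg N))⟩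
    have h3 := pow_le_pow_left₀ (norm_nonneg _) (E.norm_resolvent_le (hε n) l) 2
    have h4 := mul_le_mul_of_nonneg_left (E.form_resolvent_le (hε n) φ)
      (by positivity : 0 ≤ 2 * |K|)
    linarith
  obtain ⟨r, hr, hr'⟩ := key f hf C hC0
  obtain ⟨q, hq, hq'⟩ := key φ hφ (‖(hBE.memLp_gamma hmass hf hf).toLp _‖ ^ 2) (sq_nonneg _)
  rw [tendsto_iff_norm_sub_tendsto_zero]
  refine squeeze_zero (fun _ => norm_nonneg _) (fun n => ?_) (by simpa using hr.add hq)
  obtain ⟨h1, h1'⟩ := hC n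
  obtain ⟨h2, h2'⟩ := hr' n _ h1 h1'
  obtain ⟨h3, h3'⟩ := hq' n f (hBE.memLp_gamma hmass hf hf) le_rfl
  have e : (hBE.memLp_gamma hmass (resolvent_mem_boundedLaplacianDomain hf.2 (hε n))
        (resolvent_mem_boundedLaplacianDomain hφ.2 (hε n))).toLp _
      - (hBE.memLp_gamma hmass hf hφ).toLp _ = h2.toLp _ + h3.toLp _ := by
    rw [← MemLp.toLp_sub, ← MemLp.toLp_add]
    refine (MemLp.toLp_eq_toLp_iff _ _).2 ?_
    have e1 := Γ.gamma_sub_eq (E.resolvent (hε n) f) f (E.resolvent (hε n) φ) φ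
    rw [Γ.symm f (E.resolvent (hε n) φ - φ)] at e1
    filter_upwards [Lp.coeFn_sub (Γ.gamma (E.resolvent (hε n) f) (E.resolvent (hε n) φ))
        (Γ.gamma f φ), Lp.coeFn_add (Γ.gamma (E.resolvent (hε n) f - f) (E.resolvent (hε n) φ))
        (Γ.gamma (E.resolvent (hε n) φ - φ) f)] with x g1 g2
    rw [← g1, e1, g2]
  rw [e]
  exact (norm_add_le _ _).trans (add_le_add h2' h3')

/-- The inequality of `BE(K, N)` for arbitrary bounded functions of `𝔻`. -/
theorem BE.weak_inequality {N : ℝ≥0∞} (hBE : Γ.BE K N) (hmass : E.MassPreserving)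
    {f φ : E.domain} (hf : f ∈ E.boundedLaplacianDomain) (hφ : φ ∈ E.boundedLaplacianDomain)
    (hφ0 : ∀ᵐ x ∂μ, 0 ≤ (φ : Lp ℝ 2 μ) x) :
    K * ∫ x, Γ.gamma f f x * (φ : Lp ℝ 2 μ) x ∂μ
      + N⁻¹.toReal * ∫ x, (E.laplacian f x) ^ 2 * (φ : Lp ℝ 2 μ) x ∂μ
      ≤ 1 / 2 * ∫ x, Γ.gamma f f x * E.laplacian φ x ∂μ
        + ∫ x, Γ.gamma f φ x * E.laplacian f x ∂μ
        + ∫ x, (E.laplacian f x) ^ 2 * (φ : Lp ℝ 2 μ) x ∂μ := by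
  have hBE' := hBE.of_dimension
  set k := E.laplacian f with hk
  set l := E.laplacian φ with hl
  have hfk : E.HasLaplacian f k := E.hasLaplacian_laplacian hf.1
  have hφl : E.HasLaplacian φ l := E.hasLaplacian_laplacian hφ.1
  obtain ⟨B, hB, hφB⟩ := exists_abs_le hφ.2
  -- a sequence `ε → 0` along which `J_ε φ → φ` a.e.
  obtain ⟨ns, hns, hae⟩ := exists_subseq_tendsto_ae
    (E.tendsto_resolvent one_div_add_one_pos tendsto_one_div_add_atTop_nhds_zero_nat
      (φ : Lp ℝ 2 μ))
  set ε : ℕ → ℝ := fun i => 1 / ((ns i : ℝ) + 1) with hεdef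
  have hε : ∀ i, 0 < ε i := fun i => one_div_add_one_pos _
  have hlim : Tendsto ε atTop (𝓝 0) :=
    tendsto_one_div_add_atTop_nhds_zero_nat.comp hns.tendsto_atTop
  have hφn : ∀ i, ∀ᵐ x ∂μ, |(E.resolvent (hε i) φ : Lp ℝ 2 μ) x| ≤ B := fun i =>
    E.abs_resolvent_le (hε i) hB.le hφB
  have hkb : ∀ i, MemLp (E.resolvent (hε i) k : Lp ℝ 2 μ) ∞ μ := fun i => by
    rw [← (HasLaplacian.resolvent E (hε i) hfk).laplacian_eq, E.laplacian_resolvent]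
    refine (memLp_congr_ae (Lp.coeFn_smul _ _)).2 (MemLp.const_smul ?_ _)
    exact (memLp_congr_ae (Lp.coeFn_sub _ _)).2 ((E.memLp_top_resolvent (hε i) hf.2).sub hf.2)
  choose w hw using fun i => E.exists_mul_mem (hkb i) (E.memLp_top_resolvent (hε i) hφ.2)
  have hkφ : ∀ ψ : Lp ℝ 2 μ, (∀ᵐ x ∂μ, |ψ x| ≤ B) → MemLp (fun x => k x * ψ x) 2 μ := by
    intro ψ hψ
    refine ((Lp.memLp k).const_mul B).mono
      ((Lp.aestronglyMeasurable _).mul (Lp.aestronglyMeasurable _)) ?_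
    filter_upwards [hψ] with x hx
    rw [norm_mul, norm_mul, mul_comm, Real.norm_eq_abs B, abs_of_pos hB]
    exact mul_le_mul_of_nonneg_right hx (norm_nonneg _)
  set v : Lp ℝ 2 μ := (hkφ _ hφB).toLp _ with hv
  have hvae : ∀ᵐ x ∂μ, v x = k x * (φ : Lp ℝ 2 μ) x := (hkφ _ hφB).coeFn_toLp
  have hJk : Tendsto (fun i => (E.resolvent (hε i) k : Lp ℝ 2 μ)) atTop (𝓝 k) :=
    E.tendsto_resolvent hε hlim k
  have hJl : Tendsto (fun i => (E.resolvent (hε i) l : Lp ℝ 2 μ)) atTop (𝓝 l) :=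
    E.tendsto_resolvent hε hlim l
  have hJφ : Tendsto (fun i => (E.resolvent (hε i) φ : Lp ℝ 2 μ)) atTop (𝓝 (φ : Lp ℝ 2 μ)) :=
    E.tendsto_resolvent hε hlim _
  -- convergence of `Δ(J_ε f) J_ε φ`
  have hwlim : Tendsto (fun i => (w i : Lp ℝ 2 μ)) atTop (𝓝 v) := by
    have h1 : Tendsto (fun i => (hkφ _ (hφn i)).toLp _) atTop (𝓝 v) :=
      tendsto_lp_mul_of_bounded (fun i => Lp.aestronglyMeasurable _) (Lp.aestronglyMeasurable _)
        hφn hφB hae (fun i => (hkφ _ (hφn i)).coeFn_toLp) hvae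
    have h2 : Tendsto (fun i => (w i : Lp ℝ 2 μ) - (hkφ _ (hφn i)).toLp _) atTop (𝓝 0) := by
      rw [tendsto_zero_iff_norm_tendsto_zero]
      refine squeeze_zero (fun _ => norm_nonneg _) (fun i => ?_)
        (by simpa using (tendsto_iff_norm_sub_tendsto_zero.1 hJk).const_mul B)
      refine Lp.norm_le_mul_norm_of_ae_le_mul ?_
      filter_upwards [hw i, (hkφ _ (hφn i)).coeFn_toLp, hφn i,
        Lp.coeFn_sub (w i : Lp ℝ 2 μ) ((hkφ _ (hφn i)).toLp _),
        Lp.coeFn_sub (E.resolvent (hε i) k : Lp ℝ 2 μ) k] with x g1 g2 g3 g4 g5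
      rw [g4, g5, Pi.sub_apply, Pi.sub_apply, g1, g2, ← sub_mul, norm_mul, mul_comm]
      exact mul_le_mul_of_nonneg_right g3 (norm_nonneg _)
    simpa using h2.add h1
  have hP := hBE'.tendsto_toLp_gamma hmass hf hf hε hlim
  have hQ := hBE'.tendsto_toLp_gamma hmass hf hφ hε hlim
  have hint : ∀ {a b : E.domain} (h : MemLp (Γ.gamma a b) 2 μ) (u : Lp ℝ 2 μ),
      ∫ x, Γ.gamma a b x * u x ∂μ = inner ℝ (h.toLp _) u := by
    intro a b h u
    rw [lp_inner_eq]
    exact integral_congr_ae (h.coeFn_toLp.mono fun x hx => by simp only [hx])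
  have hkv : ∫ x, k x ^ 2 * (φ : Lp ℝ 2 μ) x ∂μ = inner ℝ k v := by
    rw [lp_inner_eq]
    exact integral_congr_ae (hvae.mono fun x hx => by simp only [hx]; ring)
  have key := fun i => hBE.apply_resolvent_resolvent hfk hφl hf.2 hφ.2 hφ0 (hε i) (hw i)
  rw [hint (hBE'.memLp_gamma hmass hf hf), hint (hBE'.memLp_gamma hmass hf hf),
    hint (hBE'.memLp_gamma hmass hf hφ), hkv]
  refine le_of_tendsto_of_tendsto'
    (((hP.inner hJφ).const_mul K).add ((hJk.inner hwlim).const_mul N⁻¹.toReal))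
    ((((hP.inner hJl).const_mul (1 / 2)).add (hQ.inner hJk)).add (hJk.inner hwlim)) fun i => ?_
  have := key i
  rwa [hint (hBE'.memLp_gamma hmass (resolvent_mem_boundedLaplacianDomain hf.2 (hε i))
      (resolvent_mem_boundedLaplacianDomain hf.2 (hε i))),
    hint (hBE'.memLp_gamma hmass (resolvent_mem_boundedLaplacianDomain hf.2 (hε i))
      (resolvent_mem_boundedLaplacianDomain hf.2 (hε i))),
    hint (hBE'.memLp_gamma hmass (resolvent_mem_boundedLaplacianDomain hf.2 (hε i))
      (resolvent_mem_boundedLaplacianDomain hφ.2 (hε i)))] at this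

theorem BE.integrable_gamma_mul_lp (hBE : Γ.BE K ∞) (hmass : E.MassPreserving) {f g : E.domain}
    (hf : f ∈ E.boundedLaplacianDomain) (hg : g ∈ E.boundedLaplacianDomain) (h : Lp ℝ 2 μ) :
    Integrable (fun x => Γ.gamma f g x * h x) μ :=
  (hBE.memLp_gamma hmass hf hg).integrable_mul (Lp.memLp h)

end CarreDuChamp

end DirichletForm

theorem mainTheorem11 {X : Type*} [TopologicalSpace X] [PolishSpace X] [MeasurableSpace X]
    [BorelSpace X] (μ : Measure X) [SigmaFinite μ] [μ.IsOpenPosMeasure]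
    (E : DirichletForm μ) (hloc : E.StronglyLocal) (hmass : E.MassPreserving)
    (Γ : E.CarreDuChamp) (K : ℝ) :
    (Γ.BE K ∞ →
      ∀ f ∈ E.boundedLaplacianDomain, ∀ g ∈ E.boundedLaplacianDomain,
      ∀ φ ∈ E.boundedLaplacianDomain,
        Integrable (fun x => Γ.gamma f g x * E.laplacian φ x) μ ∧
        Integrable (fun x => E.laplacian f x * Γ.gamma g φ x) μ ∧
        Integrable (fun x => E.laplacian g x * Γ.gamma f φ x) μ ∧
        Integrable
          (fun x => 2 * (φ : Lp ℝ 2 μ) x * E.laplacian f x * E.laplacian g x) μ) ∧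
    (∀ N : ℝ≥0∞, 1 ≤ N → Γ.BE K N →
      ∀ f ∈ E.boundedLaplacianDomain, ∀ φ ∈ E.boundedLaplacianDomain,
        (∀ᵐ x ∂μ, 0 ≤ (φ : Lp ℝ 2 μ) x) →
        Integrable (fun x => (1 / 2) * Γ.gamma f f x * E.laplacian φ x
          + E.laplacian f x * Γ.gamma f φ x
          + (φ : Lp ℝ 2 μ) x * (E.laplacian f x) ^ 2) μ ∧
        Integrable (fun x => Γ.gamma f f x * (φ : Lp ℝ 2 μ) x) μ ∧
        Integrable (fun x => (E.laplacian f x) ^ 2 * (φ : Lp ℝ 2 μ) x) μ ∧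
        K * ∫ x, Γ.gamma f f x * (φ : Lp ℝ 2 μ) x ∂μ
            + N⁻¹.toReal * ∫ x, (E.laplacian f x) ^ 2 * (φ : Lp ℝ 2 μ) x ∂μ
          ≤ ∫ x, ((1 / 2) * Γ.gamma f f x * E.laplacian φ x
            + E.laplacian f x * Γ.gamma f φ x
            + (φ : Lp ℝ 2 μ) x * (E.laplacian f x) ^ 2) ∂μ) := by
  refine ⟨fun hBE f hf g hg φ hφ => ⟨?_, ?_, ?_, ?_⟩, fun N _ hBE f hf φ hφ hφ0 => ?_⟩
  · exact hBE.integrable_gamma_mul_lp hmass hf hg _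
  · simpa only [mul_comm] using hBE.integrable_gamma_mul_lp hmass hg hφ (E.laplacian f)
  · simpa only [mul_comm] using hBE.integrable_gamma_mul_lp hmass hf hφ (E.laplacian g)
  · refine (DirichletForm.integrable_mul_of_memLp_top
      (DirichletForm.lp_integrable_mul (E.laplacian f) (E.laplacian g)) (hφ.2.const_mul 2)).congr
      (ae_of_all _ fun x => ?_)
    simp only
    ring
  · have hBE' := hBE.of_dimension
    have i1 := hBE'.integrable_gamma_mul_lp hmass hf hf (E.laplacian φ)
    have i2 := hBE'.integrable_gamma_mul_lp hmass hf hφ (E.laplacian f)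
    have i3 : Integrable (fun x => (E.laplacian f x) ^ 2 * (φ : Lp ℝ 2 μ) x) μ := by
      simpa only [sq] using DirichletForm.integrable_mul_of_memLp_top
        (DirichletForm.lp_integrable_mul (E.laplacian f) (E.laplacian f)) hφ.2
    have e : (fun x => (1 / 2) * Γ.gamma f f x * E.laplacian φ x
        + E.laplacian f x * Γ.gamma f φ x + (φ : Lp ℝ 2 μ) x * (E.laplacian f x) ^ 2)
        = fun x => 1 / 2 * (Γ.gamma f f x * E.laplacian φ x)
          + Γ.gamma f φ x * E.laplacian f x + (E.laplacian f x) ^ 2 * (φ : Lp ℝ 2 μ) x := by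
      funext x
      ring
    have i12 : Integrable (fun x => 1 / 2 * (Γ.gamma f f x * E.laplacian φ x)
        + Γ.gamma f φ x * E.laplacian f x) μ := (i1.const_mul _).add i2
    rw [e]
    refine ⟨i12.add i3, Γ.integrable_gamma_mul f f hφ.2, i3, ?_⟩
    rw [integral_add i12 i3, integral_add (i1.const_mul _) i2, integral_const_mul]
    exact hBE.weak_inequality hmass hf hφ hφ0
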